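/- Let $G=(V,E)$ be a finite directed graph (self-loops allowed) and let $v_0\in V$ be a node from which at least one infinite path starts. Let $\lambda>0$, $0<\gamma<1$ and $\varepsilon>0$ be rational numbers. For an infinite path $\pi=\pi[0],\pi[1],\dots$ let $\mathrm{Last}_\pi(t,v)=\min\big(\{t+1\}\cup\{t-j : j<t,\ \pi[j]=v\}\big)$ and write $\ell_t=\mathrm{Last}_\pi(t,\pi[t])$. Let $$r_{\mathrm{av}}(\pi)=\liminf_{N\to\infty}\frac1{N+1}\sum_{t=0}^N\sum_{j=0}^{\ell_t-1}\gamma^j\lambda ,\qquad R_{\mathrm{av}}(v_0)=\sup\{r_{\mathrm{av}}(\pi) : \pi \text{ an infinite path with } \pi[0]=v_0\}$$ be the limit-average expected reward of $\pi$ and the reward value of $v_0$. For $K\in\mathbb N$ let $$\underline r_{\mathrm{av}}(\pi,K)=\frac{\lambda}{1-\gamma}\Big(1-\limsup_{N\to\infty}\frac1{N+1}\sum_{t=0}^N\gamma^{\min\{K,\ell_t\}}\Big),\qquad \overline r_{\mathrm{av}}(\pi,K)=\frac{\lambda}{1-\gamma}\Big(1-\limsup_{N\to\infty}\frac1{N+1}\sum_{\substack{0\le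 t\le N\\ \ell_t\le K}}\gamma^{\ell_t}\Big)$$ be the $K$-truncated under- and over-approximations of $r_{\mathrm{av}}(\pi)$. Let $K=\max\{0,\lceil \ln[\varepsilon(1-\gamma)/\lambda]/\ln\gamma\rceil\}$. There is an algorithm that, given $G$, $v_0$, $\lambda$, $\gamma$ and $\varepsilon$, computes two infinite paths $\pi_{\mathrm{under}}$ and $\pi_{\mathrm{over}}$ from $v_0$ (as ultimately periodic sequences) together with the exact values $r_{\mathrm{av}}(\pi_{\mathrm{under}})$, $r_{\mathrm{av}}(\pi_{\mathrm{over}})$, $\underline r_{\mathrm{av}}(\pi_{\mathrm{under}},K)$ and $\overline r_{\mathrm{av}}(\pi_{\mathrm{over}},K)$, such that $$\underline r_{\mathrm{av}}(\pi_{\mathrm{under}},K)\le r_{\mathrm{av}}(\pi_{\mathrm{under}})\le R_{\mathrm{av}}(v_0)\le \overline r_{\mathrm{av}}(\pi_{\mathrm{over}},K),\qquad \overline r_{\mathrm{av}}(\pi_{\mathrm{over}},K)-\underline r_{\mathrm{av}}(\pi_{\mathrm{under}},K)\le\varepsilon ,$$ and $r_{\mathrm{av}}(\pi_{\mathrm{over}})\ge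 R_{\mathrm{av}}(v_0)-\varepsilon$; in particular both paths are $\varepsilon$-optimal. The number of steps of the algorithm (arithmetic operations on rational numbers, comparisons and memory accesses of a random-access machine) is bounded by a polynomial in $|V|(K+1)^{|V|}$, and the bit lengths of all numbers that it computes are bounded by a polynomial in $|V|(K+1)^{|V|}$ and the bit lengths of $\lambda,\gamma,\varepsilon$. -/

import Mathlib

open Filter MeasureTheory

namespace RobotRouting

/-! ## Paths, collected rewards and the reward value -/

section Rewards

variable {V : Type*}

/-- `π` is an infinite path of the directed graph `G` that starts at `v`. -/
def IsPathFrom (G : Digraph V) (v : V) (π : ℕ → V) : Prop :=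
  π 0 = v ∧ ∀ i, G.Adj (π i) (π (i + 1))

/-- `Last_π(t, v) = min (t + 1, {t - j | j < t, π[j] = v})`: the time elapsed at time `t` since the
previous visit to `v`, and `t + 1` if `v` has not been visited before time `t`. -/
noncomputable def last (π : ℕ → V) (t : ℕ) (v : V) : ℕ :=
  sInf (insert (t + 1) {d | ∃ j, j < t ∧ π j = v ∧ d = t - j})

/-- The expected reward collected by the robot at times `0, …, N`: on arriving at `π t` at time `t`
it collects the rewards (of expected value `lam` each) that were generated at that node at the times
`t - j`, `j < Last_π(t, π t)`, each decayed by the factor `gam ^ j`. -/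
noncomputable def rSum (lam gam : ℝ) (π : ℕ → V) (N : ℕ) : ℝ :=
  ∑ t ∈ Finset.range (N + 1), ∑ j ∈ Finset.range (last π t (π t)), gam ^ j * lam

/-- The limit-average expected reward of an infinite path. -/
noncomputable def rAv (lam gam : ℝ) (π : ℕ → V) : ℝ :=
  liminf (fun N : ℕ => rSum lam gam π N / ((N : ℝ) + 1)) atTop

/-- The infinite-horizon reward value of the node `v`: the supremum of the limit-average expected
rewards of the infinite paths from `v`. -/
noncomputable def RAv (G : Digraph V) (lam gam : ℝ) (v : V) : ℝ :=
  sSup {r | ∃ π, IsPathFrom G v π ∧ r = rAv lam gam π}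

/-- `rSum` is the expectation of the reward that is actually collected, whenever `ξ t v`, the random
reward generated at node `v` at time `t`, has expected value `lam`. -/
theorem integral_collected_eq_rSum {Ω : Type*} [MeasurableSpace Ω] (μ : Measure Ω)
    (ξ : ℕ → V → Ω → ℝ) (lam gam : ℝ) (hξ : ∀ t v, Integrable (ξ t v) μ)
    (hmean : ∀ t v, ∫ ω, ξ t v ω ∂μ = lam) (π : ℕ → V) (N : ℕ) :
    ∫ ω, ∑ t ∈ Finset.range (N + 1), ∑ j ∈ Finset.range (last π t (π t)),
      gam ^ j * ξ (t - j) (π t) ω ∂μ = rSum lam gam π N := by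
  rw [integral_finsetSum _ fun t _ => integrable_finsetSum _ fun j _ => (hξ _ _).const_mul _]
  refine Finset.sum_congr rfl fun t _ => ?_
  rw [integral_finsetSum _ fun j _ => (hξ _ _).const_mul _]
  refine Finset.sum_congr rfl fun j _ => ?_
  rw [integral_const_mul, hmean]

/-! The truncated cost functions and the corresponding approximate rewards.  The exact
limit-average reward is `lam / (1 - gam) * (1 - c)`, where `c` is the limit superior of the averages
of the costs `gam ^ Last_π(t, π t)`. -/

/-- The upper truncated cost: a visit whose predecessor is more than `K` steps back costs `gam ^ K`.
-/
noncomputable def cSumUpper (gam : ℝ) (K : ℕ) (π : ℕ → V) (N : ℕ) : ℝ :=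
  ∑ t ∈ Finset.range (N + 1), gam ^ min K (last π t (π t))

/-- The lower truncated cost: a visit whose predecessor is more than `K` steps back costs `0`. -/
noncomputable def cSumLower (gam : ℝ) (K : ℕ) (π : ℕ → V) (N : ℕ) : ℝ :=
  ∑ t ∈ Finset.range (N + 1), if last π t (π t) ≤ K then gam ^ last π t (π t) else 0

/-- The `K`-truncated under-approximation of the limit-average reward of a path. -/
noncomputable def rAvUnder (lam gam : ℝ) (K : ℕ) (π : ℕ → V) : ℝ :=
  lam / (1 - gam) -
    lam / (1 - gam) * limsup (fun N : ℕ => cSumUpper gam K π N / ((N : ℝ) + 1)) atTop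

/-- The `K`-truncated over-approximation of the limit-average reward of a path. -/
noncomputable def rAvOver (lam gam : ℝ) (K : ℕ) (π : ℕ → V) : ℝ :=
  lam / (1 - gam) -
    lam / (1 - gam) * limsup (fun N : ℕ => cSumLower gam K π N / ((N : ℝ) + 1)) atTop

/-- The truncation bound: the least natural number `K ≥ ln (eps (1 - gam) / lam) / ln gam`. -/
noncomputable def truncBound (lam gam eps : ℝ) : ℕ :=
  ⌈Real.log (eps * (1 - gam) / lam) / Real.log gam⌉₊

end Rewards

/-! ## A random-access machine with a step count -/

/-- The memory of the machine: registers and arrays (each array is named by a number), which hold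
rational numbers.  A program mentions only finitely many registers and arrays. -/
structure State where
  reg : ℕ → ℚ
  arr : ℕ → ℕ → ℚ

/-- Write `x` into register `i`. -/
def State.setReg (s : State) (i : ℕ) (x : ℚ) : State :=
  { s with reg := Function.update s.reg i x }

/-- Write `x` into cell `m` of array `a`. -/
def State.setArr (s : State) (a m : ℕ) (x : ℚ) : State :=
  { s with arr := Function.update s.arr a (Function.update (s.arr a) m x) }

/-- The programs of the machine. -/
inductive Prog : Type
  /-- do nothing -/
  | skip : Prog
  /-- `reg i := q` -/
  | const (i : ℕ) (q : ℚ) : Prog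
  /-- `reg i := reg j + reg k` -/
  | plus (i j k : ℕ) : Prog
  /-- `reg i := reg j - reg k` -/
  | minus (i j k : ℕ) : Prog
  /-- `reg i := reg j * reg k` -/
  | times (i j k : ℕ) : Prog
  /-- `reg i := reg j / reg k` -/
  | divide (i j k : ℕ) : Prog
  /-- `reg i := arr a [reg j]` -/
  | load (i a j : ℕ) : Prog
  /-- `arr a [reg j] := reg i` -/
  | store (a j i : ℕ) : Prog
  /-- run `p`, then `q` -/
  | seq (p q : Prog) : Prog
  /-- if `reg j ≤ reg k` then run `p`, else run `q` -/
  | branch (j k : ℕ) (p q : Prog) : Prog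
  /-- while `reg j ≤ reg k` run `p` -/
  | loop (j k : ℕ) (p : Prog) : Prog

/-- The bit length of a rational number: that of its numerator plus that of its denominator. -/
def bitLen (q : ℚ) : ℕ := Nat.size q.num.natAbs + Nat.size q.den

/-- `Exec p s s' t b`: started in the memory `s`, the program `p` halts in the memory `s'`, after
exactly `t` elementary steps (arithmetic operations, memory accesses and comparisons), and the
largest bit length of a number written on the way is `b`.  There is no rounding operation, and a
program that divides by zero or uses an address that is not a natural number does not halt. -/
inductive Exec : Prog → State → State → ℕ → ℕ → Prop
  | skip (s : State) : Exec .skip s s 1 0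
  | const (s : State) (i : ℕ) (q : ℚ) : Exec (.const i q) s (s.setReg i q) 1 (bitLen q)
  | plus (s : State) (i j k : ℕ) :
      Exec (.plus i j k) s (s.setReg i (s.reg j + s.reg k)) 1 (bitLen (s.reg j + s.reg k))
  | minus (s : State) (i j k : ℕ) :
      Exec (.minus i j k) s (s.setReg i (s.reg j - s.reg k)) 1 (bitLen (s.reg j - s.reg k))
  | times (s : State) (i j k : ℕ) :
      Exec (.times i j k) s (s.setReg i (s.reg j * s.reg k)) 1 (bitLen (s.reg j * s.reg k))
  | divide (s : State) (i j k : ℕ) (h : s.reg k ≠ 0) :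
      Exec (.divide i j k) s (s.setReg i (s.reg j / s.reg k)) 1 (bitLen (s.reg j / s.reg k))
  | load (s : State) (i a j m : ℕ) (h : s.reg j = m) :
      Exec (.load i a j) s (s.setReg i (s.arr a m)) 1 (bitLen (s.arr a m))
  | store (s : State) (a j i m : ℕ) (h : s.reg j = m) :
      Exec (.store a j i) s (s.setArr a m (s.reg i)) 1 (bitLen (s.reg i))
  | seq {p q : Prog} {s s' s'' : State} {t t' b b' : ℕ} (hp : Exec p s s' t b)
      (hq : Exec q s' s'' t' b') : Exec (.seq p q) s s'' (t + t') (max b b')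
  | branch_true {j k : ℕ} {p q : Prog} {s s' : State} {t b : ℕ} (h : s.reg j ≤ s.reg k)
      (hp : Exec p s s' t b) : Exec (.branch j k p q) s s' (t + 1) b
  | branch_false {j k : ℕ} {p q : Prog} {s s' : State} {t b : ℕ} (h : ¬ s.reg j ≤ s.reg k)
      (hq : Exec q s s' t b) : Exec (.branch j k p q) s s' (t + 1) b
  | loop_done {j k : ℕ} {p : Prog} {s : State} (h : ¬ s.reg j ≤ s.reg k) :
      Exec (.loop j k p) s s 1 0
  | loop_next {j k : ℕ} {p : Prog} {s s' s'' : State} {t t' b b' : ℕ} (h : s.reg j ≤ s.reg k)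
      (hp : Exec p s s' t b) (hl : Exec (.loop j k p) s' s'' t' b') :
      Exec (.loop j k p) s s'' (t + t' + 1) (max b b')

/-! ## Input and output conventions -/

open Classical in
/-- The initial memory for the graph `G` on the nodes `0, …, n - 1`: registers `0, …, 4` hold `n`,
the initial node, `lam`, `gam` and `eps`, array `0` holds the adjacency matrix of `G` row by row,
and everything else is `0`. -/
noncomputable def inputState {n : ℕ} (G : Digraph (Fin n)) (v₀ : Fin n) (lam gam eps : ℚ) :
    State where
  reg := fun i =>
    if i = 0 then (n : ℚ) else if i = 1 then ((v₀ : ℕ) : ℚ) else if i = 2 then lam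
    else if i = 3 then gam else if i = 4 then eps else 0
  arr := fun a m =>
    if a = 0 ∧ ∃ i j : Fin n, m = (i : ℕ) * n + (j : ℕ) ∧ G.Adj i j then 1 else 0

/-- The memory `s` describes the infinite path `π` as an ultimately periodic sequence: registers `i`
and `j` hold the lengths `p` and `q > 0` of the initial part and of the period, and array `a` lists
the nodes of the initial part followed by those of the period. -/
def OutputsPath {n : ℕ} (s : State) (i j a : ℕ) (π : ℕ → Fin n) : Prop :=
  ∃ p q : ℕ, 0 < q ∧ s.reg i = p ∧ s.reg j = q ∧
    (∀ t, t < p → s.arr a t = ((π t : ℕ) : ℚ)) ∧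
    (∀ t, p ≤ t → s.arr a (p + (t - p) % q) = ((π t : ℕ) : ℚ))

end RobotRouting

/-!
The reward of a path is `lam / (1 - gam)` times one minus the mean cost of its visits, where the
visit at time `t` costs `gam ^ last`. The lower truncated cost of a visit depends only on the *age
state*: the current node together with the times since the last visits of all nodes, truncated at
`K`. So the over-approximation turns into a mean-cost problem on a graph with
`M = n * (K + 1) ^ n` states, in which the path wanted is an ultimately periodic one with least mean
lower truncated cost. This single path serves as both outputs. Its over-approximation bounds the
rewards of all paths, since truncation only lowers costs and the path is optimal for the truncated
ones. Its under-approximation is smaller by at most `lam / (1 - gam) * gam ^ K ≤ eps`, since the two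
truncated costs of a visit differ by at most `gam ^ K`. Its own reward lies in between, and so does
the reward value.

The optimal path is found by a variant of Karp's algorithm. Dynamic programming stores, for every
`k ≤ M` and every age state, a cheapest walk with `k` steps that ends there (`tableProg_runs`). By
`mean_le_of_optimal_walks`, a closed walk as good as the best of all is contained in one of the
stored walks with `M` steps. The program therefore runs through all pairs of times at which such a
walk is at the same node, repeats the part in between forever, and evaluates the resulting
ultimately periodic path (`searchProg_runs`). Its costs are periodic from the second round on
(`age_lasso_add`), so summing the costs of the second round gives the exact limits of the averages;
`scanProg_runs` is the correctness of this summation. The lower bound for the costs of every infinite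
path is `le_sum_costLower`, which rests on `le_sum_of_optimal_walks`.

The program is verified with triples `Runs`, which include the bounds on the resources. What a
program leaves unchanged is read off from its text (`Exec.same`), and so is a bound for its running
time when every loop makes at most `L` rounds (`Prog.time`); this is a polynomial in `L`, and here
`L = 2 * M + 2`. For the bit lengths, all costs and their sums are fractions with the common
denominator `gam.den ^ (2 * M + 2)`, because no walk is followed for more than `2 * M` steps; when
such fractions are added, the denominator stays and only the bound for the absolute value grows
(`Fits`).
-/

namespace RobotRouting

/-! ### Bit lengths of rational numbers -/

theorem size_mul_le (a b : ℕ) : Nat.size (a * b) ≤ Nat.size a + Nat.size b := by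
  rw [Nat.size_le, pow_add]
  exact Nat.mul_lt_mul'' (Nat.lt_size_self a) (Nat.lt_size_self b)

theorem size_pow_le (a k : ℕ) : Nat.size (a ^ k) ≤ k * Nat.size a + 1 := by
  induction k with
  | zero => simp
  | succ k ih =>
    rw [pow_succ]
    have := size_mul_le (a ^ k) a
    rw [Nat.add_mul]
    omega

theorem size_le_self (a : ℕ) : Nat.size a ≤ a := by
  rw [Nat.size_le]; exact Nat.lt_two_pow_self

theorem bitLen_mul_le (x y : ℚ) : bitLen (x * y) ≤ bitLen x + bitLen y := by
  unfold bitLen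
  have h1 : (x * y).num.natAbs ≤ x.num.natAbs * y.num.natAbs := by
    rw [Rat.mul_num, ← Int.natAbs_mul]
    rw [Int.natAbs_ediv_of_dvd]
    · exact Nat.div_le_self _ _
    · exact (Int.natCast_dvd.2 (Nat.gcd_dvd_left _ _))
  have h2 : (x * y).den ≤ x.den * y.den := by
    rw [Rat.mul_den]; exact Nat.div_le_self _ _
  have := Nat.size_le_size h1
  have := Nat.size_le_size h2
  have := size_mul_le x.num.natAbs y.num.natAbs
  have := size_mul_le x.den y.den
  omega

theorem bitLen_inv_le (x : ℚ) : bitLen x⁻¹ ≤ bitLen x := by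
  rcases eq_or_ne x 0 with rfl | hx
  · simp
  · unfold bitLen
    have hn : x.num ≠ 0 := by simpa using hx
    rw [Rat.num_inv, Rat.den_inv_of_ne_zero hx]
    rw [Int.natAbs_mul, Int.natAbs_natCast, Int.natAbs_sign_of_ne_zero hn, one_mul]
    omega

theorem bitLen_div_le (x y : ℚ) : bitLen (x / y) ≤ bitLen x + bitLen y := by
  rw [div_eq_mul_inv]
  have := bitLen_mul_le x y⁻¹
  have := bitLen_inv_le y
  omega

/-- `x` is a fraction with denominator `D` and absolute value at most `C`. When such
numbers are added, only `C` grows, so their bit lengths grow only with the logarithm of the number of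
summands. -/
def Fits (D C : ℕ) (x : ℚ) : Prop := (∃ z : ℤ, x * D = z) ∧ |x| ≤ C

theorem Fits.bitLen_le {D C : ℕ} (hD : 0 < D) {x : ℚ} (h : Fits D C x) :
    bitLen x ≤ Nat.size C + 2 * Nat.size D := by
  obtain ⟨⟨z, hz⟩, hx⟩ := h
  have hden : x.den ≤ D := by
    have hxz : x = z / ((D : ℤ) : ℚ) := by
      rw [eq_div_iff (by exact_mod_cast hD.ne')]; exact_mod_cast hz
    have := Rat.den_dvd z D
    rw [Rat.divInt_eq_div, ← hxz] at this
    exact Nat.le_of_dvd hD (Int.natCast_dvd_natCast.1 this)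
  have hnum : x.num.natAbs ≤ C * D := by
    have h1 : (x.num : ℚ) = x * x.den := by
      rw [Rat.mul_den_eq_num]
    have h2 : ((x.num.natAbs : ℕ) : ℚ) ≤ C * x.den := by
      have : ((x.num.natAbs : ℕ) : ℚ) = |(x.num : ℚ)| := by
        rw [← Int.cast_abs, Int.abs_eq_natAbs, Int.cast_natCast]
      rw [this, h1, abs_mul, Nat.abs_cast]
      exact mul_le_mul_of_nonneg_right hx (by positivity)
    have h3 : x.num.natAbs ≤ C * x.den := by exact_mod_cast h2
    exact h3.trans (Nat.mul_le_mul_left _ hden)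
  unfold bitLen
  have := Nat.size_le_size hnum
  have := Nat.size_le_size hden
  have := size_mul_le C D
  omega

theorem Fits.int {D C : ℕ} {z : ℤ} (h : |z| ≤ C) : Fits D C z :=
  ⟨⟨z * D, by push_cast; ring⟩, by rw [← Int.cast_abs]; exact_mod_cast h⟩

theorem Fits.nat {D C k : ℕ} (h : k ≤ C) : Fits D C k := by
  simpa using Fits.int (D := D) (C := C) (z := (k : ℤ)) (by simpa using h)

theorem Fits.zero {D C : ℕ} : Fits D C 0 := by
  simpa using Fits.nat (D := D) (C := C) (k := 0) (Nat.zero_le _)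

theorem Fits.add {D C C' : ℕ} {x y : ℚ} (hx : Fits D C x) (hy : Fits D C' y) :
    Fits D (C + C') (x + y) := by
  obtain ⟨⟨a, ha⟩, h1⟩ := hx
  obtain ⟨⟨b, hb⟩, h2⟩ := hy
  refine ⟨⟨a + b, by rw [add_mul, ha, hb]; push_cast; ring⟩, ?_⟩
  push_cast
  exact (abs_add_le x y).trans (add_le_add h1 h2)

theorem Fits.neg {D C : ℕ} {x : ℚ} (hx : Fits D C x) : Fits D C (-x) := by
  obtain ⟨⟨a, ha⟩, h1⟩ := hx
  exact ⟨⟨-a, by rw [neg_mul, ha]; push_cast; ring⟩, by rwa [abs_neg]⟩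

theorem Fits.sub {D C C' : ℕ} {x y : ℚ} (hx : Fits D C x) (hy : Fits D C' y) :
    Fits D (C + C') (x - y) := by
  rw [sub_eq_add_neg]; exact hx.add hy.neg

theorem Fits.mono {D C C' : ℕ} {x : ℚ} (hx : Fits D C x) (h : C ≤ C') : Fits D C' x :=
  ⟨hx.1, hx.2.trans (by exact_mod_cast h)⟩

theorem Fits.sum {D C : ℕ} {ι : Type*} (s : Finset ι) (f : ι → ℚ)
    (h : ∀ i ∈ s, Fits D C (f i)) : Fits D (s.card * C) (∑ i ∈ s, f i) := by
  classical
  induction s using Finset.induction_on with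
  | empty => simpa using Fits.zero
  | insert a s ha ih =>
    rw [Finset.sum_insert ha, Finset.card_insert_of_notMem ha]
    refine ((h a (by simp)).add (ih fun i hi => h i (by simp [hi]))).mono (by rw [Nat.add_mul]; omega)

/-- A power of a rational number in `[0, 1]` is a fraction over every higher power of its
denominator. -/
theorem Fits.pow {x : ℚ} (h0 : 0 ≤ x) (h1 : x ≤ 1) {l E : ℕ} (h : l ≤ E) :
    Fits (x.den ^ E) 1 (x ^ l) := by
  refine ⟨⟨x.num ^ l * x.den ^ (E - l), ?_⟩, ?_⟩
  · have : (x.den ^ E : ℕ) = x.den ^ l * x.den ^ (E - l) := by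
      rw [← pow_add, Nat.add_sub_cancel' h]
    rw [this]; push_cast
    rw [← mul_assoc, ← mul_pow, Rat.mul_den_eq_num]
  · rw [abs_of_nonneg (by positivity)]
    simpa using pow_le_one₀ h0 h1

/-! ### Reasoning about programs -/

/-- The registers that a program may write. -/
def Prog.regs : Prog → List ℕ
  | .skip => []
  | .const i _ => [i]
  | .plus i _ _ => [i]
  | .minus i _ _ => [i]
  | .times i _ _ => [i]
  | .divide i _ _ => [i]
  | .load i _ _ => [i]
  | .store _ _ _ => []
  | .seq p q => p.regs ++ q.regs
  | .branch _ _ p q => p.regs ++ q.regs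
  | .loop _ _ p => p.regs

/-- The arrays that a program may write. -/
def Prog.arrs : Prog → List ℕ
  | .store a _ _ => [a]
  | .seq p q => p.arrs ++ q.arrs
  | .branch _ _ p q => p.arrs ++ q.arrs
  | .loop _ _ p => p.arrs
  | _ => []

/-- A bound for the number of steps of a program each of whose loops makes at most `L` rounds
whenever it is entered. -/
def Prog.time (L : ℕ) : Prog → ℕ
  | .seq p q => p.time L + q.time L
  | .branch _ _ p q => max (p.time L) (q.time L) + 1
  | .loop _ _ p => L * (p.time L + 1) + 1
  | _ => 1

theorem Prog.exists_polynomial_time_le (p : Prog) :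
    ∃ P : Polynomial ℕ, ∀ L, p.time L ≤ P.eval L := by
  induction p with
  | seq p q hp hq =>
    obtain ⟨P, hP⟩ := hp
    obtain ⟨Q, hQ⟩ := hq
    exact ⟨P + Q, fun L => by simpa [Prog.time] using add_le_add (hP L) (hQ L)⟩
  | branch j k p q hp hq =>
    obtain ⟨P, hP⟩ := hp
    obtain ⟨Q, hQ⟩ := hq
    refine ⟨P + Q + 1, fun L => ?_⟩
    have := hP L
    have := hQ L
    simp only [Prog.time, Polynomial.eval_add, Polynomial.eval_one]
    omega
  | loop j k p hp =>
    obtain ⟨P, hP⟩ := hp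
    refine ⟨Polynomial.X * (P + 1) + 1, fun L => ?_⟩
    simp only [Prog.time, Polynomial.eval_add, Polynomial.eval_one, Polynomial.eval_mul,
      Polynomial.eval_X]
    gcongr
    exact hP L
  | _ => exact ⟨1, fun L => by simp [Prog.time]⟩

/-- The memory `s'` agrees with `s` outside the registers in `R` and the arrays in `A`. -/
def Same (R A : List ℕ) (s s' : State) : Prop :=
  (∀ r, r ∉ R → s'.reg r = s.reg r) ∧ ∀ a, a ∉ A → s'.arr a = s.arr a

theorem Same.refl (R A : List ℕ) (s : State) : Same R A s s := ⟨fun _ _ => rfl, fun _ _ => rfl⟩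

theorem Same.trans {R A : List ℕ} {s s' s'' : State} (h : Same R A s s') (h' : Same R A s' s'') :
    Same R A s s'' :=
  ⟨fun r hr => (h'.1 r hr).trans (h.1 r hr), fun a ha => (h'.2 a ha).trans (h.2 a ha)⟩

theorem Same.mono {R A R' A' : List ℕ} {s s' : State} (h : Same R A s s') (hR : R ⊆ R')
    (hA : A ⊆ A') : Same R' A' s s' :=
  ⟨fun r hr => h.1 r fun h' => hr (hR h'), fun a ha => h.2 a fun h' => ha (hA h')⟩

@[simp] theorem State.setReg_reg (s : State) (i j : ℕ) (x : ℚ) :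
    (s.setReg i x).reg j = if j = i then x else s.reg j := by
  simp [State.setReg, Function.update_apply]

@[simp] theorem State.setReg_arr (s : State) (i : ℕ) (x : ℚ) : (s.setReg i x).arr = s.arr := rfl

@[simp] theorem State.setArr_reg (s : State) (a m : ℕ) (x : ℚ) : (s.setArr a m x).reg = s.reg := rfl

@[simp] theorem State.setArr_arr (s : State) (a m b : ℕ) (x : ℚ) :
    (s.setArr a m x).arr b = if b = a then Function.update (s.arr a) m x else s.arr b := by
  by_cases h : b = a
  · subst h; simp [State.setArr]
  · simp [State.setArr, h]

theorem Same.setReg {R A : List ℕ} {s s' : State} (h : Same R A s s') {i : ℕ} (hi : i ∈ R) (x : ℚ) :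
    Same R A s (s'.setReg i x) :=
  ⟨fun r hr => by
    rw [State.setReg_reg, if_neg (by rintro rfl; exact hr hi), h.1 r hr], h.2⟩

theorem Same.setArr {R A : List ℕ} {s s' : State} (h : Same R A s s') {a : ℕ} (ha : a ∈ A) (m : ℕ)
    (x : ℚ) : Same R A s (s'.setArr a m x) :=
  ⟨h.1, fun b hb => by
    rw [State.setArr_arr, if_neg (by rintro rfl; exact hb ha), h.2 b hb]⟩

theorem Exec.same {p : Prog} {s s' : State} {t b : ℕ} (h : Exec p s s' t b) :
    Same p.regs p.arrs s s' := by
  induction h with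
  | skip s => exact Same.refl _ _ _
  | store s a j i m h => exact (Same.refl _ _ s).setArr (by simp [Prog.arrs]) m _
  | seq hp hq ihp ihq =>
    exact (ihp.mono (by simp [Prog.regs]) (by simp [Prog.arrs])).trans
      (ihq.mono (by simp [Prog.regs]) (by simp [Prog.arrs]))
  | branch_true h hp ih => exact ih.mono (by simp [Prog.regs]) (by simp [Prog.arrs])
  | branch_false h hp ih => exact ih.mono (by simp [Prog.regs]) (by simp [Prog.arrs])
  | loop_done h => exact Same.refl _ _ _
  | loop_next h hp hl ihp ihl => exact ihp.trans ihl
  | _ => exact (Same.refl _ _ _).setReg (by simp [Prog.regs]) _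

/-- Total correctness with resource bounds: started in `s`, the program `p` halts in a memory with
the property `Q`; all numbers written have at most `B` bits, and the number of steps is within the
bound for loops of at most `L` rounds. -/
def Runs (L B : ℕ) (p : Prog) (s : State) (Q : State → Prop) : Prop :=
  ∃ s' t b, Exec p s s' t b ∧ t ≤ p.time L ∧ b ≤ B ∧ Q s'

section Rules

variable {L B : ℕ} {s : State} {Q : State → Prop}

theorem Runs.call {p : Prog} {P : State → Prop} (h : Runs L B p s P)
    (hQ : ∀ s', Same p.regs p.arrs s s' → P s' → Q s') : Runs L B p s Q := by
  obtain ⟨s', t, b, he, ht, hb, hP⟩ := h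
  exact ⟨s', t, b, he, ht, hb, hQ s' he.same hP⟩

theorem Runs.seq {p q : Prog} (h : Runs L B p s fun s' => Runs L B q s' Q) :
    Runs L B (p.seq q) s Q := by
  obtain ⟨s', t, b, he, ht, hb, s'', t', b', he', ht', hb', hQ⟩ := h
  exact ⟨s'', _, _, he.seq he', by simp only [Prog.time]; omega, max_le hb hb', hQ⟩

theorem Runs.skip (h : Q s) : Runs L B .skip s Q :=
  ⟨s, _, _, .skip s, by simp [Prog.time], by simp, h⟩

theorem Runs.const {i : ℕ} {v : ℚ} (hb : bitLen v ≤ B) (h : Q (s.setReg i v)) :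
    Runs L B (.const i v) s Q :=
  ⟨_, _, _, .const s i v, by simp [Prog.time], hb, h⟩

theorem Runs.plus {i j k : ℕ} {v : ℚ} (hv : s.reg j + s.reg k = v) (hb : bitLen v ≤ B)
    (h : Q (s.setReg i v)) : Runs L B (.plus i j k) s Q := by
  subst hv
  exact ⟨_, _, _, .plus s i j k, by simp [Prog.time], hb, h⟩

theorem Runs.minus {i j k : ℕ} {v : ℚ} (hv : s.reg j - s.reg k = v) (hb : bitLen v ≤ B)
    (h : Q (s.setReg i v)) : Runs L B (.minus i j k) s Q := by
  subst hv
  exact ⟨_, _, _, .minus s i j k, by simp [Prog.time], hb, h⟩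

theorem Runs.times {i j k : ℕ} {v : ℚ} (hv : s.reg j * s.reg k = v) (hb : bitLen v ≤ B)
    (h : Q (s.setReg i v)) : Runs L B (.times i j k) s Q := by
  subst hv
  exact ⟨_, _, _, .times s i j k, by simp [Prog.time], hb, h⟩

theorem Runs.divide {i j k : ℕ} {v : ℚ} (hk : s.reg k ≠ 0) (hv : s.reg j / s.reg k = v)
    (hb : bitLen v ≤ B) (h : Q (s.setReg i v)) : Runs L B (.divide i j k) s Q := by
  subst hv
  exact ⟨_, _, _, .divide s i j k hk, by simp [Prog.time], hb, h⟩

theorem Runs.load {i a j m : ℕ} {v : ℚ} (hj : s.reg j = m) (hv : s.arr a m = v)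
    (hb : bitLen v ≤ B) (h : Q (s.setReg i v)) : Runs L B (.load i a j) s Q := by
  subst hv
  exact ⟨_, _, _, .load s i a j m hj, by simp [Prog.time], hb, h⟩

theorem Runs.store {a j i m : ℕ} {v : ℚ} (hj : s.reg j = m) (hv : s.reg i = v)
    (hb : bitLen v ≤ B) (h : Q (s.setArr a m v)) : Runs L B (.store a j i) s Q := by
  subst hv
  exact ⟨_, _, _, .store s a j i m hj, by simp [Prog.time], hb, h⟩

theorem Runs.branch {j k : ℕ} {p q : Prog} (hp : s.reg j ≤ s.reg k → Runs L B p s Q)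
    (hq : s.reg k < s.reg j → Runs L B q s Q) : Runs L B (.branch j k p q) s Q := by
  by_cases h : s.reg j ≤ s.reg k
  · obtain ⟨s', t, b, he, ht, hb, hQ⟩ := hp h
    refine ⟨s', _, _, .branch_true h he, ?_, hb, hQ⟩
    simp only [Prog.time]; omega
  · obtain ⟨s', t, b, he, ht, hb, hQ⟩ := hq (not_le.1 h)
    refine ⟨s', _, _, .branch_false h he, ?_, hb, hQ⟩
    simp only [Prog.time]; omega

/-- The rule for loops: the invariant `I k` holds when `k` further rounds are allowed. -/
theorem Runs.loop {j k : ℕ} {p : Prog} {N : ℕ} (hN : N ≤ L) (I : ℕ → State → Prop) (h0 : I N s)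
    (hdone : ∀ m s', I m s' → s'.reg k < s'.reg j → Q s')
    (hstep : ∀ m s', I m s' → s'.reg j ≤ s'.reg k →
      0 < m ∧ Runs L B p s' (I (m - 1))) : Runs L B (.loop j k p) s Q := by
  suffices h : ∃ s' t b, Exec (.loop j k p) s s' t b ∧ t ≤ N * (p.time L + 1) + 1 ∧ b ≤ B ∧ Q s' by
    obtain ⟨s', t, b, he, ht, hb, hQ⟩ := h
    exact ⟨s', t, b, he, ht.trans (by simp only [Prog.time]; gcongr), hb, hQ⟩
  clear hN
  induction N generalizing s with
  | zero =>
    by_cases h : s.reg j ≤ s.reg k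
    · exact absurd (hstep 0 s h0 h).1 (lt_irrefl 0)
    · exact ⟨s, _, _, .loop_done h, by omega, by simp, hdone 0 s h0 (not_le.1 h)⟩
  | succ N ih =>
    by_cases h : s.reg j ≤ s.reg k
    · obtain ⟨s', t, b, he, ht, hb, hI⟩ := (hstep (N + 1) s h0 h).2
      obtain ⟨s'', t', b', he', ht', hb', hQ⟩ := ih (s := s') hI
      refine ⟨s'', _, _, .loop_next h he he', ?_, max_le hb hb', hQ⟩
      rw [Nat.add_mul]; omega
    · exact ⟨s, _, _, .loop_done h, by omega, by simp, hdone _ s h0 (not_le.1 h)⟩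

/-- `for i = 0, …, m - 1 do body`; register `8` holds the number one, and register `b` is used for
the last value of the counter. -/
def forLoop (i b m : ℕ) (body : Prog) : Prog :=
  .seq (.minus b m 8) (.seq (.const i 0) (.loop i b (.seq body (.plus i i 8))))

/-- The rule for `forLoop`: the invariant `I k` holds after `k` rounds and may not depend on the
registers of the counter and of its bound. -/
theorem Runs.forLoop {i b m : ℕ} {body : Prog} {N : ℕ} (I : ℕ → State → Prop)
    (hm : s.reg m = N) (h1 : s.reg 8 = 1) (hN : N ≤ L)
    (hbits : ∀ z : ℤ, |z| ≤ N + 1 → bitLen z ≤ B)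
    (hw : i ∉ body.regs ∧ b ∉ body.regs ∧ 8 ∉ body.regs ∧ i ≠ b ∧ i ≠ 8 ∧ b ≠ 8)
    (hI : ∀ k s x, I k s → I k (s.setReg i x) ∧ I k (s.setReg b x)) (h0 : I 0 s)
    (hstep : ∀ k s', k < N → Same (i :: b :: body.regs) body.arrs s s' → s'.reg i = k → I k s' →
      Runs L B body s' (I (k + 1)))
    (hQ : ∀ s', Same (i :: b :: body.regs) body.arrs s s' → I N s' → Q s') :
    Runs L B (forLoop i b m body) s Q := by
  obtain ⟨hi, hb, h8, hib, hi8, hb8⟩ := hw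
  refine .seq (.minus (v := (N : ℚ) - 1) (by rw [hm, h1]) ?_ (.seq (.const ?_ ?_)))
  · have := hbits (N - 1) (by rw [abs_le]; omega)
    simpa using this
  · simpa using hbits 0 (by simp; omega)
  refine Runs.loop (N := N) hN (fun r s' => ∃ k, k + r = N ∧ s'.reg i = k ∧ s'.reg b = (N : ℚ) - 1 ∧
    s'.reg 8 = 1 ∧ Same (i :: b :: body.regs) body.arrs s s' ∧ I k s') ?_ ?_ ?_
  · refine ⟨0, by simp, by simp, by simp [hib.symm], by simp [hi8.symm, hb8.symm, h1],
      ((Same.refl _ _ _).setReg (by simp) _).setReg (by simp) _, ?_⟩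
    exact (hI _ _ _ (hI _ _ _ h0).2).1
  · rintro r s' ⟨k, hk, hki, hkb, hk1, hs, hIk⟩ hlt
    rw [hki, hkb] at hlt
    have : (N : ℚ) < k + 1 := by linarith
    have h : N < k + 1 := by exact_mod_cast this
    obtain rfl : k = N := by omega
    exact hQ s' hs hIk
  · rintro r s' ⟨k, hk, hki, hkb, hk1, hs, hIk⟩ hle
    rw [hki, hkb] at hle
    have : (k : ℚ) + 1 ≤ N := by linarith
    have h : k + 1 ≤ N := by exact_mod_cast this
    refine ⟨by omega, .seq ?_⟩
    refine (hstep k s' (by omega) hs hki hIk).call fun s'' hs' hI' => ?_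
    have e1 : s''.reg i = k := by rw [hs'.1 i hi, hki]
    have e2 : s''.reg 8 = 1 := by rw [hs'.1 8 h8, hk1]
    refine .plus (v := ((k + 1 : ℕ) : ℚ)) (by rw [e1, e2]; push_cast; ring) ?_ ?_
    · have := hbits (k + 1) (by rw [abs_le]; omega)
      push_cast at this ⊢; exact this
    · refine ⟨k + 1, by omega, by simp, ?_, by simp [hi8.symm, e2], ?_, (hI _ _ _ hI').1⟩
      · rw [State.setReg_reg, if_neg hib.symm, hs'.1 b hb, hkb]
      · exact (hs.trans (hs'.mono (by intro x hx; simp [hx]) (fun x hx => hx))).setReg (by simp) _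

end Rules

/-! ### Walks of minimum mean cost in a finite graph -/

section MeanCost

variable {S : Type*} (R : S → S → Prop) (f : S → ℚ)

/-- `Conn R f x y k c`: some walk with `k` steps leads from `x` to `y` and has cost `c`, the sum of
the costs of its nodes other than the last one. -/
inductive Conn (x : S) : S → ℕ → ℚ → Prop
  | nil : Conn x x 0 0
  | snoc {y z : S} {k : ℕ} {c : ℚ} : Conn x y k c → R y z → Conn x z (k + 1) (c + f y)

variable {R f}

theorem Conn.trans {x y z : S} {k l : ℕ} {c d : ℚ} (h : Conn R f x y k c) (h' : Conn R f y z l d) :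
    Conn R f x z (k + l) (c + d) := by
  induction h' with
  | nil => simpa using h
  | snoc _ hr ih => rw [← add_assoc, ← add_assoc]; exact ih.snoc hr

theorem Conn.head {x z : S} {k : ℕ} {c : ℚ} (h : Conn R f x z k c) (hk : 0 < k) :
    ∃ y d, R x y ∧ Conn R f y z (k - 1) d ∧ c = f x + d := by
  induction h with
  | nil => simp at hk
  | @snoc y z k c h hr ih =>
    rcases Nat.eq_zero_or_pos k with rfl | hk'
    · cases h
      exact ⟨z, 0, hr, .nil, by ring⟩
    · obtain ⟨y', d, h1, h2, h3⟩ := ih hk'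
      refine ⟨y', d + f y, h1, ?_, by rw [h3]; ring⟩
      have := h2.snoc hr
      rwa [Nat.sub_add_cancel hk'] at this

theorem Conn.of_fun {w : ℕ → S} {m : ℕ} (hw : ∀ i < m, R (w i) (w (i + 1))) {i j : ℕ} (hij : i ≤ j)
    (hj : j ≤ m) : Conn R f (w i) (w j) (j - i) (∑ t ∈ Finset.Ico i j, f (w t)) := by
  induction j, hij using Nat.le_induction with
  | base => simpa using Conn.nil
  | succ j hij ih =>
    rw [Finset.sum_Ico_succ_top hij, Nat.succ_sub hij]
    exact (ih (by omega)).snoc (hw j (by omega))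

theorem Conn.exists_fun {x y : S} {k : ℕ} {c : ℚ} (h : Conn R f x y k c) :
    ∃ w : ℕ → S, w 0 = x ∧ w k = y ∧ (∀ i < k, R (w i) (w (i + 1))) ∧
      c = ∑ t ∈ Finset.range k, f (w t) := by
  induction h with
  | nil => exact ⟨fun _ => x, rfl, rfl, by simp, by simp⟩
  | @snoc y z k c h hr ih =>
    obtain ⟨w, h0, h1, h2, h3⟩ := ih
    refine ⟨Function.update w (k + 1) z, by simp [h0], by simp, fun i hi => ?_, ?_⟩
    · rcases Nat.lt_succ_iff_lt_or_eq.1 hi with hi | rfl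
      · rw [Function.update_of_ne (by omega), Function.update_of_ne (by omega)]
        exact h2 i hi
      · rw [Function.update_of_ne (by omega), Function.update_self, h1]
        exact hr
    · rw [Finset.sum_range_succ, Function.update_of_ne (by omega), h1, h3]
      congr 1
      refine Finset.sum_congr rfl fun t ht => ?_
      rw [Function.update_of_ne]
      have := Finset.mem_range.1 ht
      omega

theorem exists_repeat [Fintype S] (w : ℕ → S) :
    ∃ i j, i < j ∧ j ≤ Fintype.card S ∧ w i = w j := by
  obtain ⟨a, b, hab, h⟩ := Fintype.exists_ne_map_eq_of_card_lt
    (fun i : Fin (Fintype.card S + 1) => w i) (by simp)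
  rcases lt_or_gt_of_ne hab with hlt | hlt
  · exact ⟨a, b, hlt, by omega, h⟩
  · exact ⟨b, a, hlt, by omega, h.symm⟩

/-- A walk with at least as many steps as the graph has nodes splits into a closed walk and the
walk that remains when it is cut out. -/
theorem Conn.split [Fintype S] {x y : S} {k : ℕ} {c : ℚ} (h : Conn R f x y k c)
    (hk : Fintype.card S ≤ k) :
    ∃ z l a m b d, 0 < l ∧ l ≤ Fintype.card S ∧ m + l = k ∧ b + a = c ∧ d ≤ m ∧
      (∃ e, Conn R f x z d e) ∧ Conn R f z z l a ∧ Conn R f x y m b := by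
  obtain ⟨w, rfl, rfl, hw, rfl⟩ := h.exists_fun
  obtain ⟨i, j, hij, hj, e⟩ := exists_repeat w
  have h1 := Conn.of_fun (f := f) hw (Nat.zero_le i) (by omega)
  have h2 := Conn.of_fun (f := f) hw hij.le (by omega)
  have h3 := Conn.of_fun (f := f) hw (hj.trans hk) le_rfl
  rw [← e] at h2 h3
  refine ⟨w i, _, _, _, _, i, by omega, by omega, ?_, ?_, ?_, ⟨_, h1⟩, h2, h1.trans h3⟩
  · omega
  · rw [Finset.range_eq_Ico, ← Finset.sum_Ico_consecutive _ (Nat.zero_le i) (by omega : i ≤ k),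
      ← Finset.sum_Ico_consecutive _ hij.le (by omega : j ≤ k)]
    ring
  · omega

/-- Cutting out closed walks of mean cost at least `ν` does not increase `cost - ν * length`. -/
theorem Conn.shorten [Fintype S] {s₀ : S} {ν : ℚ}
    (hν : ∀ x d e k c, Conn R f s₀ x d e → Conn R f x x k c → ν * k ≤ c)
    {y : S} {k : ℕ} {c : ℚ} (h : Conn R f s₀ y k c) :
    ∃ k' c', k' ≤ Fintype.card S ∧ Conn R f s₀ y k' c' ∧ c' - ν * k' ≤ c - ν * k := by
  induction k using Nat.strong_induction_on generalizing c with
  | _ k ih =>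
    by_cases hk : k ≤ Fintype.card S
    · exact ⟨k, c, hk, h, le_rfl⟩
    · obtain ⟨z, l, a, m, b, d, hl, -, rfl, rfl, -, ⟨e, h1⟩, h2, h3⟩ := h.split (by omega)
      obtain ⟨k', c', hk', h', hle⟩ := ih m (by omega) h3
      refine ⟨k', c', hk', h', hle.trans ?_⟩
      have := hν z d e l a h1 h2
      push_cast
      linarith

theorem Conn.finite_costs [Finite S] (x y : S) (k : ℕ) : {c | Conn R f x y k c}.Finite := by
  induction k generalizing y with
  | zero =>
    refine (Set.finite_singleton (0 : ℚ)).subset ?_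
    rintro c h
    cases h; rfl
  | succ k ih =>
    refine (Set.finite_iUnion fun z => (ih z).image (· + f z)).subset ?_
    rintro c h
    cases h with
    | @snoc z _ _ c h hr => exact Set.mem_iUnion.2 ⟨z, c, h, rfl⟩

/-- If the graph has a closed walk that can be reached from `s₀`, then one of these has the least
mean cost. -/
theorem exists_min_mean [Fintype S] {s₀ x : S} {d k : ℕ} {e c : ℚ} (h₁ : Conn R f s₀ x d e)
    (h₂ : Conn R f x x k c) (hk : 0 < k) :
    ∃ u d e k c, Conn R f s₀ u d e ∧ Conn R f u u k c ∧ 0 < k ∧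
      ∀ x d' e' k' c', Conn R f s₀ x d' e' → Conn R f x x k' c' → c / k * k' ≤ c' := by
  classical
  let T : Set ℚ := {r | ∃ k, k ≤ Fintype.card S ∧ 0 < k ∧ ∃ x d e c, Conn R f s₀ x d e ∧
    Conn R f x x k c ∧ r = c / k}
  have hfin : T.Finite := by
    refine ((Set.finite_Iic (Fintype.card S)).biUnion fun k _ =>
      Set.finite_iUnion fun x => (Conn.finite_costs (R := R) (f := f) x x k).image (· / (k : ℚ))).subset ?_
    rintro r ⟨k, hk, -, x, d, e, c, -, h, rfl⟩
    simp only [Set.mem_iUnion]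
    exact ⟨k, hk, x, c, h, rfl⟩
  have key : ∀ μ, (∀ r ∈ T, μ ≤ r) →
      ∀ k x d e c, Conn R f s₀ x d e → Conn R f x x k c → μ * k ≤ c := by
    intro μ hμ k
    induction k using Nat.strong_induction_on with
    | _ k ih =>
      intro x d e c h1 h2
      rcases Nat.eq_zero_or_pos k with rfl | hk0
      · cases h2; simp
      by_cases hk : k ≤ Fintype.card S
      · have := hμ _ ⟨k, hk, hk0, x, d, e, c, h1, h2, rfl⟩
        rwa [le_div_iff₀ (by exact_mod_cast hk0)] at this
      · obtain ⟨z, l, a, m, b, d', hl, hl', rfl, rfl, hd, ⟨e', h3⟩, h4, h5⟩ := h2.split (by omega)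
        have i1 := ih l (by omega) z _ _ a (h1.trans h3) h4
        have i2 := ih m (by omega) x d e b h1 h5
        push_cast
        linarith
  have hne : T.Nonempty := by
    by_contra hempty
    rw [Set.not_nonempty_iff_eq_empty] at hempty
    have := key (c / k + 1) (by simp [hempty]) k x d e c h₁ h₂
    have hk' : (0 : ℚ) < k := by exact_mod_cast hk
    rw [add_mul, div_mul_cancel₀ _ hk'.ne'] at this
    linarith
  obtain ⟨r, ⟨k', hk', hk0, u, d', e', c', h1, h2, rfl⟩, hr⟩ := Set.exists_min_image T id hfin hne
  exact ⟨u, d', e', k', c', h1, h2, hk0, fun x d e k c h h' => key _ hr k x d e c h h'⟩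

/-- Going round a closed walk that attains the mean cost `ν`, one can stop after any number of
steps, and return at a total cost of exactly `ν` per step. -/
theorem Conn.go_round {u : S} {k : ℕ} {c ν : ℚ} (h : Conn R f u u k c) (hk : 0 < k)
    (hc : c = ν * k) (m : ℕ) :
    ∃ v a l b, Conn R f u v m a ∧ Conn R f v u l b ∧ a + b = ν * (m + l) := by
  induction m with
  | zero => exact ⟨u, 0, 0, 0, .nil, .nil, by simp⟩
  | succ m ih =>
    obtain ⟨v, a, l, b, h1, h2, h3⟩ := ih
    obtain ⟨z, d, hr, h4, h5⟩ := (h2.trans h).head (by omega)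
    refine ⟨z, a + f v, _, d, h1.snoc hr, h4, ?_⟩
    have : ((l + k - 1 : ℕ) : ℚ) = l + k - 1 := by
      rw [Nat.cast_sub (by omega)]; push_cast; ring
    rw [this]; push_cast
    linarith

/-- Karp's argument: let `μ` be a lower bound for the mean costs of the closed walks inside some
cheapest walks with `|S|` steps from `s₀`, one for each of their end nodes. Then `μ` is a lower bound
for the mean costs of all closed walks that can be reached from `s₀`. The reason is that a closed
walk of least mean cost `ν`, entered on a walk that is cheapest for the costs `f - ν`, gives a walk
with `|S|` steps which is cheapest among the walks of *all* lengths to its end node; so cutting a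
closed walk out of another cheapest walk to that node cannot lower its cost. -/
theorem mean_le_of_optimal_walks [Fintype S] {s₀ : S} {μ : ℚ}
    (hopt : ∀ x c, Conn R f s₀ x (Fintype.card S) c → ∃ w : ℕ → S, w 0 = s₀ ∧
      w (Fintype.card S) = x ∧ (∀ i < Fintype.card S, R (w i) (w (i + 1))) ∧
      ∑ t ∈ Finset.range (Fintype.card S), f (w t) ≤ c ∧
      ∀ i j, i < j → j ≤ Fintype.card S → w i = w j →
        μ * ((j - i : ℕ) : ℚ) ≤ ∑ t ∈ Finset.Ico i j, f (w t))
    {x : S} {d k : ℕ} {e c : ℚ} (h₁ : Conn R f s₀ x d e) (h₂ : Conn R f x x k c) :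
    μ * k ≤ c := by
  rcases Nat.eq_zero_or_pos k with rfl | hk
  · cases h₂; simp
  obtain ⟨u, d₁, e₁, k₁, c₁, hu, hcyc, hk₁, hmin⟩ := exists_min_mean h₁ h₂ hk
  set ν := c₁ / k₁ with hνdef
  have hk₁' : (0 : ℚ) < k₁ := by exact_mod_cast hk₁
  suffices hμν : μ ≤ ν from
    (mul_le_mul_of_nonneg_right hμν (Nat.cast_nonneg k)).trans (hmin x d e k c h₁ h₂)
  -- a walk to `u` that is cheapest for the costs `f - ν`
  let T : Set (ℕ × ℚ) := {p | p.1 ≤ Fintype.card S ∧ Conn R f s₀ u p.1 p.2}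
  have hT : T.Finite := by
    refine ((Set.finite_Iic (Fintype.card S)).biUnion fun k _ =>
      (Conn.finite_costs (R := R) (f := f) s₀ u k).image (Prod.mk k)).subset ?_
    rintro ⟨k, c⟩ ⟨hk, h⟩
    simp only [Set.mem_iUnion]
    exact ⟨k, hk, c, h, rfl⟩
  obtain ⟨k', c', hk', h', -⟩ := hu.shorten hmin
  obtain ⟨⟨k₀, c₀⟩, ⟨hk₀, h₀⟩, hleast⟩ :=
    Set.exists_min_image T (fun p => p.2 - ν * p.1) hT ⟨(k', c'), hk', h'⟩
  have hlb : ∀ k c, Conn R f s₀ u k c → c₀ - ν * k₀ ≤ c - ν * k := by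
    intro k c h
    obtain ⟨k', c', hk', h', hle⟩ := h.shorten hmin
    exact (hleast (k', c') ⟨hk', h'⟩).trans hle
  obtain ⟨v, a, l, b, h3, h4, h5⟩ := hcyc.go_round (ν := ν) hk₁
    (by rw [hνdef, div_mul_cancel₀ _ hk₁'.ne']) (Fintype.card S - k₀)
  have h6 := h₀.trans h3
  rw [Nat.add_sub_cancel' hk₀] at h6
  obtain ⟨w, hw0, hwM, hw, hwc, hwcyc⟩ := hopt v _ h6
  obtain ⟨i, j, hij, hj, heq⟩ := exists_repeat w
  have g1 := Conn.of_fun (f := f) hw (Nat.zero_le i) (by omega)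
  have g2 := Conn.of_fun (f := f) hw hj le_rfl
  rw [← heq] at g2
  rw [hw0] at g1
  rw [hwM] at g2
  have g3 := hlb _ _ ((g1.trans g2).trans h4)
  have g4 := hwcyc i j hij hj heq
  have g5 : ∑ t ∈ Finset.range (Fintype.card S), f (w t) = ∑ t ∈ Finset.Ico 0 i, f (w t) +
      (∑ t ∈ Finset.Ico i j, f (w t) + ∑ t ∈ Finset.Ico j (Fintype.card S), f (w t)) := by
    rw [Finset.sum_Ico_consecutive _ hij.le hj, Finset.sum_Ico_consecutive _ (Nat.zero_le i) (by omega),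
      Finset.range_eq_Ico]
  have hpos : (0 : ℚ) < ((j - i : ℕ) : ℚ) := by exact_mod_cast Nat.sub_pos_of_lt hij
  rw [Nat.cast_sub hij.le] at g4 hpos
  rw [Nat.cast_sub hk₀] at h5
  push_cast [Nat.cast_sub hij.le, Nat.cast_sub hj] at g3
  by_contra hlt
  push Not at hlt
  have := mul_lt_mul_of_pos_right hlt hpos
  rw [Nat.sub_zero] at g3
  dsimp only at hwc h5
  linarith

/-- Under the hypothesis of `mean_le_of_optimal_walks`, the average cost of every infinite walk is
eventually at least `μ`, with an explicit error term. -/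
theorem le_sum_of_optimal_walks [Fintype S] {s₀ : S} {μ : ℚ} (hμ : 0 ≤ μ) (hf : ∀ x, 0 ≤ f x)
    (hopt : ∀ x c, Conn R f s₀ x (Fintype.card S) c → ∃ w : ℕ → S, w 0 = s₀ ∧
      w (Fintype.card S) = x ∧ (∀ i < Fintype.card S, R (w i) (w (i + 1))) ∧
      ∑ t ∈ Finset.range (Fintype.card S), f (w t) ≤ c ∧
      ∀ i j, i < j → j ≤ Fintype.card S → w i = w j →
        μ * ((j - i : ℕ) : ℚ) ≤ ∑ t ∈ Finset.Ico i j, f (w t))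
    {w : ℕ → S} (h0 : w 0 = s₀) (hw : ∀ i, R (w i) (w (i + 1))) (N : ℕ) :
    μ * N - μ * Fintype.card S ≤ ∑ t ∈ Finset.range N, f (w t) := by
  have h := Conn.of_fun (f := f) (m := N) (fun i _ => hw i) (Nat.zero_le N) le_rfl
  rw [h0] at h
  obtain ⟨k, c, hk, h', hle⟩ := h.shorten (ν := μ) fun x d e k c h₁ h₂ =>
    mean_le_of_optimal_walks hopt h₁ h₂
  have hc : 0 ≤ c := by
    obtain ⟨w', -, -, -, rfl⟩ := h'.exists_fun
    exact Finset.sum_nonneg fun _ _ => hf _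
  have hk' : μ * k ≤ μ * Fintype.card S := by gcongr
  rw [Nat.sub_zero, ← Finset.range_eq_Ico] at hle
  linarith

end MeanCost

/-! ### Times since the last visit and the costs of visits -/

section Age

variable {V : Type*} [DecidableEq V]

/-- One less than `last w t u`, by recursion on the time `t`: a visit of `u` at time `t` resets the
value at time `t + 1` to zero, and otherwise it grows by one. -/
def age (w : ℕ → V) (u : V) : ℕ → ℕ
  | 0 => 0
  | t + 1 => if w t = u then 0 else age w u t + 1

theorem last_eq_age (w : ℕ → V) (t : ℕ) (u : V) : last w t u = age w u t + 1 := by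
  refine IsLeast.csInf_eq ?_
  induction t with
  | zero => simp [age, IsLeast, lowerBounds]
  | succ t ih =>
    by_cases h : w t = u
    · rw [age, if_pos h]
      refine ⟨Or.inr ⟨t, by omega, h, by omega⟩, ?_⟩
      rintro d (rfl | ⟨j, hj, -, rfl⟩) <;> omega
    · rw [age, if_neg h]
      refine ⟨?_, ?_⟩
      · rcases ih.1 with h' | ⟨j, hj, hu, h'⟩
        · exact Or.inl (by omega)
        · exact Or.inr ⟨j, by omega, hu, by omega⟩
      · rintro d (rfl | ⟨j, hj, hu, rfl⟩)
        · have := ih.2 (Or.inl rfl)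
          omega
        · rcases Nat.lt_succ_iff_lt_or_eq.1 hj with hj | rfl
          · have := ih.2 (Or.inr ⟨j, hj, hu, rfl⟩)
            omega
          · exact absurd hu h

theorem age_le (w : ℕ → V) (u : V) (t : ℕ) : age w u t ≤ t := by
  induction t with
  | zero => simp [age]
  | succ t ih => rw [age]; split_ifs <;> omega

theorem age_congr {w w' : ℕ → V} {t : ℕ} (h : ∀ i < t, w i = w' i) (u : V) :
    age w u t = age w' u t := by
  induction t with
  | zero => rfl
  | succ t ih => rw [age, age, ih fun i hi => h i (by omega), h t (by omega)]

variable (gam : ℚ) (K : ℕ) (w : ℕ → V) (t : ℕ)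

/-- The cost `gam ^ last` of the visit at time `t`. -/
def costExact : ℚ := gam ^ (age w (w t) t + 1)

/-- The upper truncated cost of the visit at time `t`. -/
def costUpper : ℚ := gam ^ min K (age w (w t) t + 1)

/-- The lower truncated cost of the visit at time `t`. -/
def costLower : ℚ := if age w (w t) t + 1 ≤ K then gam ^ (age w (w t) t + 1) else 0

variable {gam K w t}

theorem costLower_congr {w' : ℕ → V} (h : ∀ i ≤ t, w i = w' i) :
    costLower gam K w t = costLower gam K w' t := by
  rw [costLower, costLower, h t le_rfl, age_congr fun i hi => h i hi.le]

theorem costLower_nonneg (h0 : 0 < gam) : 0 ≤ costLower gam K w t := by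
  rw [costLower]; split_ifs <;> positivity

theorem costLower_le_costExact (h0 : 0 < gam) : costLower gam K w t ≤ costExact gam w t := by
  rw [costLower, costExact]; split_ifs
  · exact le_rfl
  · positivity

theorem costExact_le_costUpper (h0 : 0 < gam) (h1 : gam < 1) :
    costExact gam w t ≤ costUpper gam K w t :=
  pow_le_pow_of_le_one h0.le h1.le (min_le_right _ _)

theorem costUpper_le_costLower_add (h0 : 0 < gam) :
    costUpper gam K w t ≤ costLower gam K w t + gam ^ K := by
  rw [costUpper, costLower]
  split_ifs with h
  · rw [min_eq_right h]
    have : 0 ≤ gam ^ K := by positivity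
    linarith
  · rw [min_eq_left (by omega), zero_add]

theorem costExact_le (h0 : 0 < gam) (h1 : gam < 1) : costExact gam w t ≤ gam := by
  simpa [costExact] using pow_le_pow_of_le_one h0.le h1.le
    (Nat.le_add_left 1 (age w (w t) t))

end Age

/-! ### Nodes with truncated ages as the states of a finite graph -/

section States

variable {n : ℕ} (G : Digraph (Fin n)) (gam : ℚ) (K : ℕ)

/-- The first `k` steps of `w` are along edges of `G`, and `w` starts at `v`. -/
def IsWalk (v : Fin n) (k : ℕ) (w : ℕ → Fin n) : Prop :=
  w 0 = v ∧ ∀ i < k, G.Adj (w i) (w (i + 1))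

/-- The current node together with the ages of all nodes, truncated at `K`. -/
abbrev AgeState (n K : ℕ) : Type := Fin n × (Fin n → Fin (K + 1))

/-- The age state of the sequence `w` at time `t`. -/
def ageState (w : ℕ → Fin n) (t : ℕ) : AgeState n K :=
  (w t, fun u => ⟨min K (age w u t), by omega⟩)

/-- The transitions between age states. -/
def AgeStep (x y : AgeState n K) : Prop :=
  G.Adj x.1 y.1 ∧ ∀ u, (y.2 u : ℕ) = if x.1 = u then 0 else min K (x.2 u + 1)

/-- The lower truncated cost of a visit, read off from the age state. -/
def stateCost (x : AgeState n K) : ℚ := if (x.2 x.1 : ℕ) + 1 ≤ K then gam ^ ((x.2 x.1 : ℕ) + 1) else 0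

/-- The number of an age state: the truncated ages are its lower digits in base `K + 1`. -/
def code (w : ℕ → Fin n) (t : ℕ) : ℕ :=
  ∑ u : Fin n, min K (age w u t) * (K + 1) ^ (u : ℕ) + (K + 1) ^ n * (w t : ℕ)

variable {G gam K}

theorem card_ageState : Fintype.card (AgeState n K) = n * (K + 1) ^ n := by simp

theorem code_eq (w : ℕ → Fin n) (t : ℕ) : code K w t =
    (finProdFinEquiv ((ageState K w t).1, finFunctionFinEquiv (ageState K w t).2) : ℕ) := by
  simp [code, finProdFinEquiv, ageState]

theorem code_lt (w : ℕ → Fin n) (t : ℕ) : code K w t < n * (K + 1) ^ n := by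
  rw [code_eq]; exact Fin.is_lt _

theorem code_inj {w w' : ℕ → Fin n} {t t' : ℕ} :
    code K w t = code K w' t' ↔ ageState K w t = ageState K w' t' := by
  rw [code_eq, code_eq, Fin.val_inj, finProdFinEquiv.injective.eq_iff, Prod.mk.injEq,
    finFunctionFinEquiv.injective.eq_iff, ← Prod.ext_iff]

theorem ageState_congr {w w' : ℕ → Fin n} {t : ℕ} (h : ∀ i ≤ t, w i = w' i) :
    ageState K w t = ageState K w' t := by
  rw [ageState, ageState, h t le_rfl]
  simp only [Prod.mk.injEq, true_and]
  funext u
  simp only [age_congr fun i (hi : i < t) => h i hi.le]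

theorem ageState_succ_snd (w : ℕ → Fin n) (t : ℕ) (u : Fin n) :
    ((ageState K w (t + 1)).2 u : ℕ) = if w t = u then 0 else min K ((ageState K w t).2 u + 1) := by
  simp only [ageState, age]
  split_ifs <;> omega

theorem stateCost_ageState (w : ℕ → Fin n) (t : ℕ) :
    stateCost gam K (ageState K w t) = costLower gam K w t := by
  have h1 : ((ageState K w t).2 (ageState K w t).1 : ℕ) = min K (age w (w t) t) := rfl
  rw [stateCost, costLower]
  by_cases h : age w (w t) t + 1 ≤ K
  · rw [if_pos h, if_pos (by omega), h1, min_eq_right (by omega)]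
  · rw [if_neg h, if_neg (by omega)]

theorem IsWalk.ageStep {v : Fin n} {k : ℕ} {w : ℕ → Fin n} (h : IsWalk G v k w) {i : ℕ} (hi : i < k) :
    AgeStep G K (ageState K w i) (ageState K w (i + 1)) :=
  ⟨h.2 i hi, fun u => ageState_succ_snd w i u⟩

/-- The transitions and the first node determine the ages. -/
theorem ageState_eq_of_ageStep {σ : ℕ → AgeState n K} (h0 : ∀ u, (σ 0).2 u = 0) {m : ℕ}
    (h : ∀ i < m, AgeStep G K (σ i) (σ (i + 1))) {i : ℕ} (hi : i ≤ m) :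
    ageState K (fun t => (σ t).1) i = σ i := by
  refine Prod.ext rfl ?_
  induction i with
  | zero =>
    funext u
    rw [h0 u]
    simp [ageState, age]
  | succ i ih =>
    funext u
    refine Fin.ext ?_
    rw [ageState_succ_snd, ih (by omega), (h i (by omega)).2 u]

/-- Sequences in the same age state are extended by the same node to the same age state. -/
theorem ageState_succ_eq {w w' : ℕ → Fin n} {t t' : ℕ} (h : ageState K w t = ageState K w' t')
    (h' : w (t + 1) = w' (t' + 1)) : ageState K w (t + 1) = ageState K w' (t' + 1) := by
  refine Prod.ext h' (funext fun u => Fin.ext ?_)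
  have h1 : w t = w' t' := congrArg Prod.fst h
  rw [ageState_succ_snd, ageState_succ_snd, h, h1]

/-! ### Ultimately periodic paths -/

/-- The nodes of `w` up to time `p + q`, of which the last `q` are repeated forever. -/
def lasso {V : Type*} (w : ℕ → V) (p q : ℕ) (t : ℕ) : V := if t < p then w t else w (p + (t - p) % q)

theorem lasso_of_lt {V : Type*} (w : ℕ → V) {p q t : ℕ} (h : t < p + q) : lasso w p q t = w t := by
  rw [lasso]
  split_ifs with h'
  · rfl
  · rw [Nat.mod_eq_of_lt (by omega)]; congr 1; omega

theorem lasso_add {V : Type*} (w : ℕ → V) {p q t : ℕ} (h : p ≤ t) :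
    lasso w p q (t + q) = lasso w p q t := by
  rw [lasso, lasso, if_neg (by omega), if_neg (by omega)]
  congr 2
  rw [show t + q - p = (t - p) + q by omega, Nat.add_mod_right]

theorem lasso_of_le {V : Type*} {w : ℕ → V} {p q t : ℕ} (hq : 0 < q) (hw : w p = w (p + q))
    (h : t ≤ p + q) : lasso w p q t = w t := by
  rcases h.lt_or_eq with h | rfl
  · exact lasso_of_lt w h
  · rw [lasso_add w le_rfl, lasso_of_lt w (by omega), hw]

theorem IsWalk.lasso {v : Fin n} {k p q : ℕ} {w : ℕ → Fin n} (h : IsWalk G v k w) (hq : 0 < q)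
    (hk : p + q ≤ k) (hw : w p = w (p + q)) : IsPathFrom G v (lasso w p q) := by
  refine ⟨by rw [lasso_of_lt w (by omega), h.1], fun i => ?_⟩
  induction i using Nat.strong_induction_on with
  | _ i ih =>
    by_cases hi : i < p + q
    · rw [lasso_of_le hq hw hi.le, lasso_of_le hq hw (by omega : i + 1 ≤ p + q)]
      exact h.2 i (by omega)
    · have := ih (i - q) (by omega)
      rw [← lasso_add w (by omega : p ≤ i - q), ← lasso_add w (by omega : p ≤ i - q + 1)] at this
      rwa [show i - q + 1 + q = i + 1 by omega, show i - q + q = i by omega] at this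

/-- After the first period, the ages of the visited nodes are periodic. -/
theorem age_lasso_add {V : Type*} [DecidableEq V] (w : ℕ → V) {p q t : ℕ} (hq : 0 < q)
    (h : p + q ≤ t) : age (lasso w p q) (lasso w p q (t + q)) (t + q) =
      age (lasso w p q) (lasso w p q t) t := by
  -- one period before time `t` the age is reset in both cases
  have key : ∀ d, age (lasso w p q) (lasso w p q t) (t - q + 1 + d + q) =
      age (lasso w p q) (lasso w p q t) (t - q + 1 + d) := by
    have e : lasso w p q (t - q) = lasso w p q t := by
      rw [← lasso_add w (by omega : p ≤ t - q), Nat.sub_add_cancel (by omega)]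
    intro d
    induction d with
    | zero =>
      rw [show t - q + 1 + 0 + q = t + 1 by omega, add_zero, age, age, if_pos rfl, if_pos e]
    | succ d ih =>
      rw [show t - q + 1 + (d + 1) + q = t - q + 1 + d + q + 1 by omega, ← add_assoc, age, age, ih,
        lasso_add w (by omega)]
  rw [lasso_add w (by omega)]
  have := key (q - 1)
  rwa [show t - q + 1 + (q - 1) = t by omega] at this

theorem costExact_lasso_add {V : Type*} [DecidableEq V] (w : ℕ → V) {p q t : ℕ} (hq : 0 < q)
    (h : p + q ≤ t) : costExact gam (lasso w p q) (t + q) = costExact gam (lasso w p q) t := by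
  rw [costExact, costExact, age_lasso_add w hq h]

theorem costUpper_lasso_add {V : Type*} [DecidableEq V] (w : ℕ → V) {p q t : ℕ} (hq : 0 < q)
    (h : p + q ≤ t) : costUpper gam K (lasso w p q) (t + q) = costUpper gam K (lasso w p q) t := by
  rw [costUpper, costUpper, age_lasso_add w hq h]

theorem costLower_lasso_add {V : Type*} [DecidableEq V] (w : ℕ → V) {p q t : ℕ} (hq : 0 < q)
    (h : p + q ≤ t) : costLower gam K (lasso w p q) (t + q) = costLower gam K (lasso w p q) t := by
  rw [costLower, costLower, age_lasso_add w hq h]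

/-- The part of a walk between two visits of the same age state costs as much as the period of
the path that repeats it. -/
theorem sum_costLower_lasso {w : ℕ → Fin n} {p q : ℕ} (hq : 0 < q)
    (h : ageState K w p = ageState K w (p + q)) :
    ∑ t ∈ Finset.Ico (p + q) (p + q + q), costLower gam K (lasso w p q) t =
      ∑ t ∈ Finset.Ico p (p + q), costLower gam K w t := by
  have hw : w p = w (p + q) := congrArg Prod.fst h
  have key : ∀ d, ageState K (lasso w p q) (p + d + q) = ageState K (lasso w p q) (p + d) := by
    intro d
    induction d with
    | zero =>
      rw [add_zero, ageState_congr (w' := w) fun i hi => lasso_of_le hq hw (by omega),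
        ageState_congr (t := p) (w' := w) fun i hi => lasso_of_le hq hw (by omega), h]
    | succ d ih =>
      have := ageState_succ_eq ih (by
        rw [show p + d + q + 1 = p + d + 1 + q by omega, lasso_add w (by omega)])
      rwa [show p + d + q + 1 = p + (d + 1) + q by omega] at this
  rw [Finset.sum_Ico_eq_sum_range, Finset.sum_Ico_eq_sum_range]
  rw [show p + q + q - (p + q) = q by omega, show p + q - p = q by omega]
  refine Finset.sum_congr rfl fun d hd => ?_
  have hd' := Finset.mem_range.1 hd
  rw [← stateCost_ageState, ← stateCost_ageState, show p + q + d = p + d + q by omega, key]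
  rw [ageState_congr (w' := w) fun i hi => lasso_of_le hq hw (by omega)]

/-! ### Optimality of the best closed walk in the cheapest walks -/

/-- The mean reward `1 - cost` over one period of `lasso w p q`. -/
def lassoGain (gam : ℚ) (K : ℕ) (w : ℕ → Fin n) (p q : ℕ) : ℚ :=
  (q - ∑ t ∈ Finset.Ico (p + q) (p + q + q), costLower gam K (lasso w p q) t) / q

/-- If for every walk with `M = n * (K + 1) ^ n` steps there is one that is as good, ends in the same
age state, and contains no closed walk with a mean reward above `g`, then the mean reward of no infinite
path exceeds `g` in the limit. -/
theorem le_sum_costLower {v : Fin n} {g : ℚ} (h0 : 0 < gam) (hg : g ≤ 1)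
    (hopt : ∀ w, IsWalk G v (n * (K + 1) ^ n) w → ∃ w', IsWalk G v (n * (K + 1) ^ n) w' ∧
      ageState K w' (n * (K + 1) ^ n) = ageState K w (n * (K + 1) ^ n) ∧
      ∑ t ∈ Finset.range (n * (K + 1) ^ n), costLower gam K w' t ≤
        ∑ t ∈ Finset.range (n * (K + 1) ^ n), costLower gam K w t ∧
      ∀ p q, 0 < q → p + q ≤ n * (K + 1) ^ n → w' p = w' (p + q) → lassoGain gam K w' p q ≤ g)
    {π : ℕ → Fin n} (hπ : IsPathFrom G v π) (N : ℕ) :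
    (1 - g) * N - (1 - g) * (n * (K + 1) ^ n : ℕ) ≤
      ∑ t ∈ Finset.range N, costLower gam K π t := by
  have hstate0 : ∀ w : ℕ → Fin n, w 0 = v → ageState K w 0 = (v, fun _ => 0) := by
    intro w hw
    refine Prod.ext hw (funext fun u => ?_)
    simp [ageState, age]
  have := le_sum_of_optimal_walks (R := AgeStep G K) (f := stateCost gam K) (s₀ := (v, fun _ => 0))
    (μ := 1 - g) (by linarith) (fun x => by rw [stateCost]; split_ifs <;> positivity) ?_
    (w := ageState K π) (hstate0 π hπ.1) (fun i => IsWalk.ageStep (k := i + 1)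
      ⟨hπ.1, fun i _ => hπ.2 i⟩ (Nat.lt_succ_self i)) N
  · simp only [stateCost_ageState, card_ageState] at this
    exact this
  · rw [card_ageState]
    intro x c hc
    obtain ⟨σ, hσ0, hσM, hσ, rfl⟩ := hc.exists_fun
    have hst := fun i (hi : i ≤ n * (K + 1) ^ n) =>
      ageState_eq_of_ageStep (fun u => by rw [hσ0]) hσ hi
    obtain ⟨w', hw', hend, hcost, hgain⟩ := hopt (fun t => (σ t).1)
      ⟨congrArg Prod.fst hσ0, fun i hi => (hσ i hi).1⟩
    refine ⟨ageState K w', hstate0 _ hw'.1, by rw [hend, hst _ le_rfl, hσM],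
      fun i hi => hw'.ageStep hi, ?_, ?_⟩
    · simp only [stateCost_ageState]
      refine hcost.trans (Finset.sum_le_sum fun t ht => ?_)
      rw [← stateCost_ageState, hst t (Finset.mem_range.1 ht).le]
    · intro i j hij hj heq
      obtain ⟨q, rfl⟩ := Nat.exists_eq_add_of_lt hij
      have h1 := hgain i (q + 1) (by omega) hj (congrArg Prod.fst heq)
      rw [lassoGain, sum_costLower_lasso (by omega) (by exact heq)] at h1
      have hq : (0 : ℚ) < ((q + 1 : ℕ) : ℚ) := by positivity
      rw [div_le_iff₀ hq] at h1
      simp only [stateCost_ageState]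
      rw [show i + q + 1 - i = q + 1 by omega, show i + q + 1 = i + (q + 1) by omega]
      linarith

theorem lassoGain_le_one (h0 : 0 < gam) (w : ℕ → Fin n) (p : ℕ) {q : ℕ} (hq : 0 < q) :
    lassoGain gam K w p q ≤ 1 := by
  have hq' : (0 : ℚ) < q := by exact_mod_cast hq
  rw [lassoGain, div_le_one hq']
  have : 0 ≤ ∑ t ∈ Finset.Ico (p + q) (p + q + q), costLower gam K (lasso w p q) t :=
    Finset.sum_nonneg fun _ _ => costLower_nonneg h0
  linarith

theorem lassoGain_pos (h0 : 0 < gam) (h1 : gam < 1) (w : ℕ → Fin n) (p : ℕ) {q : ℕ} (hq : 0 < q) :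
    0 < lassoGain gam K w p q := by
  have hq' : (0 : ℚ) < q := by exact_mod_cast hq
  rw [lassoGain]
  refine div_pos ?_ hq'
  have : ∑ t ∈ Finset.Ico (p + q) (p + q + q), costLower gam K (lasso w p q) t ≤ q * gam := by
    refine (Finset.sum_le_card_nsmul _ _ gam fun t _ =>
      (costLower_le_costExact h0).trans (costExact_le h0 h1)).trans ?_
    simp
  nlinarith

end States

/-! ### Limit averages -/

section Averages

theorem tendsto_average_of_bounded {a : ℕ → ℝ} {m C : ℝ}
    (h : ∀ N : ℕ, |∑ t ∈ Finset.range N, a t - m * N| ≤ C) :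
    Tendsto (fun N : ℕ => (∑ t ∈ Finset.range (N + 1), a t) / ((N : ℝ) + 1)) atTop (nhds m) := by
  have hC : Tendsto (fun N : ℕ => C / ((N : ℝ) + 1)) atTop (nhds 0) := by
    have := (tendsto_one_div_add_atTop_nhds_zero_nat (𝕜 := ℝ)).const_mul C
    simpa [div_eq_mul_inv] using this
  rw [tendsto_iff_norm_sub_tendsto_zero]
  refine squeeze_zero (fun _ => norm_nonneg _) (fun N => ?_) hC
  have hN : (0 : ℝ) < (N : ℝ) + 1 := by positivity
  have := h (N + 1)
  push_cast at this
  rw [Real.norm_eq_abs, ← mul_div_cancel_right₀ m hN.ne', ← sub_div, abs_div, abs_of_pos hN]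
  gcongr

/-- The averages of an ultimately periodic sequence converge to its mean over one period. -/
theorem tendsto_average_of_periodic {a : ℕ → ℝ} {T q : ℕ} (hq : 0 < q)
    (h : ∀ t, T ≤ t → a (t + q) = a t) :
    Tendsto (fun N : ℕ => (∑ t ∈ Finset.range (N + 1), a t) / ((N : ℝ) + 1)) atTop
      (nhds ((∑ t ∈ Finset.Ico T (T + q), a t) / q)) := by
  have hq' : (q : ℝ) ≠ 0 := by positivity
  set m := (∑ t ∈ Finset.Ico T (T + q), a t) / q with hm
  set e : ℕ → ℝ := fun N => |∑ t ∈ Finset.range N, a t - m * N| with he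
  have hper : ∀ d, ∑ t ∈ Finset.Ico (T + d) (T + d + q), a t = m * q := by
    intro d
    induction d with
    | zero => rw [hm, div_mul_cancel₀ _ hq']; simp
    | succ d ih =>
      rw [← ih, show T + (d + 1) + q = T + d + q + 1 by omega, ← add_assoc,
        Finset.sum_Ico_succ_top (by omega), Finset.sum_eq_sum_Ico_succ_bot (by omega : T + d < T + d + q),
        h _ (by omega)]
      ring
  have hstep : ∀ N, T ≤ N → e (N + q) = e N := by
    intro N hN
    simp only [he]
    rw [Finset.range_eq_Ico, ← Finset.sum_Ico_consecutive a (Nat.zero_le N) (by omega : N ≤ N + q)]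
    have := hper (N - T)
    rw [show T + (N - T) = N by omega] at this
    rw [this, ← Finset.range_eq_Ico]
    congr 1
    push_cast
    ring
  refine tendsto_average_of_bounded (C := ∑ N ∈ Finset.range (T + q), e N) fun N => ?_
  change e N ≤ _
  induction N using Nat.strong_induction_on with
  | _ N ih =>
    by_cases hN : N < T + q
    · exact Finset.single_le_sum (f := e) (fun _ _ => abs_nonneg _) (Finset.mem_range.2 hN)
    · have := hstep (N - q) (by omega)
      rw [show N - q + q = N by omega] at this
      rw [this]
      exact ih (N - q) (by omega)

variable {V : Type*} [DecidableEq V] {lam gam : ℚ} {K : ℕ}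

theorem rSum_eq (h1 : gam < 1) (π : ℕ → V) (N : ℕ) : rSum (lam : ℝ) (gam : ℝ) π N =
    (lam : ℝ) / (1 - gam) * (((N : ℝ) + 1) - ∑ t ∈ Finset.range (N + 1), (costExact gam π t : ℝ)) := by
  have h1' : (gam : ℝ) < 1 := by exact_mod_cast h1
  have h : ∀ t, ∑ j ∈ Finset.range (last π t (π t)), (gam : ℝ) ^ j * lam =
      (lam : ℝ) / (1 - gam) * (1 - (costExact gam π t : ℝ)) := by
    intro t
    rw [← Finset.sum_mul, geom_sum_eq h1'.ne, last_eq_age, costExact]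
    push_cast
    have : (gam : ℝ) - 1 ≠ 0 := by linarith
    have : 1 - (gam : ℝ) ≠ 0 := by linarith
    field_simp
    ring
  rw [rSum, Finset.sum_congr rfl fun t _ => h t, ← Finset.mul_sum, Finset.sum_sub_distrib]
  simp

theorem cSumUpper_eq (π : ℕ → V) (N : ℕ) : cSumUpper (gam : ℝ) K π N =
    ∑ t ∈ Finset.range (N + 1), (costUpper gam K π t : ℝ) := by
  simp [cSumUpper, costUpper, last_eq_age]

theorem cSumLower_eq (π : ℕ → V) (N : ℕ) : cSumLower (gam : ℝ) K π N =
    ∑ t ∈ Finset.range (N + 1), (costLower gam K π t : ℝ) := by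
  refine Finset.sum_congr rfl fun t _ => ?_
  rw [last_eq_age, costLower]
  split_ifs <;> simp

/-- `lam / (1 - gam)` times the mean of `1 - cost` over one period of `lasso w p q`. -/
def lassoReward (lam gam : ℚ) (cost : ℕ → ℚ) (p q : ℕ) : ℚ :=
  lam / (1 - gam) * ((q - ∑ t ∈ Finset.Ico (p + q) (p + q + q), cost t) / q)

theorem lassoReward_cast {cost : ℕ → ℚ} {p q : ℕ} (hq : 0 < q) :
    ((lassoReward lam gam cost p q : ℚ) : ℝ) = lam / (1 - gam) -
      lam / (1 - gam) * ((∑ t ∈ Finset.Ico (p + q) (p + q + q), (cost t : ℝ)) / q) := by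
  have : (q : ℝ) ≠ 0 := by positivity
  rw [lassoReward]
  push_cast
  rw [sub_div, div_self this, mul_sub, mul_one]

theorem rAv_lasso (h1 : gam < 1) (w : ℕ → V) {p q : ℕ} (hq : 0 < q) :
    rAv (lam : ℝ) (gam : ℝ) (lasso w p q) =
      (lassoReward lam gam (costExact gam (lasso w p q)) p q : ℚ) := by
  rw [lassoReward_cast hq]
  refine Tendsto.liminf_eq ?_
  have := (tendsto_average_of_periodic (a := fun t => (costExact gam (lasso w p q) t : ℝ)) hq
    (T := p + q) fun t ht => by rw [costExact_lasso_add w hq ht]).const_mul ((lam : ℝ) / (1 - gam))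
  refine ((tendsto_const_nhds (x := (lam : ℝ) / (1 - gam))).sub this).congr fun N => ?_
  have hN : (N : ℝ) + 1 ≠ 0 := by positivity
  rw [rSum_eq h1, mul_div_assoc, sub_div, div_self hN]
  ring

theorem rAvUnder_lasso (w : ℕ → V) {p q : ℕ} (hq : 0 < q) :
    rAvUnder (lam : ℝ) (gam : ℝ) K (lasso w p q) =
      (lassoReward lam gam (costUpper gam K (lasso w p q)) p q : ℚ) := by
  rw [lassoReward_cast hq, rAvUnder]
  congr 2
  refine Tendsto.limsup_eq ?_
  simp only [cSumUpper_eq]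
  exact tendsto_average_of_periodic (a := fun t => (costUpper gam K (lasso w p q) t : ℝ)) hq
    fun t ht => by rw [costUpper_lasso_add w hq ht]

theorem rAvOver_lasso (w : ℕ → V) {p q : ℕ} (hq : 0 < q) :
    rAvOver (lam : ℝ) (gam : ℝ) K (lasso w p q) =
      (lassoReward lam gam (costLower gam K (lasso w p q)) p q : ℚ) := by
  rw [lassoReward_cast hq, rAvOver]
  congr 2
  refine Tendsto.limsup_eq ?_
  simp only [cSumLower_eq]
  exact tendsto_average_of_periodic (a := fun t => (costLower gam K (lasso w p q) t : ℝ)) hq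
    fun t ht => by rw [costLower_lasso_add w hq ht]

/-- A linear lower bound for the lower truncated costs bounds the limit-average reward. -/
theorem rAv_le (hlam : 0 < lam) (h0 : 0 < gam) (h1 : gam < 1) {g C : ℚ} {π : ℕ → V}
    (h : ∀ N : ℕ, (1 - g) * N - C ≤ ∑ t ∈ Finset.range N, costLower gam K π t) :
    rAv (lam : ℝ) (gam : ℝ) π ≤ (lam : ℝ) / (1 - gam) * g := by
  have hA : (0 : ℝ) < (lam : ℝ) / (1 - gam) := by
    have : (0 : ℚ) < lam / (1 - gam) := div_pos hlam (by linarith)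
    exact_mod_cast this
  have hlim : Tendsto (fun N : ℕ => (lam : ℝ) / (1 - gam) * g +
      (lam : ℝ) / (1 - gam) * C * (1 / ((N : ℝ) + 1))) atTop (nhds ((lam : ℝ) / (1 - gam) * g)) := by
    simpa using (tendsto_one_div_add_atTop_nhds_zero_nat (𝕜 := ℝ)).const_mul
      ((lam : ℝ) / (1 - gam) * C) |>.const_add ((lam : ℝ) / (1 - gam) * g)
  rw [← hlim.liminf_eq]
  have hle : ∀ N : ℕ, rSum (lam : ℝ) gam π N / ((N : ℝ) + 1) ≤ (lam : ℝ) / (1 - gam) * g +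
      (lam : ℝ) / (1 - gam) * C * (1 / ((N : ℝ) + 1)) := by
    intro N
    have hN : (0 : ℝ) < (N : ℝ) + 1 := by positivity
    rw [div_le_iff₀ hN, rSum_eq h1, add_mul, mul_assoc _ (1 / _), one_div_mul_cancel hN.ne', mul_one,
      mul_assoc, ← mul_add]
    refine mul_le_mul_of_nonneg_left ?_ hA.le
    have h2 := h (N + 1)
    have h3 : ∑ t ∈ Finset.range (N + 1), costLower gam K π t ≤
        ∑ t ∈ Finset.range (N + 1), costExact gam π t :=
      Finset.sum_le_sum fun t _ => costLower_le_costExact h0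
    have h4 : ((1 - g) * (N + 1 : ℕ) - C : ℝ) ≤ ∑ t ∈ Finset.range (N + 1), (costExact gam π t : ℝ) := by
      exact_mod_cast h2.trans h3
    push_cast at h4
    linarith
  have hnonneg : ∀ N : ℕ, 0 ≤ rSum (lam : ℝ) gam π N / ((N : ℝ) + 1) := by
    intro N
    have : (0 : ℝ) < lam := by exact_mod_cast hlam
    have : (0 : ℝ) < gam := by exact_mod_cast h0
    refine div_nonneg (Finset.sum_nonneg fun t _ => Finset.sum_nonneg fun j _ => by positivity)
      (by positivity)
  exact liminf_le_liminf (Eventually.of_forall hle) (isBoundedUnder_of ⟨0, hnonneg⟩)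
    hlim.isCoboundedUnder_ge

/-- So the truncation bound can be found by comparing powers of `gam`, without logarithms. -/
theorem truncBound_le_iff {eps : ℚ} (hlam : 0 < lam) (h0 : 0 < gam) (h1 : gam < 1) (he : 0 < eps)
    (k : ℕ) : truncBound (lam : ℝ) (gam : ℝ) (eps : ℝ) ≤ k ↔ gam ^ k ≤ eps * (1 - gam) / lam := by
  have h0' : (0 : ℝ) < gam := by exact_mod_cast h0
  have h1' : (gam : ℝ) < 1 := by exact_mod_cast h1
  have hx : (0 : ℚ) < eps * (1 - gam) / lam := div_pos (mul_pos he (by linarith)) hlam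
  have hx' : (0 : ℝ) < eps * (1 - gam) / lam := by exact_mod_cast hx
  rw [truncBound, Nat.ceil_le, div_le_iff_of_neg (Real.log_neg h0' h1'), ← Real.log_pow,
    Real.log_le_log_iff (by positivity) hx']
  exact_mod_cast Iff.rfl

end Averages

/-! ### The program -/

/-! Names of registers (`r…`) and arrays (`a…`). Registers `0, …, 4` and array `0` hold the input, and
the output goes to registers `0, …, 7` and arrays `1` and `2`. The array `aBuf` holds the walk that is
being worked on. In the table, the walk with `k` steps for the age state number `c` has the row number
`k * M + c`; its value is in the cell of `aGain` with this number, and its nodes fill a row of width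
`M + 1` in `aWalk`. Bounds of loop counters, and counters that only their own loop uses, are given by
plain numbers. -/

notation "rN" => 0
notation "rStart" => 1
notation "rLam" => 2
notation "rGam" => 3
notation "rEps" => 4
notation "rOne" => 8
notation "rZero" => 9
notation "rK" => 10
notation "rBase" => 11
notation "rM" => 12
notation "rWidth" => 13
notation "rGamK" => 14
notation "rThr" => 15
notation "rStop" => 16
notation "rFrom" => 20
notation "rTo" => 21
notation "rExact" => 22
notation "rUpper" => 23
notation "rLower" => 24
notation "rCode" => 25
notation "rPower" => 26
notation "rNode" => 27
notation "rTime" => 29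
notation "rAge" => 31
notation "rDecay" => 32
notation "rVisit" => 33
notation "rTmp" => 34
notation "rSrc" => 40
notation "rDst" => 41
notation "rLen" => 42
notation "rAddr" => 45
notation "rVal" => 46
notation "rSlot" => 47
notation "rNew" => 48
notation "rOld" => 49
notation "rLevel" => 51
notation "rState" => 53
notation "rNext" => 57
notation "rPre" => 62
notation "rPer" => 65
notation "rQ" => 67
notation "rBest" => 70
notation "rBestP" => 71
notation "rBestQ" => 72
notation "rBestExact" => 73
notation "rBestUpper" => 74
notation "aAdj" => 0
notation "aFst" => 1
notation "aSnd" => 2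
notation "aBuf" => 3
notation "aWalk" => 4
notation "aGain" => 5

infixr:60 " ;; " => Prog.seq

/-- Copies `rLen` cells of array `a`, from address `rSrc` on, to array `b`, from address `rDst` on. -/
def copyProg (a b : ℕ) : Prog :=
  forLoop 43 44 rLen <|
    .plus rAddr rSrc 43 ;; .load rVal a rAddr ;; .plus rAddr rDst 43 ;; .store b rAddr rVal

/-- Part of `visitProg`: at the times of other visits, the age of the node grows. -/
def waitProg : Prog :=
  .times rDecay rDecay rGam ;; .plus rAge rAge rOne ;; .branch rAge rK .skip (.plus rAge rK rZero)

/-- Part of `visitProg`: adds the costs of the visit. -/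
def chargeProg : Prog :=
  .plus rExact rExact rDecay ;;
    .branch rGamK rDecay
      (.plus rUpper rUpper rDecay ;; .plus rLower rLower rDecay)
      (.plus rUpper rUpper rGamK)

/-- One step of `scanProg`: the visit at time `rTime`, from the point of view of the node `rNode`.
If it is a visit of that node, then its costs are added, unless the time is before `rFrom`. The
registers `rAge` and `rDecay` hold the truncated age and the exact cost of a visit of `rNode`. -/
def visitProg : Prog :=
  .load rVisit aBuf rTime ;;
  .branch rVisit rNode
    (.branch rNode rVisit
      (.branch rFrom rTime chargeProg .skip ;; .const rAge 0 ;; .plus rDecay rGam rZero)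
      waitProg)
    waitProg

/-- Computes the costs of the visits at the times `rFrom ≤ t < rTo` of the sequence in `aBuf`, and the
number of its age state at time `rTo`. -/
def scanProg : Prog :=
  .const rExact 0 ;; .const rUpper 0 ;; .const rLower 0 ;; .const rCode 0 ;; .const rPower 1 ;;
  forLoop rNode 28 rN
    (.const rAge 0 ;; .plus rDecay rGam rZero ;;
      forLoop rTime 30 rTo visitProg ;;
      .times rTmp rAge rPower ;; .plus rCode rCode rTmp ;; .times rPower rPower rBase) ;;
  .load rVisit aBuf rTo ;; .times rTmp rPower rVisit ;; .plus rCode rCode rTmp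

/-- The number of age states. -/
def numStates (n K : ℕ) : ℕ := n * (K + 1) ^ n

/-! ### Copying -/

section Programs

variable {L B : ℕ} {s : State}

theorem copyProg_runs {a b x y len : ℕ} (hab : a ≠ b) (h1 : s.reg rOne = 1) (hx : s.reg rSrc = x)
    (hy : s.reg rDst = y) (hl : s.reg rLen = len) (hL : len ≤ L)
    (hbits : ∀ z : ℤ, |z| ≤ len + 1 → bitLen z ≤ B) (hxb : ∀ t < len, bitLen ((x + t : ℕ) : ℚ) ≤ B)
    (hyb : ∀ t < len, bitLen ((y + t : ℕ) : ℚ) ≤ B) (hab' : ∀ t < len, bitLen (s.arr a (x + t)) ≤ B) :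
    Runs L B (copyProg a b) s fun s' => s'.arr b =
      fun m => if y ≤ m ∧ m < y + len then s.arr a (x + (m - y)) else s.arr b m := by
  refine Runs.forLoop (N := len) (fun k s' => s'.arr b =
      fun m => if y ≤ m ∧ m < y + k then s.arr a (x + (m - y)) else s.arr b m) hl h1 hL hbits
      (by simp [Prog.regs]) (fun _ _ _ h => ⟨h, h⟩) ?_ ?_ (fun s' _ h => h)
  · funext m
    rw [if_neg (by omega)]
  · intro k s' hk hs hi hI
    have e1 : s'.reg 40 = x := by rw [hs.1 _ (by simp [Prog.regs]), hx]
    have e2 : s'.reg 41 = y := by rw [hs.1 _ (by simp [Prog.regs]), hy]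
    have e3 : s'.arr a = s.arr a := hs.2 _ (by simp [Prog.arrs, hab])
    refine .seq (.plus (v := ((x + k : ℕ) : ℚ)) (by rw [e1, hi]; push_cast; rfl) (hxb k hk) ?_)
    refine .seq (.load (m := x + k) (v := s.arr a (x + k)) (by simp) (by simp [e3]) (hab' k hk) ?_)
    refine .seq (.plus (v := ((y + k : ℕ) : ℚ)) (by simp [e2, hi]) (hyb k hk) ?_)
    refine .store (m := y + k) (v := s.arr a (x + k)) (by simp) (by simp) (hab' k hk) ?_
    simp only [State.setArr_arr, State.setReg_arr, if_true, hI]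
    funext m
    rw [Function.update_apply]
    rcases eq_or_ne m (y + k) with rfl | hm
    · rw [if_pos rfl, if_pos (by omega)]; congr 1; omega
    · rw [if_neg hm]
      by_cases h : y ≤ m ∧ m < y + k
      · rw [if_pos h, if_pos (by omega)]
      · rw [if_neg h, if_neg (by omega)]

end Programs

/-- The bounds under which the programs are analysed: fractions with denominator `D` and absolute
value at most `C` have at most `B / 4` bits, `D` is a denominator of all powers of `gam` that occur, and
loops of up to `2 * numStates n K + 2` rounds are allowed. The factor four leaves room for the products
and quotients of a few such numbers, which need not be fractions with denominator `D`. -/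
structure Bounds (n K : ℕ) (gam : ℚ) (D C B L : ℕ) : Prop where
  n_pos : 0 < n
  gam_pos : 0 < gam
  gam_lt : gam < 1
  four_bits : ∀ x, Fits D C x → 4 * bitLen x ≤ B
  pow : ∀ l ≤ 2 * numStates n K + 2, Fits D 1 (gam ^ l)
  le_C : 4 * (numStates n K + 1) ^ 3 ≤ C
  le_L : 2 * numStates n K + 2 ≤ L

open Classical in
/-- The contents of the registers and of the array that stay fixed after the initial phase. -/
structure Env {n : ℕ} (G : Digraph (Fin n)) (gam : ℚ) (K : ℕ) (s : State) : Prop where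
  nodes : s.reg rN = n
  decay : s.reg rGam = gam
  one : s.reg rOne = 1
  zero : s.reg rZero = 0
  trunc : s.reg rK = K
  base : s.reg rBase = (K + 1 : ℕ)
  states : s.reg rM = numStates n K
  width : s.reg rWidth = (numStates n K + 1 : ℕ)
  power : s.reg rGamK = gam ^ K
  adj : ∀ i j : Fin n, s.arr aAdj (i * n + j) = if G.Adj i j then 1 else 0

theorem Env.of_same {n : ℕ} {G : Digraph (Fin n)} {gam : ℚ} {K : ℕ} {s s' : State}
    (h : Env G gam K s) {R A : List ℕ} (hs : Same R A s s')
    (hR : ∀ r ∈ [rN, rGam, rOne, rZero, rK, rBase, rM, rWidth, rGamK], r ∉ R) (hA : aAdj ∉ A) :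
    Env G gam K s' := by
  have e : ∀ r ∈ [rN, rGam, rOne, rZero, rK, rBase, rM, rWidth, rGamK], s'.reg r = s.reg r :=
    fun r hr => hs.1 r (hR r hr)
  exact ⟨(e _ (by simp)).trans h.nodes, (e _ (by simp)).trans h.decay, (e _ (by simp)).trans h.one,
    (e _ (by simp)).trans h.zero, (e _ (by simp)).trans h.trunc, (e _ (by simp)).trans h.base,
    (e _ (by simp)).trans h.states, (e _ (by simp)).trans h.width, (e _ (by simp)).trans h.power,
    fun i j => by rw [hs.2 _ hA, h.adj]⟩

section Bounds

variable {n K : ℕ} {gam : ℚ} {D C B L : ℕ}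

theorem le_numStates (n K : ℕ) : n ≤ numStates n K := Nat.le_mul_of_pos_right _ (by positivity)

theorem pow_le_numStates (hn : 0 < n) : (K + 1) ^ n ≤ numStates n K := Nat.le_mul_of_pos_left _ hn

theorem succ_le_numStates (hn : 0 < n) : K + 1 ≤ numStates n K :=
  (Nat.le_self_pow hn.ne' _).trans (pow_le_numStates hn)

theorem Bounds.bits (h : Bounds n K gam D C B L) (x : ℚ) (hx : Fits D C x) : bitLen x ≤ B := by
  have := h.four_bits x hx
  omega

theorem four_mul_add_le (m : ℕ) : 4 * m + 4 ≤ 4 * (m + 1) ^ 3 := by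
  have := Nat.le_self_pow (n := 3) (by norm_num) (m + 1)
  omega

theorem Bounds.nat (h : Bounds n K gam D C B L) {k : ℕ} (hk : k ≤ 4 * (numStates n K + 1) ^ 3) :
    bitLen (k : ℚ) ≤ B :=
  h.bits _ (Fits.nat (hk.trans h.le_C))

theorem Bounds.small (h : Bounds n K gam D C B L) {k : ℕ} (hk : k ≤ 4 * numStates n K + 4) :
    bitLen (k : ℚ) ≤ B :=
  h.nat (hk.trans (four_mul_add_le _))

theorem Bounds.int (h : Bounds n K gam D C B L) {N : ℕ} (hN : N ≤ 2 * numStates n K + 2) (z : ℤ)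
    (hz : |z| ≤ N + 1) : bitLen z ≤ B := by
  refine h.bits _ (Fits.int (hz.trans ?_))
  have : N + 1 ≤ 4 * (numStates n K + 1) ^ 3 := le_trans (by omega) (four_mul_add_le _)
  exact_mod_cast this.trans h.le_C

theorem Bounds.zero (h : Bounds n K gam D C B L) : bitLen 0 ≤ B := by
  simpa using h.small (k := 0) (by omega)

theorem Bounds.one (h : Bounds n K gam D C B L) : bitLen 1 ≤ B := by
  simpa using h.small (k := 1) (by omega)

theorem Bounds.pow_bits (h : Bounds n K gam D C B L) {l : ℕ} (hl : l ≤ 2 * numStates n K + 2) :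
    bitLen (gam ^ l) ≤ B :=
  h.bits _ ((h.pow l hl).mono ((le_trans (by omega) (four_mul_add_le _)).trans h.le_C))

theorem Bounds.fits_bits (h : Bounds n K gam D C B L) {k : ℕ} {x : ℚ} (hx : Fits D k x)
    (hk : k ≤ 4 * (numStates n K + 1) ^ 3) : bitLen x ≤ B :=
  h.bits _ (hx.mono (hk.trans h.le_C))

end Bounds

/-! ### Scanning -/

/-- The sum of the costs `c i` over the times `a ≤ i < t` of the visits of the node `k`. -/
def visitSum (w : ℕ → ℕ) (c : ℕ → ℚ) (a k t : ℕ) : ℚ :=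
  ∑ i ∈ Finset.range t, if a ≤ i ∧ w i = k then c i else 0

theorem visitSum_succ (w : ℕ → ℕ) (c : ℕ → ℚ) (a k t : ℕ) :
    visitSum w c a k (t + 1) = visitSum w c a k t + if a ≤ t ∧ w t = k then c t else 0 :=
  Finset.sum_range_succ _ _

theorem visitSum_zero (w : ℕ → ℕ) (c : ℕ → ℚ) (a k : ℕ) : visitSum w c a k 0 = 0 := rfl

theorem sum_visitSum {n : ℕ} {w : ℕ → ℕ} (c : ℕ → ℚ) (a : ℕ) {t : ℕ} (hw : ∀ i < t, w i < n) :
    ∑ k ∈ Finset.range n, visitSum w c a k t = ∑ i ∈ Finset.Ico a t, c i := by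
  simp only [visitSum]
  rw [Finset.sum_comm, ← Finset.sum_filter_add_sum_filter_not (Finset.range t) (a ≤ ·)]
  rw [Finset.sum_eq_zero (s := Finset.filter (fun i => ¬ a ≤ i) _), add_zero]
  · have : Finset.filter (a ≤ ·) (Finset.range t) = Finset.Ico a t := by
      ext i; simp [and_comm]
    rw [this]
    refine Finset.sum_congr rfl fun i hi => ?_
    have hi' := Finset.mem_Ico.1 hi
    rw [Finset.sum_eq_single (w i)]
    · simp [hi'.1]
    · intro k _ hk
      rw [if_neg (fun h => hk h.2.symm)]
    · intro h
      exact absurd (Finset.mem_range.2 (hw i hi'.2)) h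
  · intro i hi
    refine Finset.sum_eq_zero fun k _ => if_neg fun h => ?_
    exact (Finset.mem_filter.1 hi).2 h.1

theorem Fits.visitSum {D : ℕ} {w : ℕ → ℕ} {c : ℕ → ℚ} {a t k : ℕ} (h : ∀ i < t, Fits D 1 (c i)) :
    Fits D t (visitSum w c a k t) := by
  have := Fits.sum (D := D) (C := 1) (Finset.range t) (fun i => if a ≤ i ∧ w i = k then c i else 0)
    fun i hi => by
      split_ifs
      · exact h i (Finset.mem_range.1 hi)
      · exact Fits.zero
  simpa [RobotRouting.visitSum] using this

/-- The number of the age state at time `t` for a sequence of node numbers, up to its `k`-th digit. -/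
def codeSum (K : ℕ) (w : ℕ → ℕ) (t k : ℕ) : ℕ :=
  ∑ u ∈ Finset.range k, min K (age w u t) * (K + 1) ^ u

theorem codeSum_lt (K : ℕ) (w : ℕ → ℕ) (t k : ℕ) : codeSum K w t k < (K + 1) ^ k := by
  induction k with
  | zero => simp [codeSum]
  | succ k ih =>
    rw [codeSum, Finset.sum_range_succ, ← codeSum, pow_succ]
    have : min K (age w k t) * (K + 1) ^ k ≤ K * (K + 1) ^ k :=
      Nat.mul_le_mul_right _ (min_le_left _ _)
    nlinarith

section Scan

variable {n : ℕ} {G : Digraph (Fin n)} {gam : ℚ} {K D C B L : ℕ}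

/-- The sums kept by `scanProg`, after the nodes before `k` and the times before `t` for node `k`. -/
structure ScanSums (gam : ℚ) (K : ℕ) (w : ℕ → ℕ) (a b k t : ℕ) (s : State) : Prop where
  exact : s.reg rExact = ∑ k' ∈ Finset.range k, visitSum w (costExact gam w) a k' b +
    visitSum w (costExact gam w) a k t
  upper : s.reg rUpper = ∑ k' ∈ Finset.range k, visitSum w (costUpper gam K w) a k' b +
    visitSum w (costUpper gam K w) a k t
  lower : s.reg rLower = ∑ k' ∈ Finset.range k, visitSum w (costLower gam K w) a k' b +
    visitSum w (costLower gam K w) a k t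

/-- The invariant of the inner loop of `scanProg`. -/
structure VisitInv (gam : ℚ) (K : ℕ) (w : ℕ → ℕ) (a b k t : ℕ) (s : State) : Prop
    extends ScanSums gam K w a b k t s where
  age : s.reg rAge = (min K (age w k t) : ℕ)
  decay : s.reg rDecay = gam ^ (RobotRouting.age w k t + 1)

theorem Bounds.fits_visit (hB : Bounds n K gam D C B L) {w : ℕ → ℕ} {t : ℕ}
    (ht : t ≤ 2 * numStates n K) : Fits D 1 (costExact gam w t) ∧ Fits D 1 (costUpper gam K w t) ∧
      Fits D 1 (costLower gam K w t) := by
  have h := age_le w (w t) t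
  refine ⟨hB.pow _ (by omega), hB.pow _ (by omega), ?_⟩
  rw [costLower]
  split_ifs
  · exact hB.pow _ (by omega)
  · exact Fits.zero

theorem Bounds.scan_bits (hB : Bounds n K gam D C B L) {w : ℕ → ℕ} {c : ℕ → ℚ} {a b k t : ℕ}
    (hc : ∀ i < b, Fits D 1 (c i)) (hb : b ≤ 2 * numStates n K) (hk : k < n) (ht : t ≤ b) :
    bitLen (∑ k' ∈ Finset.range k, visitSum w c a k' b + visitSum w c a k t) ≤ B := by
  have h1 := Fits.sum (D := D) (C := b) (Finset.range k) (fun k' => visitSum w c a k' b)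
    fun k' _ => Fits.visitSum hc
  refine hB.fits_bits (h1.add (Fits.visitSum (t := t) fun i hi => hc i (by omega))) ?_
  rw [Finset.card_range]
  have := le_numStates n K
  have h2 : k * b + t ≤ (k + 1) * b := by rw [Nat.add_mul]; omega
  have h3 : (k + 1) * b ≤ numStates n K * (2 * numStates n K) :=
    Nat.mul_le_mul (by omega) hb
  refine h2.trans (h3.trans ?_)
  rw [pow_succ, pow_two]
  nlinarith [Nat.zero_le (numStates n K), Nat.zero_le (numStates n K * numStates n K)]

theorem waitProg_runs (hB : Bounds n K gam D C B L) {s : State} (hE : Env G gam K s) {w : ℕ → ℕ}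
    {a b k t : ℕ} (hb : b ≤ 2 * numStates n K) (ht : t < b) (hI : VisitInv gam K w a b k t s)
    (hne : w t ≠ k) : Runs L B waitProg s (VisitInv gam K w a b k (t + 1)) := by
  have hage : age w k (t + 1) = age w k t + 1 := by rw [age, if_neg hne]
  have hle := age_le w k t
  have hK := succ_le_numStates (K := K) hB.n_pos
  have hv : ∀ c : ℕ → ℚ, visitSum w c a k (t + 1) = visitSum w c a k t := by
    intro c; rw [visitSum_succ, if_neg (fun h => hne h.2), add_zero]
  refine .seq (.times (v := gam ^ (age w k t + 2)) ?_ (hB.pow_bits (by omega)) ?_)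
  · rw [hI.decay, hE.decay]; ring
  refine .seq (.plus (v := ((min K (age w k t) + 1 : ℕ) : ℚ)) ?_ (hB.small (by omega)) ?_)
  · simp [hI.age, hE.one]
  refine .branch (fun h => .skip ?_) (fun h => .plus (v := K) ?_ (hB.small (by omega)) ?_)
  · simp only [State.setReg_reg] at h
    simp [hE.trunc] at h
    have h' : min K (age w k t) + 1 ≤ K := by exact_mod_cast h
    refine ⟨⟨?_, ?_, ?_⟩, ?_, ?_⟩
    · simp [hI.exact, hv]
    · simp [hI.upper, hv]
    · simp [hI.lower, hv]
    · rw [hage, show min K (age w k t + 1) = min K (age w k t) + 1 by omega]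
      simp
    · simp [hage]
  · simp [hE.trunc, hE.zero]
  · simp only [State.setReg_reg] at h
    simp [hE.trunc] at h
    have h' : K < min K (age w k t) + 1 := by exact_mod_cast h
    refine ⟨⟨?_, ?_, ?_⟩, ?_, ?_⟩
    · simp [hI.exact, hv]
    · simp [hI.upper, hv]
    · simp [hI.lower, hv]
    · rw [hage, show min K (age w k t + 1) = K by omega]
      simp
    · simp [hage]

theorem visitProg_runs (hB : Bounds n K gam D C B L) {s : State} (hE : Env G gam K s) {w : ℕ → ℕ}
    {a b k t : ℕ} (hb : b ≤ 2 * numStates n K) (ht : t < b) (hk : k < n)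
    (hI : VisitInv gam K w a b k t s) (hw : w t < n) (hbuf : s.arr aBuf t = w t)
    (hnode : s.reg rNode = k) (htime : s.reg rTime = t) (hfrom : s.reg rFrom = a) :
    Runs L B visitProg s (VisitInv gam K w a b k (t + 1)) := by
  have hn := le_numStates n K
  refine .seq (.load (m := t) (v := w t) htime hbuf (hB.small (by omega)) ?_)
  set s₁ := s.setReg rVisit (w t : ℚ) with hs₁
  have hI₁ : VisitInv gam K w a b k t s₁ := ⟨⟨hI.exact, hI.upper, hI.lower⟩, hI.age, hI.decay⟩
  have hE₁ : Env G gam K s₁ := hE.of_same ((Same.refl [rVisit] [] s).setReg (by simp) _)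
    (by decide) (by decide)
  have e1 : s₁.reg rVisit = w t := by simp [hs₁]
  have e2 : s₁.reg rNode = k := by simp [hs₁, hnode]
  have e3 : s₁.reg rFrom = a := by simp [hs₁, hfrom]
  have e4 : s₁.reg rTime = t := by simp [hs₁, htime]
  clear_value s₁
  refine .branch (fun h1 => .branch (fun h2 => ?_) fun h2 => ?_) fun h1 => ?_
  · rw [e1, e2] at h1
    rw [e1, e2] at h2
    have hwk : w t = k := le_antisymm (by exact_mod_cast h1) (by exact_mod_cast h2)
    have hage : age w k (t + 1) = 0 := by rw [age, if_pos hwk]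
    have hle := age_le w k t
    -- the sums after the visit
    suffices h : Runs L B (.branch rFrom rTime chargeProg .skip) s₁
        (ScanSums gam K w a b k (t + 1)) by
      refine .seq (h.call fun s₂ hs₂ hS => ?_)
      have hE₂ : Env G gam K s₂ := hE₁.of_same hs₂ (by decide) (by decide)
      refine .seq (.const hB.zero (.plus (v := gam ^ 1) ?_ (hB.pow_bits (by omega)) ?_))
      · simp [hE₂.decay, hE₂.zero]
      · exact ⟨⟨hS.exact, hS.upper, hS.lower⟩, by simp [hage], by simp [hage]⟩
    have c1 : costExact gam w t = gam ^ (age w k t + 1) := by rw [costExact, hwk]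
    have c2 : costUpper gam K w t = gam ^ min K (age w k t + 1) := by rw [costUpper, hwk]
    have c3 : costLower gam K w t = if age w k t + 1 ≤ K then gam ^ (age w k t + 1) else 0 := by
      rw [costLower, hwk]
    refine .branch (fun h => ?_) (fun h => .skip ?_)
    · rw [e3, e4] at h
      have hat : a ≤ t := by exact_mod_cast h
      have hv : ∀ c : ℕ → ℚ, visitSum w c a k t + c t = visitSum w c a k (t + 1) := by
        intro c; rw [visitSum_succ, if_pos ⟨hat, hwk⟩]
      have b1 := hB.scan_bits (w := w) (c := costExact gam w) (a := a) (b := b) (k := k)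
        (t := t + 1) (fun i hi => (hB.fits_visit (by omega)).1) hb hk ht
      have b2 := hB.scan_bits (w := w) (c := costUpper gam K w) (a := a) (b := b) (k := k)
        (t := t + 1) (fun i hi => (hB.fits_visit (by omega)).2.1) hb hk ht
      have b3 := hB.scan_bits (w := w) (c := costLower gam K w) (a := a) (b := b) (k := k)
        (t := t + 1) (fun i hi => (hB.fits_visit (by omega)).2.2) hb hk ht
      refine .seq (.plus ?_ b1 ?_)
      · rw [hI₁.exact, hI₁.decay, ← c1, add_assoc, hv]
      have hiff : gam ^ K ≤ gam ^ (age w k t + 1) ↔ age w k t + 1 ≤ K :=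
        pow_le_pow_iff_right_of_lt_one₀ hB.gam_pos hB.gam_lt
      refine .branch (fun h' => .seq (.plus ?_ b2 (.plus ?_ b3 ?_))) (fun h' => .plus ?_ b2 ?_)
      all_goals
        simp only [State.setReg_reg, Nat.reduceEqDiff, if_false, hE₁.power, hI₁.decay, hiff,
          pow_lt_pow_iff_right_of_lt_one₀ hB.gam_pos hB.gam_lt] at h'
      · simp only [State.setReg_reg, Nat.reduceEqDiff, if_false]
        rw [hI₁.upper, hI₁.decay, add_assoc, ← hv, c2, min_eq_right h']
      · simp only [State.setReg_reg, Nat.reduceEqDiff, if_false]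
        rw [hI₁.lower, hI₁.decay, add_assoc, ← hv, c3, if_pos h']
      · exact ⟨by simp, by simp, by simp⟩
      · simp only [State.setReg_reg, Nat.reduceEqDiff, if_false]
        rw [hI₁.upper, hE₁.power, add_assoc, ← hv, c2, min_eq_left h'.le]
      · refine ⟨by simp, by simp, ?_⟩
        simp only [State.setReg_reg, Nat.reduceEqDiff, if_false]
        rw [hI₁.lower, ← hv, c3, if_neg (by omega), add_zero]
    · rw [e3, e4] at h
      have hat : t < a := by exact_mod_cast h
      have hv : ∀ c : ℕ → ℚ, visitSum w c a k (t + 1) = visitSum w c a k t := by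
        intro c; rw [visitSum_succ, if_neg (by omega), add_zero]
      exact ⟨by rw [hv, hI₁.exact], by rw [hv, hI₁.upper], by rw [hv, hI₁.lower]⟩
  · rw [e1, e2] at h2
    have : w t < k := by exact_mod_cast h2
    exact waitProg_runs hB hE₁ hb ht hI₁ this.ne
  · rw [e1, e2] at h1
    have : k < w t := by exact_mod_cast h1
    exact waitProg_runs hB hE₁ hb ht hI₁ this.ne'

/-- The invariant of the outer loop of `scanProg`. -/
structure ScanInv (gam : ℚ) (K : ℕ) (w : ℕ → ℕ) (a b k : ℕ) (s : State) : Prop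
    extends ScanSums gam K w a b k 0 s where
  code : s.reg rCode = codeSum K w b k
  power : s.reg rPower = ((K + 1) ^ k : ℕ)

/-- What `scanProg` computes. -/
structure Scanned (n : ℕ) (gam : ℚ) (K : ℕ) (w : ℕ → ℕ) (a b : ℕ) (s : State) : Prop where
  exact : s.reg rExact = ∑ t ∈ Finset.Ico a b, costExact gam w t
  upper : s.reg rUpper = ∑ t ∈ Finset.Ico a b, costUpper gam K w t
  lower : s.reg rLower = ∑ t ∈ Finset.Ico a b, costLower gam K w t
  code : s.reg rCode = (codeSum K w b n + (K + 1) ^ n * w b : ℕ)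

theorem scanProg_runs (hB : Bounds n K gam D C B L) {s : State} (hE : Env G gam K s) {w : ℕ → ℕ}
    {a b : ℕ} (hb : b ≤ 2 * numStates n K) (hw : ∀ t ≤ b, w t < n)
    (hbuf : ∀ t ≤ b, s.arr aBuf t = w t) (hfrom : s.reg rFrom = a) (hto : s.reg rTo = b) :
    Runs L B scanProg s (Scanned n gam K w a b) := by
  have hn := le_numStates n K
  have hL := hB.le_L
  have hKp := pow_le_numStates (K := K) hB.n_pos
  refine .seq (.const hB.zero (.seq (.const hB.zero (.seq (.const hB.zero (.seq (.const hB.zero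
    (.seq (.const hB.one (.seq ?_))))))))))
  set s₁ := ((((s.setReg rExact 0).setReg rUpper 0).setReg rLower 0).setReg rCode 0).setReg rPower 1
    with hs₁
  have hsame : Same scanProg.regs scanProg.arrs s s₁ := by
    refine (((((Same.refl _ _ s).setReg ?_ _).setReg ?_ _).setReg ?_ _).setReg ?_ _).setReg ?_ _ <;>
      decide
  have hE₁ : Env G gam K s₁ := hE.of_same hsame (by decide) (by decide)
  have hbuf₁ : ∀ t ≤ b, s₁.arr aBuf t = w t := hbuf
  have hfrom₁ : s₁.reg rFrom = a := hfrom
  have hto₁ : s₁.reg rTo = b := hto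
  have h0 : ScanInv gam K w a b 0 s₁ := by
    refine ⟨⟨?_, ?_, ?_⟩, ?_, ?_⟩ <;> simp [hs₁, visitSum, codeSum]
  clear_value s₁
  refine Runs.forLoop (N := n) (ScanInv gam K w a b) hE₁.nodes hE₁.one (by omega) (hB.int (by omega))
    (by decide) (fun k s x h => ⟨⟨⟨h.exact, h.upper, h.lower⟩, h.code, h.power⟩,
      ⟨⟨h.exact, h.upper, h.lower⟩, h.code, h.power⟩⟩) h0 ?_ ?_
  · intro k s₂ hk hs₂ hnode hI
    refine .seq (.const hB.zero (.seq (.plus (v := gam ^ 1) ?_ (hB.pow_bits (by omega)) (.seq ?_))))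
    · simp [hs₂.1 rGam (by decide), hs₂.1 rZero (by decide), hE₁.decay, hE₁.zero]
    set s₃ := (s₂.setReg rAge 0).setReg rDecay (gam ^ 1) with hs₃
    have hE₃ : Env G gam K s₃ := hE₁.of_same
      ((hs₂.setReg (by decide) _).setReg (by decide) _) (by decide) (by decide)
    have hbuf₃ : ∀ t ≤ b, s₃.arr aBuf t = w t := by
      intro t ht
      change s₂.arr aBuf t = w t
      rw [hs₂.2 aBuf (by decide), hbuf₁ t ht]
    have hfrom₃ : s₃.reg rFrom = a := by simp [hs₃, hs₂.1 rFrom (by decide), hfrom₁]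
    have hto₃ : s₃.reg rTo = b := by simp [hs₃, hs₂.1 rTo (by decide), hto₁]
    have hnode₃ : s₃.reg rNode = k := by simp [hs₃, hnode]
    have hcode₃ : s₃.reg rCode = codeSum K w b k := by simp [hs₃, hI.code]
    have hpow₃ : s₃.reg rPower = ((K + 1) ^ k : ℕ) := by simp [hs₃, hI.power]
    have hI₃ : VisitInv gam K w a b k 0 s₃ := by
      refine ⟨⟨?_, ?_, ?_⟩, ?_, ?_⟩
      · simp [hs₃, hI.exact]
      · simp [hs₃, hI.upper]
      · simp [hs₃, hI.lower]
      · simp [hs₃, age]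
      · simp [hs₃, age]
    clear_value s₃
    refine Runs.forLoop (N := b) (VisitInv gam K w a b k) hto₃ hE₃.one (by omega)
      (hB.int (by omega)) (by decide) (fun k s x h => ⟨⟨⟨h.exact, h.upper, h.lower⟩, h.age, h.decay⟩,
        ⟨⟨h.exact, h.upper, h.lower⟩, h.age, h.decay⟩⟩) hI₃ ?_ ?_
    · intro t s₄ ht hs₄ htime hI₄
      refine visitProg_runs hB (hE₃.of_same hs₄ (by decide) (by decide)) hb ht hk hI₄
        (hw t ht.le) ?_ ?_ htime ?_
      · rw [hs₄.2 aBuf (by decide), hbuf₃ t ht.le]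
      · rw [hs₄.1 rNode (by decide), hnode₃]
      · rw [hs₄.1 rFrom (by decide), hfrom₃]
    · intro s₄ hs₄ hI₄
      have hE₄ : Env G gam K s₄ := hE₃.of_same hs₄ (by decide) (by decide)
      have p1 : (K + 1) ^ (k + 1) ≤ (K + 1) ^ n := Nat.pow_le_pow_right (by omega) hk
      have p2 := codeSum_lt K w b (k + 1)
      have p3 : codeSum K w b (k + 1) = codeSum K w b k + min K (age w k b) * (K + 1) ^ k :=
        Finset.sum_range_succ _ _
      refine .seq (.times (v := ((min K (age w k b) * (K + 1) ^ k : ℕ) : ℚ)) ?_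
        (hB.small (by omega)) ?_)
      · rw [hI₄.age, hs₄.1 rPower (by decide), hpow₃]; push_cast; rfl
      refine .seq (.plus (v := ((codeSum K w b (k + 1) : ℕ) : ℚ)) ?_ (hB.small (by omega)) ?_)
      · rw [p3]
        simp [hs₄.1 rCode (by decide), hcode₃]
      refine .times (v := (((K + 1) ^ (k + 1) : ℕ) : ℚ)) ?_ (hB.small (by omega)) ?_
      · simp [hs₄.1 rPower (by decide), hpow₃, hE₄.base, pow_succ]
      refine ⟨⟨?_, ?_, ?_⟩, ?_, ?_⟩
      · simp [hI₄.exact, Finset.sum_range_succ, visitSum]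
      · simp [hI₄.upper, Finset.sum_range_succ, visitSum]
      · simp [hI₄.lower, Finset.sum_range_succ, visitSum]
      · simp
      · simp
  · intro s₂ hs₂ hI
    have p1 := codeSum_lt K w b n
    have p2 : (K + 1) ^ n + (K + 1) ^ n * w b ≤ numStates n K := by
      have : (K + 1) ^ n * (w b + 1) ≤ (K + 1) ^ n * n := Nat.mul_le_mul_left _ (hw b le_rfl)
      rw [numStates, mul_comm n]
      linarith
    have e1 : s₂.arr aBuf b = w b := by rw [hs₂.2 aBuf (by decide), hbuf₁ b le_rfl]
    have e2 : s₂.reg rTo = b := by rw [hs₂.1 rTo (by decide), hto₁]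
    refine .seq (.load (m := b) (v := w b) e2 e1 (hB.small (by have := hw b le_rfl; omega)) ?_)
    refine .seq (.times (v := (((K + 1) ^ n * w b : ℕ) : ℚ)) ?_ (hB.small (by omega)) ?_)
    · simp [hI.power]
    refine .plus (v := ((codeSum K w b n + (K + 1) ^ n * w b : ℕ) : ℚ)) ?_ (hB.small (by omega)) ?_
    · simp [hI.code]
    have hw' : ∀ i < b, w i < n := fun i hi => hw i hi.le
    refine ⟨?_, ?_, ?_, ?_⟩
    · simp [hI.exact, sum_visitSum _ _ hw', visitSum_zero]
    · simp [hI.upper, sum_visitSum _ _ hw', visitSum_zero]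
    · simp [hI.lower, sum_visitSum _ _ hw', visitSum_zero]
    · simp

end Scan

/-! ### The table of cheapest walks -/

notation "rRow" => 55
notation "rHave" => 56
notation "rEnd" => 59
notation "rEdge" => 60
notation "rAdj" => 61

/-- Enters the walk in `aBuf`, which has `rTo` steps and whose costs and end state have been computed
by `scanProg`, into the table, unless the table holds a walk that is as good. The entry for `k` steps
and the age state number `c` is at `k * M + c`. The array `aGain` holds `k + 1` minus the cost, so
that the value `0` of a fresh cell means that there is no walk. -/
def relaxProg : Prog :=
  .times rSlot rTo rM ;; .plus rSlot rSlot rCode ;; .plus rNew rTo rOne ;; .minus rNew rNew rLower ;;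
  .load rOld aGain rSlot ;;
  .branch rNew rOld .skip
    (.store aGain rSlot rNew ;;
      .times rDst rSlot rWidth ;; .const rSrc 0 ;; .plus rLen rTo rOne ;; copyProg aBuf aWalk)

/-- Offers the walk in `aBuf` with `rTo` steps to the table. -/
def offerProg : Prog := .const rFrom 0 ;; scanProg ;; relaxProg

/-- Offers the extension by the node `rNext` of the walk in row `rRow` of the table. -/
def extendProg : Prog :=
  .times rSrc rRow rWidth ;; .const rDst 0 ;; .plus rLen rLevel rOne ;; copyProg aWalk aBuf ;;
  .load rEnd aBuf rLevel ;; .times rEdge rEnd rN ;; .plus rEdge rEdge rNext ;; .load rAdj aAdj rEdge ;;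
  .branch rOne rAdj (.store aBuf rTo rNext ;; offerProg) .skip

/-- Offers all extensions of the walk for the age state number `rState`. -/
def rowProg : Prog :=
  .times rRow rLevel rM ;; .plus rRow rRow rState ;; .load rHave aGain rRow ;;
  .branch rOne rHave (forLoop rNext 58 rN extendProg) .skip

/-- Fills the part of the table for `rLevel + 1` steps. -/
def levelProg : Prog := .plus rTo rLevel rOne ;; forLoop rState 54 rM rowProg

/-- Fills the table for up to `M` steps. -/
def tableProg : Prog :=
  .store aBuf rZero rStart ;; .const rTo 0 ;; offerProg ;; forLoop rLevel 52 rM levelProg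

section Cast

variable {n : ℕ} {gam : ℚ} {K : ℕ}

theorem age_val (w : ℕ → Fin n) (u : Fin n) (t : ℕ) :
    age (fun i => (w i : ℕ)) (u : ℕ) t = age w u t := by
  induction t with
  | zero => rfl
  | succ t ih => simp only [age, ih, Fin.val_inj]

theorem costExact_val (w : ℕ → Fin n) : costExact gam (fun i => (w i : ℕ)) = costExact gam w := by
  funext t; simp only [costExact, age_val]

theorem costUpper_val (w : ℕ → Fin n) : costUpper gam K (fun i => (w i : ℕ)) = costUpper gam K w := by
  funext t; simp only [costUpper, age_val]

theorem costLower_val (w : ℕ → Fin n) : costLower gam K (fun i => (w i : ℕ)) = costLower gam K w := by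
  funext t; simp only [costLower, age_val]

theorem codeSum_val (w : ℕ → Fin n) (t : ℕ) :
    codeSum K (fun i => (w i : ℕ)) t n + (K + 1) ^ n * (w t : ℕ) = code K w t := by
  rw [codeSum, code, Finset.sum_range]
  simp only [age_val]

end Cast

section Table

variable {n : ℕ} {G : Digraph (Fin n)} {v : Fin n} {gam : ℚ} {K D C B L : ℕ}

/-- The value of a walk with `k` steps in the table. -/
def walkGain (gam : ℚ) (K : ℕ) (w : ℕ → Fin n) (k : ℕ) : ℚ :=
  k + 1 - ∑ t ∈ Finset.range k, costLower gam K w t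

theorem one_le_walkGain (h0 : 0 < gam) (h1 : gam < 1) (w : ℕ → Fin n) (k : ℕ) :
    1 ≤ walkGain gam K w k := by
  have : ∑ t ∈ Finset.range k, costLower gam K w t ≤ k * 1 := by
    refine (Finset.sum_le_card_nsmul _ _ 1 fun t _ =>
      ((costLower_le_costExact h0).trans (costExact_le h0 h1)).trans h1.le).trans ?_
    simp
  rw [walkGain]
  linarith

/-- The table entry for `k` steps and the age state number `c` is empty or describes a walk. -/
def Entry (G : Digraph (Fin n)) (v : Fin n) (gam : ℚ) (K : ℕ) (gain walks : ℕ → ℚ) (k c : ℕ) : Prop :=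
  gain (k * numStates n K + c) = 0 ∨ ∃ w, IsWalk G v k w ∧ code K w k = c ∧
    gain (k * numStates n K + c) = walkGain gam K w k ∧
    ∀ t ≤ k, walks ((k * numStates n K + c) * (numStates n K + 1) + t) = ((w t : ℕ) : ℚ)

/-- All entries of the table are correct. -/
def Sound (G : Digraph (Fin n)) (v : Fin n) (gam : ℚ) (K : ℕ) (gain walks : ℕ → ℚ) : Prop :=
  ∀ k c, k ≤ numStates n K → c < numStates n K → Entry G v gam K gain walks k c

/-- The table entries are at least as good as the walks with `k` steps. -/
def Optimal (G : Digraph (Fin n)) (v : Fin n) (gam : ℚ) (K : ℕ) (gain : ℕ → ℚ) (k : ℕ) : Prop :=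
  ∀ w, IsWalk G v k w → walkGain gam K w k ≤ gain (k * numStates n K + code K w k)

theorem Bounds.walkGain_bits (hB : Bounds n K gam D C B L) (w : ℕ → Fin n) {k : ℕ}
    (hk : k ≤ numStates n K) : bitLen (walkGain gam K w k) ≤ B := by
  have h1 := Fits.sum (D := D) (C := 1) (Finset.range k) (fun t => costLower gam K w t)
    fun t ht => by
      have := (hB.fits_visit (w := fun i => (w i : ℕ)) (t := t)
        (by have := Finset.mem_range.1 ht; omega)).2.2
      rwa [costLower_val] at this
  have h2 : Fits D (k + 1) ((k : ℚ) + 1) := by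
    have := Fits.nat (D := D) (le_refl (k + 1))
    push_cast at this
    exact this
  rw [Finset.card_range] at h1
  exact hB.fits_bits (h2.sub h1) (le_trans (by omega) (four_mul_add_le _))

theorem Entry.bits (hB : Bounds n K gam D C B L) {gain walks : ℕ → ℚ} {k c : ℕ}
    (hk : k ≤ numStates n K) (h : Entry G v gam K gain walks k c) :
    bitLen (gain (k * numStates n K + c)) ≤ B := by
  rcases h with h | ⟨w, -, -, h, -⟩
  · rw [h]; exact hB.zero
  · rw [h]; exact hB.walkGain_bits w hk

theorem row_inj {m a b a' b' : ℕ} (hb : b < m) (hb' : b' < m) (h : a * m + b = a' * m + b') :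
    a = a' ∧ b = b' := by
  have hm : 0 < m := by omega
  have h1 := congrArg (· / m) h
  have h2 := congrArg (· % m) h
  simp only [Nat.add_mod, Nat.mul_mod_left, Nat.zero_add,
    Nat.mod_eq_of_lt hb, Nat.mod_eq_of_lt hb'] at h2
  subst h2
  refine ⟨Nat.eq_of_mul_eq_mul_right hm (by omega), rfl⟩

theorem Bounds.row (hB : Bounds n K gam D C B L) {k c : ℕ} (hk : k ≤ numStates n K)
    (hc : c ≤ numStates n K) : bitLen ((k * numStates n K + c : ℕ) : ℚ) ≤ B := by
  refine hB.nat ?_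
  have h1 : k * numStates n K ≤ numStates n K * numStates n K := Nat.mul_le_mul_right _ hk
  rw [pow_succ, pow_two]
  nlinarith [Nat.zero_le (numStates n K), Nat.zero_le (numStates n K * numStates n K)]

theorem Bounds.cell (hB : Bounds n K gam D C B L) {k c t : ℕ} (hk : k ≤ numStates n K)
    (hc : c ≤ numStates n K) (ht : t ≤ 2 * numStates n K + 1) :
    bitLen (((k * numStates n K + c) * (numStates n K + 1) + t : ℕ) : ℚ) ≤ B := by
  refine hB.nat ?_
  have h1 : k * numStates n K ≤ numStates n K * numStates n K := Nat.mul_le_mul_right _ hk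
  have h2 : (k * numStates n K + c) * (numStates n K + 1) ≤
    (numStates n K * numStates n K + numStates n K) * (numStates n K + 1) :=
    Nat.mul_le_mul_right _ (by omega)
  rw [pow_succ, pow_two]
  nlinarith [Nat.zero_le (numStates n K), Nat.zero_le (numStates n K * numStates n K)]

/-- What a part of the program that offers walks to the table preserves and achieves: the entries
stay correct and do not get worse. -/
structure Improves (G : Digraph (Fin n)) (v : Fin n) (gam : ℚ) (K : ℕ) (s s' : State) : Prop where
  sound : Sound G v gam K (s'.arr aGain) (s'.arr aWalk)
  le : ∀ m, s.arr aGain m ≤ s'.arr aGain m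

theorem relaxProg_runs (hB : Bounds n K gam D C B L) {s : State} (hE : Env G gam K s) {w : ℕ → Fin n}
    {k : ℕ} (hk : k ≤ numStates n K) (hw : IsWalk G v k w)
    (hbuf : ∀ t ≤ k, s.arr aBuf t = ((w t : ℕ) : ℚ)) (hto : s.reg rTo = k)
    (hlow : s.reg rLower = ∑ t ∈ Finset.range k, costLower gam K w t)
    (hcode : s.reg rCode = code K w k) (hS : Sound G v gam K (s.arr aGain) (s.arr aWalk)) :
    Runs L B relaxProg s fun s' => Improves G v gam K s s' ∧
      walkGain gam K w k ≤ s'.arr aGain (k * numStates n K + code K w k) := by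
  have hc : code K w k < numStates n K := code_lt w k
  have hn := le_numStates n K
  have hL := hB.le_L
  set slot := k * numStates n K + code K w k with hslot
  refine .seq (.times (v := ((k * numStates n K : ℕ) : ℚ)) ?_ ?_ ?_)
  · rw [hto, hE.states]; push_cast; rfl
  · simpa using hB.row (c := 0) hk (Nat.zero_le _)
  refine .seq (.plus (v := (slot : ℚ)) ?_ (hB.row hk hc.le) ?_)
  · simp [hcode, hslot]
  refine .seq (.plus (v := ((k + 1 : ℕ) : ℚ)) ?_ (hB.small (by omega)) ?_)
  · simp [hto, hE.one]
  refine .seq (.minus (v := walkGain gam K w k) ?_ (hB.walkGain_bits w hk) ?_)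
  · simp [hlow, walkGain]
  refine .seq (.load (m := slot) (v := s.arr aGain slot) ?_ rfl ((hS k _ hk hc).bits hB hk) ?_)
  · simp
  refine .branch (fun h => .skip ?_) (fun h => ?_)
  · refine ⟨⟨hS, fun m => le_rfl⟩, ?_⟩
    simpa using h
  simp only [State.setReg_reg] at h
  simp at h
  refine .seq (.store (m := slot) (v := walkGain gam K w k) ?_ ?_ (hB.walkGain_bits w hk) ?_)
  · simp
  · simp
  refine .seq (.times (v := ((slot * (numStates n K + 1) : ℕ) : ℚ)) ?_ ?_ ?_)
  · simp [hE.width]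
  · exact hB.cell (t := 0) hk hc.le (by omega)
  refine .seq (.const hB.zero (.seq (.plus (v := ((k + 1 : ℕ) : ℚ)) ?_ (hB.small (by omega)) ?_)))
  · simp [hto, hE.one]
  refine (copyProg_runs (x := 0) (y := slot * (numStates n K + 1)) (len := k + 1) (by decide)
    ?_ ?_ ?_ ?_ (by omega) (hB.int (by omega)) ?_ ?_ ?_).call ?_
  · simp [hE.one]
  · simp
  · simp
  · simp
  · intro t ht
    exact hB.small (by omega)
  · intro t ht
    exact hB.cell hk hc.le (by omega)
  · intro t ht
    simp only [zero_add, State.setArr_arr, State.setReg_arr]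
    simp [hbuf t (by omega)]
    exact hB.small (by have := (w t).2; omega)
  intro s' hs' hcopy
  have hgain : s'.arr aGain = Function.update (s.arr aGain) slot (walkGain gam K w k) := by
    rw [hs'.2 aGain (by decide)]
    simp
  have hwalk : s'.arr aWalk = fun m => if slot * (numStates n K + 1) ≤ m ∧
      m < slot * (numStates n K + 1) + (k + 1) then s.arr aBuf (m - slot * (numStates n K + 1))
      else s.arr aWalk m := by
    rw [hcopy]
    simp
  refine ⟨⟨?_, ?_⟩, ?_⟩
  · intro k' c' hk' hc'
    by_cases heq : k' * numStates n K + c' = slot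
    · obtain ⟨rfl, rfl⟩ := row_inj hc' hc heq
      refine Or.inr ⟨w, hw, rfl, ?_, fun t ht => ?_⟩
      · rw [hgain, ← hslot, Function.update_self]
      · rw [hwalk, ← hslot]
        simp only
        rw [if_pos (by omega), Nat.add_sub_cancel_left, hbuf t ht]
    · have hrow : ∀ t ≤ k', s'.arr aWalk ((k' * numStates n K + c') * (numStates n K + 1) + t) =
          s.arr aWalk ((k' * numStates n K + c') * (numStates n K + 1) + t) := by
        intro t ht
        rw [hwalk]
        simp only
        rw [if_neg]
        rintro ⟨h1, h2⟩
        obtain ⟨d, hd⟩ := Nat.exists_eq_add_of_le h1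
        exact heq (row_inj (m := numStates n K + 1) (b := t) (b' := d) (by omega) (by omega) hd).1
      rcases hS k' c' hk' hc' with h0 | ⟨w', h1, h2, h3, h4⟩
      · left
        rw [hgain, Function.update_of_ne heq, h0]
      · refine Or.inr ⟨w', h1, h2, ?_, fun t ht => ?_⟩
        · rw [hgain, Function.update_of_ne heq, h3]
        · rw [hrow t ht, h4 t ht]
  · intro m
    rw [hgain, Function.update_apply]
    split_ifs with hm
    · rw [hm]; exact h.le
    · exact le_rfl
  · rw [hgain, Function.update_self]

theorem offerProg_runs (hB : Bounds n K gam D C B L) {s : State} (hE : Env G gam K s) {w : ℕ → Fin n}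
    {k : ℕ} (hk : k ≤ numStates n K) (hw : IsWalk G v k w)
    (hbuf : ∀ t ≤ k, s.arr aBuf t = ((w t : ℕ) : ℚ)) (hto : s.reg rTo = k)
    (hS : Sound G v gam K (s.arr aGain) (s.arr aWalk)) :
    Runs L B offerProg s fun s' => Improves G v gam K s s' ∧
      walkGain gam K w k ≤ s'.arr aGain (k * numStates n K + code K w k) := by
  refine .seq (.const hB.zero (.seq ?_))
  have hE₁ : Env G gam K (s.setReg rFrom 0) :=
    hE.of_same ((Same.refl [rFrom] [] s).setReg (by simp) _) (by decide) (by decide)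
  refine (scanProg_runs hB hE₁ (w := fun t => (w t : ℕ)) (a := 0) (b := k) (by omega)
    (fun t _ => (w t).2) hbuf (by simp) (by simp [hto])).call fun s' hs' hsc => ?_
  have hgain : s'.arr aGain = s.arr aGain := hs'.2 _ (by decide)
  have hwalk : s'.arr aWalk = s.arr aWalk := hs'.2 _ (by decide)
  have hbuf' : s'.arr aBuf = s.arr aBuf := hs'.2 _ (by decide)
  refine (relaxProg_runs hB (hE₁.of_same hs' (by decide) (by decide)) hk hw ?_ ?_ ?_ ?_ ?_).call ?_
  · rw [hbuf']; exact hbuf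
  · rw [hs'.1 rTo (by decide)]; simp [hto]
  · rw [hsc.lower, costLower_val, Finset.range_eq_Ico]
  · rw [hsc.code, codeSum_val]
  · rw [hgain, hwalk]; exact hS
  · rintro s'' - ⟨⟨h1, h2⟩, h3⟩
    exact ⟨⟨h1, fun m => by rw [← hgain]; exact h2 m⟩, h3⟩

/-- The hypotheses on the memory while the part of the table for `k + 1` steps is filled. -/
structure LevelEnv (G : Digraph (Fin n)) (v : Fin n) (gam : ℚ) (K k : ℕ) (s : State) : Prop where
  env : Env G gam K s
  sound : Sound G v gam K (s.arr aGain) (s.arr aWalk)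
  optimal : Optimal G v gam K (s.arr aGain) k
  level : s.reg rLevel = k
  next : s.reg rTo = (k + 1 : ℕ)

theorem LevelEnv.of_improves {k : ℕ} {s s' : State} (h : LevelEnv G v gam K k s)
    (hI : Improves G v gam K s s') {R A : List ℕ} (hs : Same R A s s')
    (hR : ∀ r ∈ [rN, rGam, rOne, rZero, rK, rBase, rM, rWidth, rGamK], r ∉ R) (hA : aAdj ∉ A)
    (hl : rLevel ∉ R) (ht : rTo ∉ R) : LevelEnv G v gam K k s' :=
  ⟨h.env.of_same hs hR hA, hI.sound, fun w hw => (h.optimal w hw).trans (hI.le _),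
    (hs.1 _ hl).trans h.level, (hs.1 _ ht).trans h.next⟩

/-- An optimal walk to the age state of `w` at time `k` is extended by the next node of `w` to a walk
that is as good as `w`. -/
theorem walkGain_extend {w w' : ℕ → Fin n} {k : ℕ} (hst : ageState K w' k = ageState K w k)
    (hg : walkGain gam K w k ≤ walkGain gam K w' k) :
    walkGain gam K w (k + 1) ≤ walkGain gam K (Function.update w' (k + 1) (w (k + 1))) (k + 1) ∧
      code K (Function.update w' (k + 1) (w (k + 1))) (k + 1) = code K w (k + 1) := by
  have hagree : ∀ t ≤ k, ∀ i ≤ t, Function.update w' (k + 1) (w (k + 1)) i = w' i := by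
    intro t ht i hi
    rw [Function.update_of_ne (by omega)]
  refine ⟨?_, ?_⟩
  · rw [walkGain, walkGain] at hg
    rw [walkGain, walkGain, Finset.sum_range_succ, Finset.sum_range_succ,
      costLower_congr (hagree k le_rfl), ← stateCost_ageState w' k, hst, stateCost_ageState]
    rw [Finset.sum_congr (g := costLower gam K w') rfl fun t ht =>
      costLower_congr (hagree t (Finset.mem_range.1 ht).le)]
    linarith
  · rw [code_inj]
    exact ageState_succ_eq ((ageState_congr (hagree k le_rfl)).trans hst) (by simp)

theorem extendProg_runs (hB : Bounds n K gam D C B L) {s : State} {k c : ℕ} {u : Fin n}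
    (hE : LevelEnv G v gam K k s) (hk : k < numStates n K) (hc : c < numStates n K)
    (hrow : s.reg rRow = (k * numStates n K + c : ℕ)) (hnext : s.reg rNext = (u : ℕ))
    (hne : s.arr aGain (k * numStates n K + c) ≠ 0) :
    Runs L B extendProg s fun s' => Improves G v gam K s s' ∧
      ∀ w, IsWalk G v (k + 1) w → code K w k = c → w (k + 1) = u → walkGain gam K w (k + 1) ≤
        s'.arr aGain ((k + 1) * numStates n K + code K w (k + 1)) := by
  have hn := le_numStates n K
  have hL := hB.le_L
  obtain ⟨w₀, hw₀, hcode₀, hgain₀, hwalk₀⟩ := (hE.sound k c hk.le hc).resolve_left hne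
  set slot := k * numStates n K + c with hslot
  refine .seq (.times (v := ((slot * (numStates n K + 1) : ℕ) : ℚ)) ?_ ?_ ?_)
  · rw [hrow, hE.env.width]; push_cast; rfl
  · exact hB.cell (t := 0) hk.le hc.le (by omega)
  refine .seq (.const hB.zero (.seq (.plus (v := ((k + 1 : ℕ) : ℚ)) ?_ (hB.small (by omega)) (.seq ?_))))
  · simp [hE.level, hE.env.one]
  refine (copyProg_runs (x := slot * (numStates n K + 1)) (y := 0) (len := k + 1) (by decide)
    ?_ ?_ ?_ ?_ (by omega) (hB.int (by omega)) ?_ ?_ ?_).call ?_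
  · simp [hE.env.one]
  · simp
  · simp
  · simp
  · intro t ht
    exact hB.cell hk.le hc.le (by omega)
  · intro t ht
    exact hB.small (by omega)
  · intro t ht
    simp only [State.setReg_arr]
    rw [hwalk₀ t (by omega)]
    exact hB.small (by have := (w₀ t).2; omega)
  intro s₁ hs₁ hcopy
  have hs : Same extendProg.regs extendProg.arrs s s₁ :=
    ((((Same.refl _ _ s).setReg (by decide) _).setReg (by decide) _).setReg (by decide) _).trans
      (hs₁.mono (by decide) (by decide))
  have hgain : s₁.arr aGain = s.arr aGain := hs₁.2 aGain (by decide)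
  have hwalk : s₁.arr aWalk = s.arr aWalk := hs₁.2 aWalk (by decide)
  have hE₁ : LevelEnv G v gam K k s₁ := by
    refine ⟨hE.env.of_same hs (by decide) (by decide), ?_, ?_, ?_, ?_⟩
    · rw [hgain, hwalk]; exact hE.sound
    · rw [hgain]; exact hE.optimal
    · rw [hs₁.1 rLevel (by decide)]; exact hE.level
    · rw [hs₁.1 rTo (by decide)]; exact hE.next
  have hbuf : ∀ t ≤ k, s₁.arr aBuf t = ((w₀ t : ℕ) : ℚ) := by
    intro t ht
    rw [hcopy]
    simp only [State.setReg_arr]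
    rw [if_pos (by omega), Nat.sub_zero, hwalk₀ t ht]
  have hnext₁ : s₁.reg rNext = (u : ℕ) := by
    rw [hs₁.1 rNext (by decide)]; simp [hnext]
  clear hs hs₁ hcopy
  have hend := (w₀ k).2
  have hu := u.2
  -- addresses in the adjacency matrix are at most `n * n`
  have hadj : (w₀ k : ℕ) * n + u ≤ 4 * (numStates n K + 1) ^ 3 := by
    have h1 : (w₀ k : ℕ) * n ≤ numStates n K * numStates n K := Nat.mul_le_mul (by omega) hn
    rw [pow_succ, pow_two]
    nlinarith [Nat.zero_le (numStates n K), Nat.zero_le (numStates n K * numStates n K)]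
  refine .seq (.load (m := k) (v := ((w₀ k : ℕ) : ℚ)) hE₁.level (hbuf k le_rfl) (hB.small (by omega)) ?_)
  refine .seq (.times (v := (((w₀ k : ℕ) * n : ℕ) : ℚ)) ?_ (hB.nat (by omega)) ?_)
  · simp [hE₁.env.nodes]
  refine .seq (.plus (v := (((w₀ k : ℕ) * n + u : ℕ) : ℚ)) ?_ (hB.nat hadj) ?_)
  · simp [hnext₁]
  classical
  refine .seq (.load (m := (w₀ k : ℕ) * n + u) (v := if G.Adj (w₀ k) u then 1 else 0) ?_ ?_ ?_ ?_)
  · simp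
  · simp only [State.setReg_arr]
    rw [hE₁.env.adj]
  · split_ifs
    · exact hB.one
    · exact hB.zero
  -- every walk in question passes through the same age state as the stored walk
  have hsame : ∀ w, code K w k = c → ageState K w₀ k = ageState K w k := by
    intro w hw
    rw [← code_inj, hcode₀, hw]
  refine .branch (fun h => ?_) (fun h => .skip ?_)
  · have hadj' : G.Adj (w₀ k) u := by
      by_contra hna
      simp [hna, hE₁.env.one] at h
      linarith
    set w₁ := Function.update w₀ (k + 1) u with hw₁
    have hw₁0 : ∀ t ≤ k, w₁ t = w₀ t := fun t ht => by rw [hw₁, Function.update_of_ne (by omega)]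
    have hw₁1 : w₁ (k + 1) = u := by rw [hw₁, Function.update_self]
    refine .seq (.store (m := k + 1) (v := ((u : ℕ) : ℚ)) ?_ ?_ (hB.small (by omega)) ?_)
    · simp [hE₁.next]
    · simp [hnext₁]
    refine (offerProg_runs (G := G) (v := v) hB (w := w₁) (k := k + 1) ?_ (by omega) ⟨?_, ?_⟩ ?_ ?_ ?_).call ?_
    · refine hE₁.env.of_same (R := [rEnd, rEdge, rAdj]) (A := [aBuf]) ((((((Same.refl _ _ s₁).setReg
        (by decide) _).setReg (by decide) _).setReg (by decide) _).setReg (by decide) _).setArr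
        (by decide) _ _) (by decide) (by decide)
    · rw [hw₁0 0 (Nat.zero_le _), hw₀.1]
    · intro i hi
      rcases Nat.lt_succ_iff_lt_or_eq.1 hi with hi | rfl
      · rw [hw₁0 i hi.le, hw₁0 (i + 1) hi]
        exact hw₀.2 i hi
      · rw [hw₁0 i le_rfl, hw₁1]
        exact hadj'
    · intro t ht
      rw [State.setArr_arr, if_pos rfl, Function.update_apply]
      rcases Nat.lt_succ_iff_lt_or_eq.1 (Nat.lt_succ_of_le ht) with ht | rfl
      · rw [if_neg (by omega), hw₁0 t (by omega)]
        exact hbuf t (by omega)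
      · rw [if_pos rfl, hw₁1]
    · simp [hE₁.next]
    · simpa using hE₁.sound
    · rintro s₂ - ⟨⟨h1, h2⟩, h3⟩
      refine ⟨⟨h1, fun m => ?_⟩, ?_⟩
      · have := h2 m
        rw [← hgain]
        simpa using this
      · intro w hw hcw hwu
        subst hwu
        have hst := hsame w hcw
        have hopt := hE.optimal w ⟨hw.1, fun i hi => hw.2 i (by omega)⟩
        rw [hcw, ← hslot, hgain₀] at hopt
        obtain ⟨g1, g2⟩ := walkGain_extend hst hopt
        rw [← hw₁] at g1 g2
        rw [g2] at h3
        exact g1.trans h3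
  · have hadj' : ¬ G.Adj (w₀ k) u := by
      intro ha
      simp [ha, hE₁.env.one] at h
    refine ⟨⟨hE₁.sound, fun m => by rw [← hgain]; rfl⟩, ?_⟩
    intro w hw hcw hwu
    have : w₀ k = w k := congrArg Prod.fst (hsame w hcw)
    exact absurd (hwu ▸ this ▸ hw.2 k (by omega)) hadj'

theorem Improves.refl {s : State} (h : Sound G v gam K (s.arr aGain) (s.arr aWalk)) :
    Improves G v gam K s s := ⟨h, fun _ => le_rfl⟩

theorem Improves.trans {s s' s'' : State} (h : Improves G v gam K s s')
    (h' : Improves G v gam K s' s'') : Improves G v gam K s s'' :=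
  ⟨h'.sound, fun m => (h.le m).trans (h'.le m)⟩

theorem rowProg_runs (hB : Bounds n K gam D C B L) {s : State} {k c : ℕ}
    (hE : LevelEnv G v gam K k s) (hk : k < numStates n K) (hc : c < numStates n K)
    (hstate : s.reg rState = c) :
    Runs L B rowProg s fun s' => Improves G v gam K s s' ∧
      ∀ w, IsWalk G v (k + 1) w → code K w k = c → walkGain gam K w (k + 1) ≤
        s'.arr aGain ((k + 1) * numStates n K + code K w (k + 1)) := by
  have hn := le_numStates n K
  have hL := hB.le_L
  set slot := k * numStates n K + c with hslot
  refine .seq (.times (v := ((k * numStates n K : ℕ) : ℚ)) ?_ ?_ ?_)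
  · rw [hE.level, hE.env.states]; push_cast; rfl
  · simpa using hB.row (c := 0) hk.le (Nat.zero_le _)
  refine .seq (.plus (v := (slot : ℚ)) ?_ (hB.row hk.le hc.le) ?_)
  · simp [hstate, hslot]
  refine .seq (.load (m := slot) (v := s.arr aGain slot) ?_ rfl ((hE.sound k c hk.le hc).bits hB hk.le) ?_)
  · simp
  set s₁ := ((s.setReg rRow ((k * numStates n K : ℕ) : ℚ)).setReg rRow (slot : ℚ)).setReg rHave
    (s.arr aGain slot) with hs₁
  have hsame : Same rowProg.regs [] s s₁ :=
    (((Same.refl _ _ s).setReg (by decide) _).setReg (by decide) _).setReg (by decide) _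
  have hI₁ : Improves G v gam K s s₁ := ⟨hE.sound, fun _ => le_rfl⟩
  have hE₁ : LevelEnv G v gam K k s₁ :=
    hE.of_improves hI₁ hsame (by decide) (by decide) (by decide) (by decide)
  have hrow₁ : s₁.reg rRow = slot := by simp [hs₁]
  have hhave₁ : s₁.reg rHave = s₁.arr aGain slot := by simp [hs₁]
  suffices h : Runs L B (.branch rOne rHave (forLoop rNext 58 rN extendProg) .skip) s₁
      fun s' => Improves G v gam K s₁ s' ∧
      ∀ w, IsWalk G v (k + 1) w → code K w k = c → walkGain gam K w (k + 1) ≤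
        s'.arr aGain ((k + 1) * numStates n K + code K w (k + 1)) from
    h.call fun s' _ h => ⟨hI₁.trans h.1, h.2⟩
  clear_value s₁
  clear hsame
  refine .branch (fun h => ?_) (fun h => .skip ?_)
  · rw [hE₁.env.one, hhave₁] at h
    refine Runs.forLoop (N := n) (fun j s' => Improves G v gam K s₁ s' ∧ ∀ w, IsWalk G v (k + 1) w →
      code K w k = c → (w (k + 1) : ℕ) < j → walkGain gam K w (k + 1) ≤
        s'.arr aGain ((k + 1) * numStates n K + code K w (k + 1))) hE₁.env.nodes hE₁.env.one
      (by omega) (hB.int (by omega)) (by decide) (fun _ _ _ h => ⟨⟨⟨h.1.sound, h.1.le⟩, h.2⟩,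
        ⟨⟨h.1.sound, h.1.le⟩, h.2⟩⟩) ⟨.refl hE₁.sound, fun w _ _ hw => by omega⟩ ?_ ?_
    · rintro j s₂ hj hs₂ hnext ⟨hI₂, hcov⟩
      have hE₂ := hE₁.of_improves hI₂ hs₂ (by decide) (by decide) (by decide) (by decide)
      refine (extendProg_runs hB (u := ⟨j, hj⟩) hE₂ hk hc ?_ hnext ?_).call ?_
      · rw [hs₂.1 rRow (by decide), hrow₁]
      · have := h.trans (hI₂.le slot)
        intro h0
        rw [← hslot] at h0
        linarith
      · rintro s₃ - ⟨hI₃, hcov₃⟩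
        refine ⟨hI₂.trans hI₃, fun w hw hcw hlt => ?_⟩
        rcases Nat.lt_succ_iff_lt_or_eq.1 hlt with hlt | heq
        · exact (hcov w hw hcw hlt).trans (hI₃.le _)
        · exact hcov₃ w hw hcw (Fin.ext heq)
    · rintro s₂ - ⟨hI₂, hcov⟩
      exact ⟨hI₂, fun w hw hcw => hcov w hw hcw (w (k + 1)).2⟩
  · rw [hE₁.env.one, hhave₁] at h
    refine ⟨.refl hE₁.sound, fun w hw hcw => ?_⟩
    have h1 := hE₁.optimal w ⟨hw.1, fun i hi => hw.2 i (by omega)⟩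
    have h2 := one_le_walkGain (K := K) hB.gam_pos hB.gam_lt w k
    rw [hcw] at h1
    linarith

theorem levelProg_runs (hB : Bounds n K gam D C B L) {s : State} {k : ℕ} (hE : Env G gam K s)
    (hS : Sound G v gam K (s.arr aGain) (s.arr aWalk)) (hO : Optimal G v gam K (s.arr aGain) k)
    (hk : k < numStates n K) (hlevel : s.reg rLevel = k) :
    Runs L B levelProg s fun s' => Sound G v gam K (s'.arr aGain) (s'.arr aWalk) ∧
      Optimal G v gam K (s'.arr aGain) (k + 1) := by
  have hL := hB.le_L
  refine .seq (.plus (v := ((k + 1 : ℕ) : ℚ)) ?_ (hB.small (by omega)) ?_)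
  · simp [hlevel, hE.one]
  set s₁ := s.setReg rTo ((k + 1 : ℕ) : ℚ) with hs₁
  have hE₁ : LevelEnv G v gam K k s₁ := by
    refine ⟨hE.of_same ((Same.refl [rTo] [] s).setReg (by decide) _) (by decide) (by decide), hS, hO,
      ?_, ?_⟩
    · simp [hs₁, hlevel]
    · simp [hs₁]
  clear_value s₁
  refine Runs.forLoop (N := numStates n K) (fun j s' => Improves G v gam K s₁ s' ∧
    ∀ w, IsWalk G v (k + 1) w → code K w k < j → walkGain gam K w (k + 1) ≤
        s'.arr aGain ((k + 1) * numStates n K + code K w (k + 1))) hE₁.env.states hE₁.env.one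
    (by omega) (hB.int (by omega)) (by decide) (fun _ _ _ h => ⟨⟨⟨h.1.sound, h.1.le⟩, h.2⟩,
      ⟨⟨h.1.sound, h.1.le⟩, h.2⟩⟩) ⟨.refl hE₁.sound, fun w _ hw => by omega⟩ ?_ ?_
  · rintro j s₂ hj hs₂ hstate ⟨hI₂, hcov⟩
    have hE₂ := hE₁.of_improves hI₂ hs₂ (by decide) (by decide) (by decide) (by decide)
    refine (rowProg_runs hB hE₂ hk hj hstate).call ?_
    rintro s₃ - ⟨hI₃, hcov₃⟩
    refine ⟨hI₂.trans hI₃, fun w hw hlt => ?_⟩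
    rcases Nat.lt_succ_iff_lt_or_eq.1 hlt with hlt | heq
    · exact (hcov w hw hlt).trans (hI₃.le _)
    · exact hcov₃ w hw heq
  · rintro s₂ - ⟨hI₂, hcov⟩
    exact ⟨hI₂.sound, fun w hw => hcov w hw (code_lt w k)⟩

theorem tableProg_runs (hB : Bounds n K gam D C B L) {s : State} (hE : Env G gam K s)
    (hstart : s.reg rStart = (v : ℕ)) (hgain : ∀ m, s.arr aGain m = 0) :
    Runs L B tableProg s fun s' => Sound G v gam K (s'.arr aGain) (s'.arr aWalk) ∧
      Optimal G v gam K (s'.arr aGain) (numStates n K) := by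
  have hn := le_numStates n K
  have hL := hB.le_L
  refine .seq (.store (m := 0) (v := ((v : ℕ) : ℚ)) ?_ hstart
    (hB.small (by have := v.2; omega)) (.seq (.const hB.zero (.seq ?_))))
  · simp [hE.zero]
  set s₁ := (s.setArr aBuf 0 ((v : ℕ) : ℚ)).setReg rTo 0 with hs₁
  have hsame : Same [rTo] [aBuf] s s₁ :=
    ((Same.refl _ _ s).setArr (a := aBuf) (by decide) _ _).setReg (i := rTo) (by decide) _
  have hE₁ : Env G gam K s₁ := hE.of_same hsame (by decide) (by decide)
  refine (offerProg_runs (v := v) hB (w := fun _ => v) (k := 0) hE₁ (Nat.zero_le _)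
    ⟨rfl, fun i hi => by omega⟩ ?_ ?_ ?_).call ?_
  · intro t ht
    obtain rfl : t = 0 := by omega
    simp [hs₁]
  · simp [hs₁]
  · intro k c _ _
    left
    rw [hsame.2 aGain (by decide), hgain]
  rintro s₂ hs₂ ⟨⟨hS₂, -⟩, hopt⟩
  have hE₂ : Env G gam K s₂ := hE₁.of_same hs₂ (by decide) (by decide)
  have hO₂ : Optimal G v gam K (s₂.arr aGain) 0 := by
    intro w hw
    have e : code K (fun _ => v) 0 = code K w 0 := by
      rw [code_inj]
      refine ageState_congr fun i hi => ?_
      obtain rfl : i = 0 := by omega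
      exact hw.1.symm
    rw [e] at hopt
    simpa [walkGain] using hopt
  refine Runs.forLoop (N := numStates n K) (fun k s' => Sound G v gam K (s'.arr aGain) (s'.arr aWalk) ∧
      Optimal G v gam K (s'.arr aGain) k) hE₂.states hE₂.one (by omega) (hB.int (by omega))
      (by decide) (fun _ _ _ h => ⟨h, h⟩) ⟨hS₂, hO₂⟩ ?_ fun _ _ h => h
  rintro k s₃ hk hs₃ hlevel ⟨hS₃, hO₃⟩
  exact levelProg_runs hB (hE₂.of_same hs₃ (by decide) (by decide)) hS₃ hO₃ hk hlevel

end Table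

/-! ### The search for the best ultimately periodic path -/

notation "rFst" => 68
notation "rSnd" => 69
notation "rRest" => 64
notation "rGain" => 77

/-- Records the path in `aBuf` with an initial part of length `rPre` and a period of length `rQ`. -/
def recordProg : Prog :=
  .plus rBest rGain rZero ;; .plus rBestP rPre rZero ;; .plus rBestQ rQ rZero ;;
  .minus rBestExact rQ rExact ;; .divide rBestExact rBestExact rQ ;;
  .minus rBestUpper rQ rUpper ;; .divide rBestUpper rBestUpper rQ ;;
  .const rSrc 0 ;; .const rDst 0 ;; .plus rLen rFrom rZero ;; copyProg aBuf aFst ;; copyProg aBuf aSnd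

/-- Unrolls the closed walk between the times `rPre` and `rFrom = rPre + rQ` of the walk in row `rRow`
once more, computes the costs of this second round, and records the path if it is the best so far. The
costs of the first round may differ from those of the later ones, as the ages in it depend on the
initial part. -/
def evalProg : Prog :=
  .times rSrc rRow rWidth ;; .plus rSrc rSrc rPre ;; .plus rDst rFrom rZero ;; .plus rLen rQ rOne ;;
  copyProg aWalk aBuf ;; .plus rTo rFrom rQ ;; scanProg ;;
  .minus rGain rQ rLower ;; .divide rGain rGain rQ ;; .branch rGain rBest .skip recordProg

/-- Evaluates the walk in row `rRow` at the times `rPre` and `rPre + rPer + 1`, if it is at the same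
node at both times. -/
def checkProg : Prog :=
  .plus rQ rPer rOne ;;
  .times rSrc rRow rWidth ;; .const rDst 0 ;; .plus rLen rM rOne ;; copyProg aWalk aBuf ;;
  .load rFst aBuf rPre ;; .plus rFrom rPre rQ ;; .load rSnd aBuf rFrom ;;
  .branch rFst rSnd (.branch rSnd rFst evalProg .skip) .skip

/-- Checks all closed walks that begin at the time `rPre`. -/
def startProg : Prog := .minus rRest rM rPre ;; forLoop rPer 66 rRest checkProg

/-- Checks all closed walks in the walk with `M` steps for the age state number `rState`. -/
def walkProg : Prog :=
  .times rRow rM rM ;; .plus rRow rRow rState ;; .load rHave aGain rRow ;;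
  .branch rOne rHave (forLoop rPre 63 rM startProg) .skip

/-- Checks all closed walks in the walks with `M` steps in the table. -/
def searchProg : Prog := forLoop rState 54 rM walkProg

section Search

variable {n : ℕ} {G : Digraph (Fin n)} {v : Fin n} {gam : ℚ} {K D C B L : ℕ}

/-- The path recorded in the memory. -/
structure Recorded (G : Digraph (Fin n)) (v : Fin n) (gam : ℚ) (K : ℕ) (w : ℕ → Fin n) (p q : ℕ)
    (s : State) : Prop where
  walk : IsWalk G v (numStates n K) w
  pos : 0 < q
  le : p + q ≤ numStates n K
  closed : w p = w (p + q)
  fst : s.reg rBestP = p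
  snd : s.reg rBestQ = q
  gain : s.reg rBest = lassoGain gam K w p q
  exact : s.reg rBestExact =
    (q - ∑ t ∈ Finset.Ico (p + q) (p + q + q), costExact gam (lasso w p q) t) / q
  upper : s.reg rBestUpper =
    (q - ∑ t ∈ Finset.Ico (p + q) (p + q + q), costUpper gam K (lasso w p q) t) / q
  out₁ : ∀ t < p + q, s.arr aFst t = ((w t : ℕ) : ℚ)
  out₂ : ∀ t < p + q, s.arr aSnd t = ((w t : ℕ) : ℚ)

/-- The best path so far, if any, is recorded in the memory. -/
def Best (G : Digraph (Fin n)) (v : Fin n) (gam : ℚ) (K : ℕ) (s : State) : Prop :=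
  s.reg rBest = 0 ∨ ∃ w p q, Recorded G v gam K w p q s

theorem Best.of_same {s s' : State} (h : Best G v gam K s) {R A : List ℕ} (hs : Same R A s s')
    (hR : ∀ r ∈ [rBest, rBestP, rBestQ, rBestExact, rBestUpper], r ∉ R) (hA : aFst ∉ A ∧ aSnd ∉ A) :
    Best G v gam K s' := by
  have e : ∀ r ∈ [rBest, rBestP, rBestQ, rBestExact, rBestUpper], s'.reg r = s.reg r :=
    fun r hr => hs.1 r (hR r hr)
  rcases h with h | ⟨w, p, q, h⟩
  · exact Or.inl ((e _ (by simp)).trans h)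
  · exact Or.inr ⟨w, p, q, h.walk, h.pos, h.le, h.closed, (e _ (by simp)).trans h.fst,
      (e _ (by simp)).trans h.snd, (e _ (by simp)).trans h.gain, (e _ (by simp)).trans h.exact,
      (e _ (by simp)).trans h.upper, fun t ht => by rw [hs.2 _ hA.1, h.out₁ t ht],
      fun t ht => by rw [hs.2 _ hA.2, h.out₂ t ht]⟩

theorem le_of_two_mul_le {a b : ℕ} (h : 2 * a ≤ b) : a ≤ b := by omega

theorem Bounds.fits_period (hB : Bounds n K gam D C B L) (w : ℕ → Fin n) {p q : ℕ}
    (hpq : p + q ≤ numStates n K) :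
    Fits D q (∑ t ∈ Finset.Ico (p + q) (p + q + q), costExact gam (lasso w p q) t) ∧
      Fits D q (∑ t ∈ Finset.Ico (p + q) (p + q + q), costUpper gam K (lasso w p q) t) ∧
      Fits D q (∑ t ∈ Finset.Ico (p + q) (p + q + q), costLower gam K (lasso w p q) t) := by
  have hfits : ∀ c : ℕ → ℚ, (∀ t ≤ 2 * numStates n K, Fits D 1 (c t)) →
      Fits D q (∑ t ∈ Finset.Ico (p + q) (p + q + q), c t) := by
    intro c hc
    have := Fits.sum (D := D) (C := 1) (Finset.Ico (p + q) (p + q + q)) c fun t ht =>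
      hc t (by have := Finset.mem_Ico.1 ht; omega)
    simpa using this
  have h := fun t (ht : t ≤ 2 * numStates n K) =>
    hB.fits_visit (w := fun i => (lasso w p q i).val) ht
  rw [costExact_val (lasso w p q), costUpper_val (lasso w p q), costLower_val (lasso w p q)] at h
  exact ⟨hfits _ fun t ht => (h t ht).1, hfits _ fun t ht => (h t ht).2.1,
    hfits _ fun t ht => (h t ht).2.2⟩

theorem Bounds.quotient_bits (hB : Bounds n K gam D C B L) {q : ℕ} {x : ℚ}
    (hq : q ≤ numStates n K) (hx : Fits D q x) :
    bitLen ((q : ℚ) - x) ≤ B ∧ 2 * bitLen (((q : ℚ) - x) / q) ≤ B := by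
  have hle := four_mul_add_le (numStates n K)
  have h1 := hB.four_bits _ (((Fits.nat (D := D) (le_refl q)).sub hx).mono
    (le_trans (by omega) (hle.trans hB.le_C)))
  have h2 := hB.four_bits q (Fits.nat (le_trans (by omega) (hle.trans hB.le_C)))
  have h3 := bitLen_div_le ((q : ℚ) - x) q
  exact ⟨by omega, by omega⟩

theorem recordProg_runs (hB : Bounds n K gam D C B L) {s : State} (hE : Env G gam K s)
    {w : ℕ → Fin n} {p q : ℕ} (hw : IsWalk G v (numStates n K) w) (hq : 0 < q)
    (hpq : p + q ≤ numStates n K) (hclosed : w p = w (p + q)) (hp' : s.reg rPre = p)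
    (hq' : s.reg rQ = q) (hfrom : s.reg rFrom = (p + q : ℕ))
    (hbuf : ∀ t < p + q, s.arr aBuf t = ((w t : ℕ) : ℚ))
    (hgain : s.reg rGain = lassoGain gam K w p q)
    (hsc : Scanned n gam K (fun t => (lasso w p q t).val) (p + q) (p + q + q) s) :
    Runs L B recordProg s (Recorded G v gam K w p q) := by
  have hn := le_numStates n K
  have hL := hB.le_L
  have hq0 : (q : ℚ) ≠ 0 := by positivity
  have hexact := hsc.exact
  have hupper := hsc.upper
  have hb1 := hB.quotient_bits (by omega) (hB.fits_period w hpq).1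
  have hb2 := hB.quotient_bits (by omega) (hB.fits_period w hpq).2.1
  have hb3 := hB.quotient_bits (by omega) (hB.fits_period w hpq).2.2
  rw [costExact_val (lasso w p q)] at hexact
  rw [costUpper_val (lasso w p q)] at hupper
  refine .seq (.plus (v := lassoGain gam K w p q) ?_ (le_of_two_mul_le hb3.2) ?_)
  · simp [hgain, hE.zero]
  refine .seq (.plus (v := (p : ℚ)) ?_ (hB.small (by omega)) ?_)
  · simp [hp', hE.zero]
  refine .seq (.plus (v := (q : ℚ)) ?_ (hB.small (by omega)) ?_)
  · simp [hq', hE.zero]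
  refine .seq (.minus ?_ hb1.1 ?_)
  · simp [hq', hexact]
  refine .seq (.divide ?_ ?_ (le_of_two_mul_le hb1.2) ?_)
  · simpa [hq'] using hq0
  · simp [hq']
  refine .seq (.minus ?_ hb2.1 ?_)
  · simp [hq', hupper]
  refine .seq (.divide ?_ ?_ (le_of_two_mul_le hb2.2) ?_)
  · simpa [hq'] using hq0
  · simp [hq']
  refine .seq (.const hB.zero (.seq (.const hB.zero (.seq
    (.plus (v := ((p + q : ℕ) : ℚ)) ?_ (hB.small (by omega)) (.seq ?_))))))
  · simp [hfrom, hE.zero]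
  have hbits : ∀ t < p + q, bitLen (s.arr aBuf (0 + t)) ≤ B := by
    intro t ht
    rw [zero_add, hbuf t ht]
    exact hB.small (by have := (w t).2; omega)
  refine (copyProg_runs (a := aBuf) (b := aFst) (x := 0) (y := 0) (len := p + q) (by decide) ?_ ?_ ?_ ?_ (by omega)
    (hB.int (by omega)) (fun t ht => hB.small (by omega)) (fun t ht => hB.small (by omega)) ?_).call ?_
  · simp [hE.one]
  · simp
  · simp
  · simp
  · exact hbits
  intro s₁ hs₁ hc₁
  refine (copyProg_runs (a := aBuf) (b := aSnd) (x := 0) (y := 0) (len := p + q) (by decide) ?_ ?_ ?_ ?_ (by omega)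
    (hB.int (by omega)) (fun t ht => hB.small (by omega)) (fun t ht => hB.small (by omega)) ?_).call ?_
  · rw [hs₁.1 rOne (by decide)]; simp [hE.one]
  · rw [hs₁.1 rSrc (by decide)]; simp
  · rw [hs₁.1 rDst (by decide)]; simp
  · rw [hs₁.1 rLen (by decide)]; simp
  · rw [hs₁.2 aBuf (by decide)]; exact hbits
  intro s₂ hs₂ hc₂
  refine ⟨hw, hq, hpq, hclosed, ?_, ?_, ?_, ?_, ?_, ?_, ?_⟩
  · rw [hs₂.1 _ (by decide), hs₁.1 _ (by decide)]; simp
  · rw [hs₂.1 _ (by decide), hs₁.1 _ (by decide)]; simp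
  · rw [hs₂.1 _ (by decide), hs₁.1 _ (by decide)]; simp
  · rw [hs₂.1 _ (by decide), hs₁.1 _ (by decide)]; simp
  · rw [hs₂.1 _ (by decide), hs₁.1 _ (by decide)]; simp
  · intro t ht
    rw [hs₂.2 aFst (by decide), hc₁]
    simp [ht, hbuf t ht]
  · intro t ht
    rw [hc₂, hs₁.2 aBuf (by decide)]
    simp [ht, hbuf t ht]

/-- What the search keeps fixed while it is working on the walk `w` with `M` steps, the one for the
age state number `c`. -/
structure RowEnv (G : Digraph (Fin n)) (gam : ℚ) (K c : ℕ) (w : ℕ → Fin n) (s : State) : Prop where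
  env : Env G gam K s
  row : s.reg rRow = (numStates n K * numStates n K + c : ℕ)
  cells : ∀ t ≤ numStates n K, s.arr aWalk ((numStates n K * numStates n K + c) *
    (numStates n K + 1) + t) = ((w t : ℕ) : ℚ)

theorem RowEnv.of_same {c : ℕ} {w : ℕ → Fin n} {s s' : State} (h : RowEnv G gam K c w s)
    {R A : List ℕ} (hs : Same R A s s')
    (hR : ∀ r ∈ [rN, rGam, rOne, rZero, rK, rBase, rM, rWidth, rGamK], r ∉ R) (hA : aAdj ∉ A)
    (hrow : rRow ∉ R) (hwalk : aWalk ∉ A) : RowEnv G gam K c w s' :=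
  ⟨h.env.of_same hs hR hA, (hs.1 _ hrow).trans h.row, fun t ht => by rw [hs.2 _ hwalk, h.cells t ht]⟩

theorem evalProg_runs (hB : Bounds n K gam D C B L) {s : State} {c : ℕ} {w : ℕ → Fin n}
    (hE : RowEnv G gam K c w s) (hc : c < numStates n K) (hw : IsWalk G v (numStates n K) w) {p q : ℕ}
    (hq : 0 < q) (hpq : p + q ≤ numStates n K) (hclosed : w p = w (p + q)) (hp' : s.reg rPre = p)
    (hq' : s.reg rQ = q) (hfrom : s.reg rFrom = (p + q : ℕ))
    (hbuf : ∀ t < p + q, s.arr aBuf t = ((w t : ℕ) : ℚ)) (hbest : Best G v gam K s) :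
    Runs L B evalProg s fun s' => Best G v gam K s' ∧ s.reg rBest ≤ s'.reg rBest ∧
      lassoGain gam K w p q ≤ s'.reg rBest := by
  have hn := le_numStates n K
  have hL := hB.le_L
  set M := numStates n K with hM
  set base := (M * M + c) * (M + 1) with hbase
  refine .seq (.times (v := (base : ℚ)) ?_ (hB.cell (t := 0) le_rfl hc.le (by omega)) ?_)
  · rw [hE.row, hE.env.width, hbase]; push_cast; rfl
  refine .seq (.plus (v := ((base + p : ℕ) : ℚ)) ?_ (hB.cell le_rfl hc.le (by omega)) ?_)
  · simp [hp']
  refine .seq (.plus (v := ((p + q : ℕ) : ℚ)) ?_ (hB.small (by omega)) ?_)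
  · simp [hfrom, hE.env.zero]
  refine .seq (.plus (v := ((q + 1 : ℕ) : ℚ)) ?_ (hB.small (by omega)) (.seq ?_))
  · simp [hq', hE.env.one]
  refine (copyProg_runs (x := base + p) (y := p + q) (len := q + 1) (by decide) ?_ ?_ ?_ ?_ (by omega)
    (hB.int (by omega)) ?_ (fun t ht => hB.small (by omega)) ?_).call ?_
  · simp [hE.env.one]
  · simp
  · simp
  · simp
  · intro t ht
    rw [add_assoc]
    exact hB.cell (t := p + t) le_rfl hc.le (by omega)
  · intro t ht
    simp only [State.setReg_arr]
    rw [add_assoc, hE.cells _ (by omega)]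
    exact hB.small (by have := (w (p + t)).2; omega)
  intro s₁ hs₁ hcopy
  have hs : Same evalProg.regs [aBuf] s s₁ :=
    (((((Same.refl _ _ s).setReg (by decide) _).setReg (by decide) _).setReg (by decide) _).setReg
      (by decide) _).trans (hs₁.mono (by decide) (by decide))
  have hE₁ : RowEnv G gam K c w s₁ :=
    hE.of_same hs (by decide) (by decide) (by decide) (by decide)
  -- the buffer now holds the ultimately periodic path up to the end of its second round
  have hbuf₁ : ∀ t ≤ p + q + q, s₁.arr aBuf t = (((lasso w p q t).val : ℕ) : ℚ) := by
    intro t ht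
    rw [hcopy]
    simp only [State.setReg_arr]
    by_cases h : p + q ≤ t
    · obtain ⟨d, rfl⟩ := Nat.exists_eq_add_of_le h
      rw [if_pos (by omega), Nat.add_sub_cancel_left, add_assoc, hE.cells _ (by omega),
        show p + q + d = p + d + q by omega, lasso_add w (by omega), lasso_of_le hq hclosed (by omega)]
    · rw [if_neg (by omega), hbuf t (by omega), lasso_of_lt w (by omega)]
  have hp₁ : s₁.reg rPre = p := by rw [hs₁.1 _ (by decide)]; simp [hp']
  have hq₁ : s₁.reg rQ = q := by rw [hs₁.1 _ (by decide)]; simp [hq']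
  have hfrom₁ : s₁.reg rFrom = (p + q : ℕ) := by rw [hs₁.1 _ (by decide)]; simp [hfrom]
  have hb₁ : s₁.reg rBest = s.reg rBest := by rw [hs₁.1 _ (by decide)]; simp
  have hbest₁ : Best G v gam K s₁ := by
    refine hbest.of_same (R := [rSrc, rDst, rLen, 43, 44, rAddr, rVal]) (A := [aBuf]) ?_ (by decide) (by decide)
    exact (((((Same.refl _ _ s).setReg (by decide) _).setReg (by decide) _).setReg (by decide) _).setReg
      (by decide) _).trans (hs₁.mono (by decide) (by decide))
  clear hs hs₁ hcopy
  refine .seq (.plus (v := ((p + q + q : ℕ) : ℚ)) ?_ (hB.small (by omega)) (.seq ?_))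
  · rw [hfrom₁, hq₁]; push_cast; rfl
  set s₂ := s₁.setReg rTo ((p + q + q : ℕ) : ℚ) with hs₂
  have hsame₂ : Same [rTo] [] s₁ s₂ := (Same.refl _ _ s₁).setReg (by decide) _
  have hE₂ : RowEnv G gam K c w s₂ :=
    hE₁.of_same hsame₂ (by decide) (by decide) (by decide) (by decide)
  refine (scanProg_runs hB hE₂.env (w := fun t => (lasso w p q t).val) (a := p + q) (b := p + q + q)
    (by omega) (fun t _ => (lasso w p q t).2) hbuf₁ ?_ ?_).call fun s₃ hs₃ hsc => ?_
  · simpa [hs₂] using hfrom₁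
  · simp [hs₂]
  have hE₃ : RowEnv G gam K c w s₃ :=
    hE₂.of_same hs₃ (by decide) (by decide) (by decide) (by decide)
  have hp₃ : s₃.reg rPre = p := by rw [hs₃.1 _ (by decide), hsame₂.1 _ (by decide), hp₁]
  have hq₃ : s₃.reg rQ = q := by rw [hs₃.1 _ (by decide), hsame₂.1 _ (by decide), hq₁]
  have hfrom₃ : s₃.reg rFrom = (p + q : ℕ) := by
    rw [hs₃.1 _ (by decide), hsame₂.1 _ (by decide), hfrom₁]
  have hbuf₃ : ∀ t < p + q, s₃.arr aBuf t = ((w t : ℕ) : ℚ) := by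
    intro t ht
    rw [hs₃.2 _ (by decide), hsame₂.2 _ (by decide), hbuf₁ t (by omega), lasso_of_lt w ht]
  have hb₃ : s₃.reg rBest = s.reg rBest := by
    rw [hs₃.1 _ (by decide), hsame₂.1 _ (by decide), hb₁]
  have hbest₃ : Best G v gam K s₃ :=
    (hbest₁.of_same hsame₂ (by decide) (by decide)).of_same hs₃ (by decide) (by decide)
  have hlower := hsc.lower
  rw [costLower_val (lasso w p q)] at hlower
  have hb := hB.quotient_bits (q := q) (by omega) (hB.fits_period w hpq).2.2
  have hq0 : (q : ℚ) ≠ 0 := by positivity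
  refine .seq (.minus ?_ hb.1 ?_)
  · rw [hq₃, hlower]
  refine .seq (.divide (v := lassoGain gam K w p q) ?_ ?_ (le_of_two_mul_le hb.2) ?_)
  · simpa [hq₃] using hq0
  · simp [hq₃, lassoGain]
  refine .branch (fun h => .skip ?_) (fun h => ?_)
  · simp only [State.setReg_reg] at h
    simp at h
    refine ⟨(hbest₃.of_same (R := [rGain]) (A := []) (((Same.refl _ _ _).setReg (by decide) _).setReg
      (by decide) _) (by decide) (by decide)), ?_, ?_⟩
    · simp [hb₃]
    · simpa using h
  · simp only [State.setReg_reg] at h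
    simp at h
    refine (recordProg_runs hB ?_ hw hq hpq hclosed ?_ ?_ ?_ ?_ ?_ ?_).call ?_
    · exact hE₃.env.of_same (R := [rGain]) (A := []) (((Same.refl _ _ _).setReg (by decide) _).setReg
        (by decide) _) (by decide) (by decide)
    · simp [hp₃]
    · simp [hq₃]
    · simp [hfrom₃]
    · simpa using hbuf₃
    · simp
    · exact ⟨hsc.exact, hsc.upper, hsc.lower, hsc.code⟩
    · rintro s₄ - hR
      refine ⟨Or.inr ⟨w, p, q, hR⟩, ?_, hR.gain.ge⟩
      rw [hR.gain, ← hb₃]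
      exact h.le

theorem checkProg_runs (hB : Bounds n K gam D C B L) {s : State} {c : ℕ} {w : ℕ → Fin n}
    (hE : RowEnv G gam K c w s) (hc : c < numStates n K) (hw : IsWalk G v (numStates n K) w) {p r : ℕ}
    (hpr : p + (r + 1) ≤ numStates n K) (hp' : s.reg rPre = p) (hr' : s.reg rPer = r)
    (hbest : Best G v gam K s) :
    Runs L B checkProg s fun s' => Best G v gam K s' ∧ s.reg rBest ≤ s'.reg rBest ∧
      (w p = w (p + (r + 1)) → lassoGain gam K w p (r + 1) ≤ s'.reg rBest) := by
  have hn := le_numStates n K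
  have hL := hB.le_L
  set M := numStates n K with hM
  set base := (M * M + c) * (M + 1) with hbase
  set q := r + 1 with hqr
  refine .seq (.plus (v := (q : ℚ)) ?_ (hB.small (by omega)) ?_)
  · simp [hr', hE.env.one, hqr]
  refine .seq (.times (v := (base : ℚ)) ?_ (hB.cell (t := 0) le_rfl hc.le (by omega)) ?_)
  · simp [hE.row, hE.env.width, hbase, ← hM]
  refine .seq (.const hB.zero (.seq
    (.plus (v := ((M + 1 : ℕ) : ℚ)) ?_ (hB.small (by omega)) (.seq ?_))))
  · simp [hE.env.states, hE.env.one, ← hM]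
  refine (copyProg_runs (x := base) (y := 0) (len := M + 1) (by decide) ?_ ?_ ?_ ?_ (by omega)
    (hB.int (by omega)) ?_ (fun t ht => hB.small (by omega)) ?_).call ?_
  · simp [hE.env.one]
  · simp
  · simp
  · simp
  · intro t ht
    exact hB.cell le_rfl hc.le (by omega)
  · intro t ht
    simp only [State.setReg_arr]
    rw [hE.cells _ (by omega)]
    exact hB.small (by have := (w t).2; omega)
  intro s₁ hs₁ hcopy
  have hs : Same [rQ, rSrc, rDst, rLen, 43, 44, rAddr, rVal] [aBuf] s s₁ :=
    (((((Same.refl _ _ s).setReg (by decide) _).setReg (by decide) _).setReg (by decide) _).setReg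
      (by decide) _).trans (hs₁.mono (by decide) (by decide))
  have hE₁ := hE.of_same hs (by decide) (by decide) (by decide) (by decide)
  have hbest₁ := hbest.of_same hs (by decide) (by decide)
  have hbuf₁ : ∀ t ≤ M, s₁.arr aBuf t = ((w t : ℕ) : ℚ) := by
    intro t ht
    rw [hcopy]
    simp only [State.setReg_arr]
    rw [if_pos (by omega), Nat.sub_zero, hE.cells t ht]
  have hp₁ : s₁.reg rPre = p := by rw [hs.1 _ (by decide), hp']
  have hq₁ : s₁.reg rQ = q := by rw [hs₁.1 _ (by decide)]; simp
  have hb₁ : s₁.reg rBest = s.reg rBest := hs.1 _ (by decide)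
  clear hs hs₁ hcopy
  refine .seq (.load (m := p) (v := ((w p : ℕ) : ℚ)) hp₁ (hbuf₁ p (by omega))
    (hB.small (by have := (w p).2; omega)) ?_)
  refine .seq (.plus (v := ((p + q : ℕ) : ℚ)) ?_ (hB.small (by omega)) ?_)
  · simp [hp₁, hq₁]
  refine .seq (.load (m := p + q) (v := ((w (p + q) : ℕ) : ℚ)) ?_ (hbuf₁ (p + q) (by omega))
    (hB.small (by have := (w (p + q)).2; omega)) ?_)
  · simp
  set s₂ := ((s₁.setReg rFst ((w p : ℕ) : ℚ)).setReg rFrom ((p + q : ℕ) : ℚ)).setReg rSnd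
    ((w (p + q) : ℕ) : ℚ) with hs₂
  have hs : Same [rFst, rFrom, rSnd] [] s₁ s₂ :=
    (((Same.refl _ _ s₁).setReg (by decide) _).setReg (by decide) _).setReg (by decide) _
  have e1 : s₂.reg rFst = (w p : ℕ) := by simp [hs₂]
  have e2 : s₂.reg rSnd = (w (p + q) : ℕ) := by simp [hs₂]
  have e3 : s₂.reg rFrom = (p + q : ℕ) := by simp [hs₂]
  have e4 : s₂.reg rBest = s.reg rBest := by simp [hs₂, hb₁]
  have hbest₂ := hbest₁.of_same hs (by decide) (by decide)
  refine .branch (fun h => .branch (fun h' => ?_) fun h' => .skip ⟨hbest₂, e4.ge, ?_⟩)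
    fun h => .skip ⟨hbest₂, e4.ge, ?_⟩
  · rw [e1, e2] at h h'
    have hclosed : w p = w (p + q) :=
      Fin.ext (le_antisymm (by exact_mod_cast h) (by exact_mod_cast h'))
    refine (evalProg_runs hB (hE₁.of_same hs (by decide) (by decide) (by decide) (by decide)) hc hw
      (by omega) hpr hclosed ?_ ?_ e3 ?_ hbest₂).call ?_
    · rw [hs.1 _ (by decide), hp₁]
    · rw [hs.1 _ (by decide), hq₁]
    · intro t ht
      rw [hs.2 _ (by decide), hbuf₁ t (by omega)]
    · rintro s₃ - ⟨h1, h2, h3⟩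
      exact ⟨h1, e4 ▸ h2, fun _ => h3⟩
  · intro heq
    rw [e1, e2, heq] at h'
    exact absurd h' (lt_irrefl _)
  · intro heq
    rw [e1, e2, heq] at h
    exact absurd h (lt_irrefl _)

theorem Best.setReg {s : State} (h : Best G v gam K s) {i : ℕ} (x : ℚ)
    (hi : i ∉ [rBest, rBestP, rBestQ, rBestExact, rBestUpper]) : Best G v gam K (s.setReg i x) :=
  h.of_same (R := [i]) (A := []) ((Same.refl _ _ s).setReg (by simp) x)
    (fun r hr => by
      rw [List.mem_singleton]
      rintro rfl
      exact hi hr) (by simp)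

theorem startProg_runs (hB : Bounds n K gam D C B L) {s : State} {c : ℕ} {w : ℕ → Fin n}
    (hE : RowEnv G gam K c w s) (hc : c < numStates n K) (hw : IsWalk G v (numStates n K) w) {p : ℕ}
    (hp : p < numStates n K) (hp' : s.reg rPre = p) (hbest : Best G v gam K s) :
    Runs L B startProg s fun s' => Best G v gam K s' ∧ s.reg rBest ≤ s'.reg rBest ∧
      ∀ q, 0 < q → p + q ≤ numStates n K → w p = w (p + q) →
        lassoGain gam K w p q ≤ s'.reg rBest := by
  have hL := hB.le_L
  refine .seq (.minus (v := ((numStates n K - p : ℕ) : ℚ)) ?_ (hB.small (by omega)) ?_)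
  · rw [hE.env.states, hp', Nat.cast_sub hp.le]
  set s₁ := s.setReg rRest ((numStates n K - p : ℕ) : ℚ) with hs₁
  have hs : Same [rRest] [] s s₁ := (Same.refl _ _ s).setReg (by decide) _
  have hE₁ := hE.of_same hs (by decide) (by decide) (by decide) (by decide)
  have hp₁ : s₁.reg rPre = p := by rw [hs.1 _ (by decide), hp']
  have hb₁ : s₁.reg rBest = s.reg rBest := hs.1 _ (by decide)
  have hrest : s₁.reg rRest = (numStates n K - p : ℕ) := by simp [hs₁]
  have hbest₁ : Best G v gam K s₁ := hbest.setReg _ (by decide)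
  clear_value s₁
  refine Runs.forLoop (N := numStates n K - p) (fun j s' => Best G v gam K s' ∧
    s₁.reg rBest ≤ s'.reg rBest ∧ ∀ r < j, w p = w (p + (r + 1)) →
      lassoGain gam K w p (r + 1) ≤ s'.reg rBest) hrest hE₁.env.one (by omega) (hB.int (by omega))
    (by decide) (fun _ _ x h => ⟨⟨h.1.setReg x (by decide), h.2⟩, ⟨h.1.setReg x (by decide), h.2⟩⟩)
    ⟨hbest₁, le_rfl, fun r hr => by omega⟩ ?_ ?_
  · rintro r s₂ hr hs₂ hper ⟨h1, h2, h3⟩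
    refine (checkProg_runs hB (p := p) (r := r)
      (hE₁.of_same hs₂ (by decide) (by decide) (by decide) (by decide)) hc hw
      (by omega) (by rw [hs₂.1 _ (by decide), hp₁]) hper h1).call ?_
    rintro s₃ - ⟨g1, g2, g3⟩
    refine ⟨g1, h2.trans g2, fun r' hr' heq => ?_⟩
    rcases Nat.lt_succ_iff_lt_or_eq.1 hr' with hr' | rfl
    · exact (h3 r' hr' heq).trans g2
    · exact g3 heq
  · rintro s₂ - ⟨h1, h2, h3⟩
    refine ⟨h1, hb₁ ▸ h2, fun q hq hpq heq => ?_⟩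
    have := h3 (q - 1) (by omega)
    rw [Nat.sub_add_cancel hq] at this
    exact this heq

/-- The walk in the table for `M` steps and the age state number `c` contains no closed walk that is
better than `g`. -/
def Searched (G : Digraph (Fin n)) (v : Fin n) (gam : ℚ) (K : ℕ) (gain : ℕ → ℚ) (g : ℚ) (c : ℕ) :
    Prop :=
  1 ≤ gain (numStates n K * numStates n K + c) → ∃ w, IsWalk G v (numStates n K) w ∧
    code K w (numStates n K) = c ∧
    gain (numStates n K * numStates n K + c) = walkGain gam K w (numStates n K) ∧
    ∀ p q, 0 < q → p + q ≤ numStates n K → w p = w (p + q) → lassoGain gam K w p q ≤ g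

theorem walkProg_runs (hB : Bounds n K gam D C B L) {s : State} {c : ℕ} (hE : Env G gam K s)
    (hS : Sound G v gam K (s.arr aGain) (s.arr aWalk)) (hc : c < numStates n K)
    (hstate : s.reg rState = c) (hbest : Best G v gam K s) :
    Runs L B walkProg s fun s' => Best G v gam K s' ∧ s.reg rBest ≤ s'.reg rBest ∧
      Searched G v gam K (s.arr aGain) (s'.reg rBest) c := by
  have hL := hB.le_L
  set M := numStates n K with hM
  refine .seq (.times (v := ((M * M : ℕ) : ℚ)) ?_ (hB.row (c := 0) le_rfl (Nat.zero_le _)) ?_)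
  · rw [hE.states, hM]; push_cast; rfl
  refine .seq (.plus (v := ((M * M + c : ℕ) : ℚ)) ?_ (hB.row le_rfl hc.le) ?_)
  · simp [hstate]
  refine .seq (.load (m := M * M + c) (v := s.arr aGain (M * M + c)) ?_ rfl
    ((hS M c le_rfl hc).bits hB le_rfl) ?_)
  · simp
  set s₁ := ((s.setReg rRow ((M * M : ℕ) : ℚ)).setReg rRow ((M * M + c : ℕ) : ℚ)).setReg rHave
    (s.arr aGain (M * M + c)) with hs₁
  have hs : Same [rRow, rHave] [] s s₁ :=
    (((Same.refl _ _ s).setReg (by decide) _).setReg (by decide) _).setReg (by decide) _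
  have hE₁ := hE.of_same hs (by decide) (by decide)
  have hbest₁ := hbest.of_same hs (by decide) (by decide)
  have hb₁ : s₁.reg rBest = s.reg rBest := hs.1 _ (by decide)
  have hhave : s₁.reg rHave = s.arr aGain (M * M + c) := by simp [hs₁]
  have hrow : s₁.reg rRow = (M * M + c : ℕ) := by simp [hs₁]
  have hwalk : s₁.arr aWalk = s.arr aWalk := hs.2 _ (by decide)
  clear_value s₁
  refine .branch (fun h => ?_) (fun h => .skip ⟨hbest₁, hb₁.ge, fun h' => ?_⟩)
  · rw [hE₁.one, hhave] at h
    obtain ⟨w, hw, hcode, hgain, hcells⟩ := (hS M c le_rfl hc).resolve_left (by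
      intro h0
      rw [← hM] at h0
      linarith)
    have hR : RowEnv G gam K c w s₁ := ⟨hE₁, hrow, by rw [hwalk]; exact hcells⟩
    refine Runs.forLoop (N := M) (fun j s' => Best G v gam K s' ∧
      s₁.reg rBest ≤ s'.reg rBest ∧ ∀ p < j, ∀ q, 0 < q → p + q ≤ M → w p = w (p + q) →
        lassoGain gam K w p q ≤ s'.reg rBest) hE₁.states hE₁.one (by omega) (hB.int (by omega))
      (by decide) (fun _ _ x h => ⟨⟨h.1.setReg x (by decide), h.2⟩, ⟨h.1.setReg x (by decide), h.2⟩⟩)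
      ⟨hbest₁, le_rfl, fun r hr => by omega⟩ ?_ ?_
    · rintro p s₂ hp hs₂ hpre ⟨h1, h2, h3⟩
      refine (startProg_runs hB (hR.of_same hs₂ (by decide) (by decide) (by decide) (by decide)) hc hw
        hp hpre h1).call ?_
      rintro s₃ - ⟨g1, g2, g3⟩
      refine ⟨g1, h2.trans g2, fun p' hp' q hq hpq heq => ?_⟩
      rcases Nat.lt_succ_iff_lt_or_eq.1 hp' with hp' | rfl
      · exact (h3 p' hp' q hq hpq heq).trans g2
      · exact g3 q hq hpq heq
    · rintro s₂ - ⟨h1, h2, h3⟩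
      exact ⟨h1, hb₁ ▸ h2, fun _ => ⟨w, hw, hcode, hgain, fun p q hq hpq heq =>
        h3 p (by omega) q hq hpq heq⟩⟩
  · rw [hE₁.one, hhave] at h
    exact absurd h' (not_le.2 h)

theorem searchProg_runs (hB : Bounds n K gam D C B L) {s : State} (hE : Env G gam K s)
    (hS : Sound G v gam K (s.arr aGain) (s.arr aWalk)) (hbest : s.reg rBest = 0) :
    Runs L B searchProg s fun s' => Best G v gam K s' ∧
      ∀ c < numStates n K, Searched G v gam K (s.arr aGain) (s'.reg rBest) c := by
  have hL := hB.le_L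
  refine Runs.forLoop (N := numStates n K) (fun j s' => Best G v gam K s' ∧
    ∀ c < j, Searched G v gam K (s.arr aGain) (s'.reg rBest) c) hE.states hE.one (by omega)
    (hB.int (by omega)) (by decide)
    (fun _ _ x h => ⟨⟨h.1.setReg x (by decide), h.2⟩, ⟨h.1.setReg x (by decide), h.2⟩⟩)
    ⟨Or.inl hbest, fun c hc => by omega⟩ ?_ fun s' _ h => h
  rintro c s₁ hc hs₁ hstate ⟨h1, h2⟩
  have hgain : s₁.arr aGain = s.arr aGain := hs₁.2 _ (by decide)
  have hwalk : s₁.arr aWalk = s.arr aWalk := hs₁.2 _ (by decide)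
  refine (walkProg_runs (v := v) hB (hE.of_same hs₁ (by decide) (by decide))
    (by rw [hgain, hwalk]; exact hS) hc hstate h1).call ?_
  rintro s₂ - ⟨g1, g2, g3⟩
  rw [hgain] at g3
  refine ⟨g1, fun c' hc' => ?_⟩
  rcases Nat.lt_succ_iff_lt_or_eq.1 hc' with hc' | rfl
  · intro hg
    obtain ⟨w, e1, e2, e3, e4⟩ := h2 c' hc' hg
    exact ⟨w, e1, e2, e3, fun p q hq hpq heq => (e4 p q hq hpq heq).trans g2⟩
  · exact g3

end Search

/-! ### The complete program -/

notation "rFactor" => 77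

/-- Computes `K`, by comparing the powers of `gam` with `eps * (1 - gam) / lam`, and the number `M` of
age states. -/
def setupProg : Prog :=
  .const rOne 1 ;; .minus rThr rOne rGam ;; .times rThr rEps rThr ;; .divide rThr rThr rLam ;;
  .const rGamK 1 ;;
  .loop rStop rZero
    (.branch rGamK rThr (.const rStop 1) (.times rGamK rGamK rGam ;; .plus rK rK rOne)) ;;
  .plus rBase rK rOne ;; .plus rM rN rZero ;; forLoop 17 18 rN (.times rM rM rBase) ;;
  .plus rWidth rM rOne

/-- Writes the recorded path and its rewards to the output registers. -/
def outputProg : Prog :=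
  .minus rFactor rOne rGam ;; .divide rFactor rLam rFactor ;;
  .times 4 rFactor rBestExact ;; .times 5 rFactor rBestExact ;; .times 6 rFactor rBestUpper ;;
  .times 7 rFactor rBest ;;
  .plus 0 rBestP rZero ;; .plus 1 rBestQ rZero ;; .plus 2 rBestP rZero ;; .plus 3 rBestQ rZero

/-- Finds an ultimately periodic path with the least mean lower truncated cost, and its rewards. -/
def mainProg : Prog := setupProg ;; tableProg ;; searchProg ;; outputProg

section Main

variable {n : ℕ} {G : Digraph (Fin n)} {v : Fin n} {lam gam eps : ℚ} {K D C B L : ℕ}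

theorem Bounds.one_sub_bits (hB : Bounds n K gam D C B L) : 4 * bitLen (1 - gam) ≤ B := by
  have h1 : Fits D 1 gam := by simpa using hB.pow 1 (by omega)
  have h2 : Fits D 1 1 := by simpa using hB.pow 0 (by omega)
  exact hB.four_bits _ ((h2.sub h1).mono
    (le_trans (by omega) ((four_mul_add_le (numStates n K)).trans hB.le_C)))

open Classical in
theorem setupProg_runs (hB : Bounds n K gam D C B L) (hlam : 0 < lam) (hlb : 4 * bitLen lam ≤ B)
    (heb : 4 * bitLen eps ≤ B) (hK : ∀ k, gam ^ k ≤ eps * (1 - gam) / lam ↔ K ≤ k) {s : State}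
    (hn : s.reg rN = n) (hl : s.reg rLam = lam) (hg : s.reg rGam = gam) (he : s.reg rEps = eps)
    (h0 : s.reg rZero = 0) (hk : s.reg rK = 0) (hflag : s.reg rStop = 0)
    (hadj : ∀ i j : Fin n, s.arr aAdj (i * n + j) = if G.Adj i j then 1 else 0) :
    Runs L B setupProg s (Env G gam K) := by
  have hL := hB.le_L
  have hnM := le_numStates n K
  have hKM := succ_le_numStates (K := K) hB.n_pos
  have hsub := hB.one_sub_bits
  have h1 := bitLen_mul_le eps (1 - gam)
  have h2 := bitLen_div_le (eps * (1 - gam)) lam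
  refine .seq (.const hB.one (.seq (.minus (v := 1 - gam) ?_ (by omega) ?_)))
  · simp [hg]
  refine .seq (.times (v := eps * (1 - gam)) ?_ (by omega) ?_)
  · simp [he]
  refine .seq (.divide (v := eps * (1 - gam) / lam) ?_ ?_ (by omega) (.seq (.const hB.one (.seq ?_))))
  · simpa [hl] using hlam.ne'
  · simp [hl]
  set s₁ := ((((s.setReg rOne 1).setReg rThr (1 - gam)).setReg rThr (eps * (1 - gam))).setReg rThr
    (eps * (1 - gam) / lam)).setReg rGamK 1 with hs₁
  have hsame : Same [rOne, rThr, rGamK] [] s s₁ :=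
    (((((Same.refl _ _ s).setReg (by decide) _).setReg (by decide) _).setReg (by decide) _).setReg
      (by decide) _).setReg (by decide) _
  have e1 : s₁.reg rOne = 1 := by simp [hs₁]
  have e2 : s₁.reg rThr = eps * (1 - gam) / lam := by simp [hs₁]
  have e3 : s₁.reg rGamK = 1 := by simp [hs₁]
  have e4 : s₁.reg rN = n := by rw [hsame.1 _ (by decide), hn]
  have e5 : s₁.reg rGam = gam := by rw [hsame.1 _ (by decide), hg]
  have e6 : s₁.reg rZero = 0 := by rw [hsame.1 _ (by decide), h0]
  have e7 : s₁.reg rK = 0 := by rw [hsame.1 _ (by decide), hk]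
  have e8 : s₁.reg rStop = 0 := by rw [hsame.1 _ (by decide), hflag]
  have e9 : s₁.arr aAdj = s.arr aAdj := hsame.2 _ (by decide)
  clear_value s₁
  clear hsame
  -- the loop leaves the registers `rK` and `rGamK` at `K` and `gam ^ K`
  have hloop : Runs L B (.loop rStop rZero
      (.branch rGamK rThr (.const rStop 1) (.times rGamK rGamK rGam ;; .plus rK rK rOne))) s₁
      fun s' => s'.reg rK = K ∧ s'.reg rGamK = gam ^ K := by
    refine Runs.loop (N := K + 1) (by omega) (fun m s' => Same [rK, rGamK, rStop] [] s₁ s' ∧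
      ((s'.reg rStop = 1 ∧ s'.reg rK = K ∧ s'.reg rGamK = gam ^ K) ∨
        ∃ k : ℕ, k + m = K + 1 ∧ 0 < m ∧ s'.reg rStop = 0 ∧ s'.reg rK = k ∧ s'.reg rGamK = gam ^ k))
      ⟨Same.refl _ _ _, Or.inr ⟨0, by simp, by omega, e8, by simpa using e7, by simpa using e3⟩⟩ ?_ ?_
    · rintro m s' ⟨hs, h | ⟨k, -, -, h, -⟩⟩ hlt
      · exact h.2
      · rw [h, hs.1 rZero (by decide), e6] at hlt
        exact absurd hlt (lt_irrefl _)
    · rintro m s' ⟨hs, h | ⟨k, hkm, hm, f1, f2, f3⟩⟩ hle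
      · rw [h.1, hs.1 rZero (by decide), e6] at hle
        norm_num at hle
      · refine ⟨hm, .branch (fun h => .const hB.one ?_) (fun h => ?_)⟩
        · rw [f3, hs.1 rThr (by decide), e2, hK] at h
          obtain rfl : k = K := by omega
          exact ⟨hs.setReg (by decide) _, Or.inl ⟨by simp, by simp [f2], by simp [f3]⟩⟩
        · rw [f3, hs.1 rThr (by decide), e2] at h
          have hlt : k < K := by
            by_contra hge
            exact absurd h (not_lt.2 ((hK k).2 (not_lt.1 hge)))
          refine .seq (.times (v := gam ^ (k + 1)) ?_ (hB.pow_bits (by omega)) ?_)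
          · rw [f3, hs.1 rGam (by decide), e5, pow_succ]
          refine .plus (v := ((k + 1 : ℕ) : ℚ)) ?_ (hB.small (by omega)) ?_
          · simp [f2, hs.1 rOne (by decide), e1]
          · exact ⟨(hs.setReg (by decide) _).setReg (by decide) _,
              Or.inr ⟨k + 1, by omega, by omega, by simp [f1], by simp, by simp⟩⟩
  refine hloop.call fun s₂ hs₂ h => ?_
  obtain ⟨hK₂, hgK₂⟩ := h
  have f1 : s₂.reg rOne = 1 := by rw [hs₂.1 _ (by decide), e1]
  have f4 : s₂.reg rN = n := by rw [hs₂.1 _ (by decide), e4]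
  have f5 : s₂.reg rGam = gam := by rw [hs₂.1 _ (by decide), e5]
  have f6 : s₂.reg rZero = 0 := by rw [hs₂.1 _ (by decide), e6]
  have f9 : s₂.arr aAdj = s.arr aAdj := by rw [hs₂.2 _ (by decide), e9]
  refine .seq (.plus (v := ((K + 1 : ℕ) : ℚ)) ?_ (hB.small (by omega)) ?_)
  · simp [hK₂, f1]
  refine .seq (.plus (v := (n : ℚ)) ?_ (hB.small (by omega)) (.seq ?_))
  · simp [f4, f6]
  set s₃ := (s₂.setReg rBase ((K + 1 : ℕ) : ℚ)).setReg rM (n : ℚ) with hs₃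
  refine Runs.forLoop (N := n) (fun k s' => s'.reg rM = (n * (K + 1) ^ k : ℕ)) ?_ ?_ (by omega)
    (hB.int (by omega)) (by decide) (fun _ _ _ h => ⟨h, h⟩) ?_ ?_ ?_
  · simp [hs₃, f4]
  · simp [hs₃, f1]
  · simp [hs₃]
  · intro k s' hk hs _ hI
    have : n * (K + 1) ^ (k + 1) ≤ numStates n K :=
      Nat.mul_le_mul_left _ (Nat.pow_le_pow_right (by omega) hk)
    refine .times (v := ((n * (K + 1) ^ (k + 1) : ℕ) : ℚ)) ?_ (hB.small (by omega)) ?_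
    · rw [hI, hs.1 rBase (by decide)]
      simp [hs₃, pow_succ, mul_assoc]
    · simp
  · intro s₄ hs₄ hM
    refine .plus (v := ((numStates n K + 1 : ℕ) : ℚ)) ?_ (hB.small (by omega)) ?_
    · rw [hM, hs₄.1 rOne (by decide)]
      simp [hs₃, f1, numStates]
    · refine ⟨?_, ?_, ?_, ?_, ?_, ?_, ?_, ?_, ?_, ?_⟩
      · simp [hs₄.1 rN (by decide), hs₃, f4]
      · simp [hs₄.1 rGam (by decide), hs₃, f5]
      · simp [hs₄.1 rOne (by decide), hs₃, f1]
      · simp [hs₄.1 rZero (by decide), hs₃, f6]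
      · simp [hs₄.1 rK (by decide), hs₃, hK₂]
      · simp [hs₄.1 rBase (by decide), hs₃]
      · simp [hM, numStates]
      · simp
      · simp [hs₄.1 rGamK (by decide), hs₃, hgK₂]
      · intro i j
        rw [State.setReg_arr, hs₄.2 aAdj (by decide)]
        simp only [hs₃, State.setReg_arr]
        rw [f9, hadj]

/-- The contents of the output registers and arrays. -/
structure Output (lam gam : ℚ) (K : ℕ) (w : ℕ → Fin n) (p q : ℕ) (s : State) : Prop where
  out₁ : OutputsPath s 0 1 1 (lasso w p q)
  out₂ : OutputsPath s 2 3 2 (lasso w p q)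
  exact₁ : s.reg 4 = lassoReward lam gam (costExact gam (lasso w p q)) p q
  exact₂ : s.reg 5 = lassoReward lam gam (costExact gam (lasso w p q)) p q
  upper : s.reg 6 = lassoReward lam gam (costUpper gam K (lasso w p q)) p q
  lower : s.reg 7 = lassoReward lam gam (costLower gam K (lasso w p q)) p q

theorem outputProg_runs (hB : Bounds n K gam D C B L) (hlb : 4 * bitLen lam ≤ B) {s : State}
    (hE : Env G gam K s) (hl : s.reg rLam = lam) {w : ℕ → Fin n} {p q : ℕ}
    (hR : Recorded G v gam K w p q s) : Runs L B outputProg s (Output lam gam K w p q) := by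
  have hsub := hB.one_sub_bits
  have hA := bitLen_div_le lam (1 - gam)
  have hq : q ≤ numStates n K := by have := hR.le; omega
  have hp : p ≤ numStates n K := by have := hR.le; omega
  have hbits : ∀ x : ℚ, Fits D q x → bitLen (lam / (1 - gam) * ((q - x) / q)) ≤ B := by
    intro x hx
    have h1 := (hB.quotient_bits hq hx).2
    have h2 := bitLen_mul_le (lam / (1 - gam)) ((q - x) / q)
    omega
  obtain ⟨g1, g2, g3⟩ := hB.fits_period w hR.le
  have hne : 1 - gam ≠ 0 := by have := hB.gam_lt; linarith
  refine .seq (.minus (v := 1 - gam) ?_ (by omega) ?_)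
  · rw [hE.one, hE.decay]
  refine .seq (.divide (v := lam / (1 - gam)) ?_ ?_ (by omega) ?_)
  · simpa using hne
  · simp [hl]
  refine .seq (.times (v := lassoReward lam gam (costExact gam (lasso w p q)) p q) ?_ (hbits _ g1) ?_)
  · simp [hR.exact, lassoReward]
  refine .seq (.times (v := lassoReward lam gam (costExact gam (lasso w p q)) p q) ?_ (hbits _ g1) ?_)
  · simp [hR.exact, lassoReward]
  refine .seq (.times (v := lassoReward lam gam (costUpper gam K (lasso w p q)) p q) ?_ (hbits _ g2) ?_)
  · simp [hR.upper, lassoReward]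
  refine .seq (.times (v := lassoReward lam gam (costLower gam K (lasso w p q)) p q) ?_ (hbits _ g3) ?_)
  · simp [hR.gain, lassoReward, lassoGain]
  refine .seq (.plus (v := (p : ℚ)) ?_ (hB.small (by omega)) ?_)
  · simp [hR.fst, hE.zero]
  refine .seq (.plus (v := (q : ℚ)) ?_ (hB.small (by omega)) ?_)
  · simp [hR.snd, hE.zero]
  refine .seq (.plus (v := (p : ℚ)) ?_ (hB.small (by omega)) ?_)
  · simp [hR.fst, hE.zero]
  refine .plus (v := (q : ℚ)) ?_ (hB.small (by omega)) ?_
  · simp [hR.snd, hE.zero]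
  have hmod : ∀ t, p + (t - p) % q < p + q := fun t =>
    Nat.add_lt_add_left (Nat.mod_lt _ hR.pos) p
  refine ⟨⟨p, q, hR.pos, by simp, by simp, fun t ht => ?_, fun t ht => ?_⟩,
    ⟨p, q, hR.pos, by simp, by simp, fun t ht => ?_, fun t ht => ?_⟩, ?_, ?_, ?_, ?_⟩
  · rw [lasso_of_lt w (by omega)]
    exact hR.out₁ t (by omega)
  · rw [lasso, if_neg (by omega)]
    exact hR.out₁ _ (hmod t)
  · rw [lasso_of_lt w (by omega)]
    exact hR.out₂ t (by omega)
  · rw [lasso, if_neg (by omega)]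
    exact hR.out₂ _ (hmod t)
  · simp
  · simp
  · simp
  · simp

/-- The program outputs an ultimately periodic path whose mean lower truncated cost is least possible:
up to a constant, the costs of every path grow at least at this rate. -/
theorem mainProg_runs (hB : Bounds n K gam D C B L) (hlam : 0 < lam) (hlb : 4 * bitLen lam ≤ B)
    (heb : 4 * bitLen eps ≤ B) (hK : ∀ k, gam ^ k ≤ eps * (1 - gam) / lam ↔ K ≤ k)
    (hpath : ∃ π, IsPathFrom G v π) :
    Runs L B mainProg (inputState G v lam gam eps) fun s => ∃ w p q,
      IsWalk G v (numStates n K) w ∧ 0 < q ∧ p + q ≤ numStates n K ∧ w p = w (p + q) ∧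
      Output lam gam K w p q s ∧ ∀ π, IsPathFrom G v π → ∀ N : ℕ,
        (1 - lassoGain gam K w p q) * N - (1 - lassoGain gam K w p q) * (numStates n K) ≤
          ∑ t ∈ Finset.range N, costLower gam K π t := by
  classical
  refine .seq ((setupProg_runs (G := G) hB hlam hlb heb hK (by simp [inputState])
    (by simp [inputState]) (by simp [inputState]) (by simp [inputState]) (by simp [inputState])
    (by simp [inputState]) (by simp [inputState]) ?_).call fun s₁ hs₁ hE₁ => .seq ?_)
  · intro i j
    simp only [inputState, true_and]
    refine if_congr ⟨?_, fun h => ⟨i, j, rfl, h⟩⟩ rfl rfl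
    rintro ⟨i', j', heq, h⟩
    obtain ⟨h1, h2⟩ := row_inj j.2 j'.2 heq
    rwa [Fin.ext h1, Fin.ext h2]
  have hgain₁ : ∀ m, s₁.arr aGain m = 0 := by
    intro m
    rw [hs₁.2 _ (by decide)]
    simp [inputState]
  have hl₁ : s₁.reg rLam = lam := by rw [hs₁.1 _ (by decide)]; simp [inputState]
  have hb₁ : s₁.reg rBest = 0 := by rw [hs₁.1 _ (by decide)]; simp [inputState]
  have hv₁ : s₁.reg rStart = (v : ℕ) := by rw [hs₁.1 _ (by decide)]; simp [inputState]
  refine (tableProg_runs hB hE₁ hv₁ hgain₁).call ?_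
  rintro s₂ hs₂ ⟨hS₂, hO₂⟩
  have hE₂ := hE₁.of_same hs₂ (by decide) (by decide)
  refine .seq ((searchProg_runs hB hE₂ hS₂ (by rw [hs₂.1 _ (by decide), hb₁])).call ?_)
  rintro s₃ hs₃ ⟨hbest, hsearch⟩
  have hE₃ := hE₂.of_same hs₃ (by decide) (by decide)
  have hl₃ : s₃.reg rLam = lam := by rw [hs₃.1 _ (by decide), hs₂.1 _ (by decide), hl₁]
  -- for every walk with `M` steps, the table has one that is as good and has been searched
  have hopt : ∀ w, IsWalk G v (numStates n K) w → ∃ w', IsWalk G v (numStates n K) w' ∧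
      ageState K w' (numStates n K) = ageState K w (numStates n K) ∧
      ∑ t ∈ Finset.range (numStates n K), costLower gam K w' t ≤
        ∑ t ∈ Finset.range (numStates n K), costLower gam K w t ∧
      ∀ p q, 0 < q → p + q ≤ numStates n K → w' p = w' (p + q) →
        lassoGain gam K w' p q ≤ s₃.reg rBest := by
    intro w hw
    have h1 := hO₂ w hw
    obtain ⟨w', hw', hcode, hgain, hall⟩ := hsearch _ (code_lt w (numStates n K))
      ((one_le_walkGain hB.gam_pos hB.gam_lt w _).trans h1)
    refine ⟨w', hw', code_inj.1 hcode, ?_, hall⟩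
    rw [hgain, walkGain, walkGain] at h1
    linarith
  have hne : s₃.reg rBest ≠ 0 := by
    obtain ⟨π, hπ⟩ := hpath
    obtain ⟨w', hw', -, -, hall⟩ := hopt π ⟨hπ.1, fun i _ => hπ.2 i⟩
    obtain ⟨i, j, hij, hj, heq⟩ := exists_repeat (ageState K w')
    rw [card_ageState] at hj
    have h1 := hall i (j - i) (by omega) (by rw [numStates]; omega)
      (by rw [Nat.add_sub_cancel' hij.le]; exact congrArg Prod.fst heq)
    have h2 := lassoGain_pos (K := K) hB.gam_pos hB.gam_lt w' i (by omega : 0 < j - i)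
    exact (h2.trans_le h1).ne'
  obtain ⟨w, p, q, hR⟩ := hbest.resolve_left hne
  refine (outputProg_runs hB hlb hE₃ hl₃ hR).call fun s₄ _ hout =>
    ⟨w, p, q, hR.walk, hR.pos, hR.le, hR.closed, hout, fun π hπ N => ?_⟩
  rw [hR.gain] at hopt
  exact le_sum_costLower hB.gam_pos (lassoGain_le_one hB.gam_pos w p hR.pos) hopt hπ N

theorem lassoReward_anti (hlam : 0 < lam) (h1 : gam < 1) {c c' : ℕ → ℚ} (h : ∀ t, c t ≤ c' t)
    (p q : ℕ) : lassoReward lam gam c' p q ≤ lassoReward lam gam c p q := by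
  have hA : 0 ≤ lam / (1 - gam) := div_nonneg hlam.le (by linarith)
  refine mul_le_mul_of_nonneg_left (div_le_div_of_nonneg_right ?_ (Nat.cast_nonneg q)) hA
  exact sub_le_sub_left (Finset.sum_le_sum fun t _ => h t) _

theorem lassoReward_sub_le (hlam : 0 < lam) (h0 : 0 < gam) (h1 : gam < 1)
    (hK : gam ^ K ≤ eps * (1 - gam) / lam) (w : ℕ → Fin n) (p : ℕ) {q : ℕ} (hq : 0 < q) :
    lassoReward lam gam (costLower gam K w) p q - lassoReward lam gam (costUpper gam K w) p q ≤ eps := by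
  have hq' : (0 : ℚ) < q := by exact_mod_cast hq
  have hs : (0 : ℚ) < 1 - gam := by linarith
  have hA : 0 < lam / (1 - gam) := div_pos hlam hs
  have hsum : ∑ t ∈ Finset.Ico (p + q) (p + q + q), costUpper gam K w t ≤
      ∑ t ∈ Finset.Ico (p + q) (p + q + q), costLower gam K w t + q * gam ^ K := by
    refine (Finset.sum_le_sum fun t _ => costUpper_le_costLower_add h0).trans ?_
    rw [Finset.sum_add_distrib]
    simp
  rw [lassoReward, lassoReward, ← mul_sub, ← sub_div]
  calc lam / (1 - gam) * _ ≤ lam / (1 - gam) * gam ^ K := by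
        refine mul_le_mul_of_nonneg_left ?_ hA.le
        rw [div_le_iff₀ hq']
        linarith
    _ ≤ lam / (1 - gam) * (eps * (1 - gam) / lam) := mul_le_mul_of_nonneg_left hK hA.le
    _ = eps := by field_simp

/-- The resources that suffice, where `b` bounds the bit length of the input numbers. -/
theorem exists_bounds (hn : 0 < n) (h0 : 0 < gam) (h1 : gam < 1) {b : ℕ} (hb : bitLen gam ≤ b) :
    Bounds n K gam (gam.den ^ (2 * numStates n K + 2)) (4 * (numStates n K + 1) ^ 3)
      (40 * (numStates n K + b + 1) ^ 3) (2 * numStates n K + 2) := by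
  refine ⟨hn, h0, h1, fun x hx => ?_, fun l hl => Fits.pow h0.le h1.le hl, le_rfl, le_rfl⟩
  have e1 := hx.bitLen_le (pow_pos gam.den_pos _)
  have e2 := size_le_self (4 * (numStates n K + 1) ^ 3)
  have e3 := size_pow_le gam.den (2 * numStates n K + 2)
  have e4 : Nat.size gam.den ≤ b := (Nat.le_add_left _ _).trans hb
  set m := numStates n K
  have e5 : (2 * m + 2) * Nat.size gam.den ≤ (2 * m + 2) * b := Nat.mul_le_mul_left _ e4
  have e6 : (m + 1) ^ 3 ≤ (m + b + 1) ^ 3 := Nat.pow_le_pow_left (by omega) 3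
  have e7 : (m + 1) * b ≤ (m + b + 1) * (m + b + 1) := Nat.mul_le_mul (by omega) (by omega)
  have e8 : (m + b + 1) * (m + b + 1) ≤ (m + b + 1) ^ 3 := by
    rw [← pow_two]; exact Nat.pow_le_pow_right (by omega) (by omega)
  have e9 : 1 ≤ (m + b + 1) ^ 3 := Nat.one_le_pow _ _ (by omega)
  have e10 : (2 * m + 2) * b = 2 * ((m + 1) * b) := by ring
  omega

end Main

end RobotRouting

theorem mainTheorem1 :
    ∃ (prog : RobotRouting.Prog) (P Q : Polynomial ℕ),
      ∀ (n : ℕ) (G : Digraph (Fin n)) (v₀ : Fin n) (lam gam eps : ℚ),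
        0 < lam → 0 < gam → gam < 1 → 0 < eps →
        (∃ π : ℕ → Fin n, RobotRouting.IsPathFrom G v₀ π) →
        ∀ K : ℕ, K = RobotRouting.truncBound lam gam eps →
        ∃ (s : RobotRouting.State) (steps bits : ℕ) (πunder πover : ℕ → Fin n),
          -- the program halts, within the claimed time
          RobotRouting.Exec prog (RobotRouting.inputState G v₀ lam gam eps) s steps bits ∧
          steps ≤ P.eval (n * (K + 1) ^ n) ∧
          bits ≤ Q.eval (n * (K + 1) ^ n + RobotRouting.bitLen lam + RobotRouting.bitLen gam +
            RobotRouting.bitLen eps) ∧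
          -- it outputs two infinite paths from the initial node
          RobotRouting.IsPathFrom G v₀ πunder ∧
          RobotRouting.IsPathFrom G v₀ πover ∧
          RobotRouting.OutputsPath s 0 1 1 πunder ∧
          RobotRouting.OutputsPath s 2 3 2 πover ∧
          -- together with their exact and their approximate limit-average rewards
          ((s.reg 4 : ℚ) : ℝ) = RobotRouting.rAv lam gam πunder ∧
          ((s.reg 5 : ℚ) : ℝ) = RobotRouting.rAv lam gam πover ∧
          ((s.reg 6 : ℚ) : ℝ) = RobotRouting.rAvUnder lam gam K πunder ∧
          ((s.reg 7 : ℚ) : ℝ) = RobotRouting.rAvOver lam gam K πover ∧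
          -- which enclose the reward value up to the error bound
          RobotRouting.rAvUnder lam gam K πunder ≤ RobotRouting.rAv lam gam πunder ∧
          RobotRouting.rAv lam gam πunder ≤ RobotRouting.RAv G lam gam v₀ ∧
          RobotRouting.RAv G lam gam v₀ ≤ RobotRouting.rAvOver lam gam K πover ∧
          RobotRouting.rAvOver lam gam K πover - RobotRouting.rAvUnder lam gam K πunder ≤ eps ∧
          RobotRouting.RAv G lam gam v₀ - eps ≤ RobotRouting.rAv lam gam πover := by
  obtain ⟨P, hP⟩ := RobotRouting.mainProg.exists_polynomial_time_le
  refine ⟨RobotRouting.mainProg, P.comp (2 * Polynomial.X + 2), 40 * (Polynomial.X + 1) ^ 3, ?_⟩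
  intro n G v₀ lam gam eps hlam h0 h1 heps hpath K hK
  have hn : 0 < n := v₀.pos
  have hKiff : ∀ k, gam ^ k ≤ eps * (1 - gam) / lam ↔ K ≤ k := fun k => by
    rw [hK, RobotRouting.truncBound_le_iff hlam h0 h1 heps]
  set b := RobotRouting.bitLen lam + RobotRouting.bitLen gam + RobotRouting.bitLen eps with hb
  have hB := RobotRouting.exists_bounds (K := K) hn h0 h1 (b := b) (by omega)
  have hle : 4 * b ≤ 40 * (RobotRouting.numStates n K + b + 1) ^ 3 := by
    have := Nat.le_self_pow (n := 3) (by norm_num) (RobotRouting.numStates n K + b + 1)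
    omega
  obtain ⟨s, t, bits, hexec, ht, hbits, w, p, q, hw, hq, hpq, hclosed, hout, hlow⟩ :=
    RobotRouting.mainProg_runs hB hlam (by omega) (by omega) hKiff hpath
  set ℓ := RobotRouting.lasso w p q with hℓ
  have hpathℓ : RobotRouting.IsPathFrom G v₀ ℓ := hw.lasso hq hpq hclosed
  have e1 : RobotRouting.rAv (lam : ℝ) (gam : ℝ) ℓ = _ := RobotRouting.rAv_lasso h1 w hq
  have e2 : RobotRouting.rAvUnder (lam : ℝ) (gam : ℝ) K ℓ = _ := RobotRouting.rAvUnder_lasso w hq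
  have e3 : RobotRouting.rAvOver (lam : ℝ) (gam : ℝ) K ℓ = _ := RobotRouting.rAvOver_lasso w hq
  -- the over-approximation of the computed path bounds the rewards of all paths
  have hall : ∀ π, RobotRouting.IsPathFrom G v₀ π →
      RobotRouting.rAv (lam : ℝ) (gam : ℝ) π ≤ RobotRouting.rAvOver (lam : ℝ) (gam : ℝ) K ℓ := by
    intro π hπ
    have := RobotRouting.rAv_le hlam h0 h1 (C := (1 - RobotRouting.lassoGain gam K w p q) *
      (RobotRouting.numStates n K)) (hlow π hπ)
    rw [e3, RobotRouting.lassoReward]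
    push_cast
    rw [RobotRouting.lassoGain] at this
    push_cast at this
    exact this
  have hunder : RobotRouting.rAvUnder (lam : ℝ) (gam : ℝ) K ℓ ≤
      RobotRouting.rAv (lam : ℝ) (gam : ℝ) ℓ := by
    rw [e1, e2]
    exact_mod_cast RobotRouting.lassoReward_anti hlam h1
      (fun t => RobotRouting.costExact_le_costUpper h0 h1) p q
  have hgap : RobotRouting.rAvOver (lam : ℝ) (gam : ℝ) K ℓ -
      RobotRouting.rAvUnder (lam : ℝ) (gam : ℝ) K ℓ ≤ eps := by
    rw [e2, e3]
    exact_mod_cast RobotRouting.lassoReward_sub_le hlam h0 h1 ((hKiff K).2 le_rfl) ℓ p hq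
  have hle_sup : RobotRouting.rAv (lam : ℝ) (gam : ℝ) ℓ ≤ RobotRouting.RAv G lam gam v₀ :=
    le_csSup ⟨_, by rintro r ⟨π, hπ, rfl⟩; exact hall π hπ⟩ ⟨ℓ, hpathℓ, rfl⟩
  have hsup_le : RobotRouting.RAv G lam gam v₀ ≤ RobotRouting.rAvOver (lam : ℝ) (gam : ℝ) K ℓ :=
    csSup_le ⟨_, ℓ, hpathℓ, rfl⟩ (by rintro r ⟨π, hπ, rfl⟩; exact hall π hπ)
  refine ⟨s, t, bits, ℓ, ℓ, hexec, ?_, ?_, hpathℓ, hpathℓ, hout.out₁, hout.out₂, ?_, ?_, ?_, ?_,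
    hunder, hle_sup, hsup_le, hgap, by linarith⟩
  · have := ht.trans (hP _)
    simpa [Polynomial.eval_comp, RobotRouting.numStates] using this
  · have : n * (K + 1) ^ n + RobotRouting.bitLen lam + RobotRouting.bitLen gam +
        RobotRouting.bitLen eps = RobotRouting.numStates n K + b := by
      rw [hb, RobotRouting.numStates]; ring
    rw [this]
    simpa using hbits
  · rw [hout.exact₁, e1]
  · rw [hout.exact₂, e1]
  · rw [hout.upper, e2]
  · rw [hout.lower, e3]
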